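/- \textbf{Theorem (duality).} Let $(\Omega,\mathcal F,\mathbb P)$ be a probability space and let $p:\Omega\to(0,1]$ be measurable with $p_-=\inf_\Omega p>0$. Assume that there is a constant $K\ge 1$ with $$\mathbb P(A)^{\,\inf_A p-\sup_A p}\le K\qquad\text{for all } A\in\mathcal F \text{ with } \mathbb P(A)>0 .$$ For a nonnegative measurable $g$ and an exponent $r:\Omega\to(0,\infty]$ put $\rho_r(g)=\int_{\{r<\infty\}}g^{\,r}\,d\mathbb P+\operatorname{ess\,sup}_{\{r=\infty\}}g$ and $\|g\|_{r(\cdot)}=\inf\{t>0:\rho_r(g/t)\le1\}$; $g\in L^{r(\cdot)}$ means $\rho_r(g/t)<\infty$ for some $t>0$. Functions and scalars are real or complex, fixed throughout. Let $(\mathcal F_n)_{n\ge0}$ be a filtration in $\mathcal F$. For a martingale $f=(f_n)_{n\ge0}$ let $$s(f)=\Big(\sum_{n\ge1}\mathbb E\big(|f_n-f_{n-1}|^2\,\big|\,\mathcal F_{n-1}\big)\Big)^{1/2}$$ (conditional expectations of nonnegative functions, with values in $[0,\infty]$), and let $H^s_{p(\cdot)}$ be the space of the martingales with $s(f)\in L^{p(\cdot)}$,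 with $\|f\|_{H^s_{p(\cdot)}}=\|s(f)\|_{p(\cdot)}$. Its dual $(H^s_{p(\cdot)})^*$ consists of the linear functionals $l$ on $H^s_{p(\cdot)}$ with $\|l\|=\sup\{|l(f)|:\|f\|_{H^s_{p(\cdot)}}\le1\}<\infty$. Put $\alpha=1/p-1$ (so $1/\alpha=\infty$ where $p=1$). Let $\Lambda_2(\alpha(\cdot))$ be the space of all $\varphi\in L^2$ that are measurable with respect to $\sigma(\bigcup_n\mathcal F_n)$ (up to null sets), satisfy $\mathbb E(\varphi\,|\,\mathcal F_0)=0$, and have finite norm $$\|\varphi\|_{\Lambda_2(\alpha(\cdot))}=\sup_{\tau}\ \|\chi_{\{\tau<\infty\}}\|_{1/\alpha(\cdot)}^{-1}\,\|\chi_{\{\tau<\infty\}}\|_2^{-1}\,\|\varphi-\varphi^\tau\|_2 ,$$ where $\tau$ runs over all stopping times with values in $\{0,1,\dots,\infty\}$, $\varphi^\tau=\mathbb E(\varphi|\mathcal F_n)$ on $\{\tau=n\}$, $\varphi^\tau=\mathbb E(\varphi|\sigma(\bigcup_n\mathcal F_n))$ on $\{\tau=\infty\}$, and a stopping time with $\mathbb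 P(\tau<\infty)=0$ contributes $0$. Then $(H^s_{p(\cdot)})^*=\Lambda_2(\alpha(\cdot))$ with equivalent norms: there is a linear bijection $\varphi\mapsto l_\varphi$ from $\Lambda_2(\alpha(\cdot))$ onto $(H^s_{p(\cdot)})^*$ such that, for every $f\in L^2$, the martingale $(\mathbb E(f|\mathcal F_n))_n$ belongs to $H^s_{p(\cdot)}$ and $$l_\varphi\big((\mathbb E(f|\mathcal F_n))_n\big)=\mathbb E(f\varphi),$$ and there are constants $c,C>0$, depending only on $(\Omega,\mathcal F,\mathbb P)$, $p$ and the scalar field and not on the filtration, such that $c\,\|\varphi\|_{\Lambda_2(\alpha(\cdot))}\le\|l_\varphi\|\le C\,\|\varphi\|_{\Lambda_2(\alpha(\cdot))}$ for all $\varphi\in\Lambda_2(\alpha(\cdot))$. -/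

import Mathlib

open MeasureTheory Filter Set
open scoped ENNReal NNReal

noncomputable section

namespace VarHardy

variable {Ω : Type*} {m : MeasurableSpace Ω} {𝕜 : Type*} [RCLike 𝕜]

/-! ### Variable exponents and variable Lebesgue quasi-norms -/

/-- `p_-(A)`, the infimum of the exponent `p` over the set `A`. -/
def lowerExp (p : Ω → ℝ) (A : Set Ω) : ℝ := sInf (p '' A)

/-- `p_+(A)`, the supremum of the exponent `p` over the set `A`. -/
def upperExp (p : Ω → ℝ) (A : Set Ω) : ℝ := sSup (p '' A)

/-- The condition `P(A) ^ (p_-(A) - p_+(A)) ≤ K` for some constant `K ≥ 1` and all measurable sets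
`A` of positive probability. -/
def OscillationCondition (μ : Measure Ω) (p : Ω → ℝ) : Prop :=
  ∃ K : ℝ, 1 ≤ K ∧ ∀ A : Set Ω, MeasurableSet A → μ A ≠ 0 →
    μ.real A ^ (lowerExp p A - upperExp p A) ≤ K

/-- The modular `ρ(g) = ∫_{r < ∞} g ^ r dμ + ess sup_{r = ∞} g` of a nonnegative function, for an
exponent `r` with values in `(0, ∞]`. -/
def varModular (μ : Measure Ω) (r : Ω → ℝ≥0∞) (g : Ω → ℝ≥0∞) : ℝ≥0∞ :=
  (∫⁻ x in {x | r x ≠ ∞}, g x ^ (r x).toReal ∂μ) + essSup g (μ.restrict {x | r x = ∞})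

/-- The quasi-norm `inf {t > 0 : ρ(g / t) ≤ 1}` (with `inf ∅ = ∞`). -/
def varNorm (μ : Measure Ω) (r : Ω → ℝ≥0∞) (g : Ω → ℝ≥0∞) : ℝ≥0∞ :=
  ⨅ (t : ℝ≥0) (_ : 0 < t) (_ : varModular μ r (fun x => g x / t) ≤ 1), (t : ℝ≥0∞)

/-- Membership of a nonnegative function in the variable Lebesgue space: `ρ(g / t) < ∞` for some
`t > 0`. -/
def MemVar (μ : Measure Ω) (r : Ω → ℝ≥0∞) (g : Ω → ℝ≥0∞) : Prop :=
  ∃ t : ℝ≥0, 0 < t ∧ varModular μ r (fun x => g x / t) < ∞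

/-- A finite exponent `p` as an extended exponent. -/
def extExp (p : Ω → ℝ) : Ω → ℝ≥0∞ := fun x => ENNReal.ofReal (p x)

/-- The exponent `1 / α`, where `α = 1 / p - 1`; it is `∞` at the points where `p = 1`. -/
def dualExp (p : Ω → ℝ) : Ω → ℝ≥0∞ := fun x => (ENNReal.ofReal (1 / p x - 1))⁻¹

/-! ### The conditional square function -/

/-- `s(f) = (∑_{n ≥ 1} E(|f_n - f_{n-1}|² | F_{n-1})) ^ (1/2)`; the term `n = 0` of the sum vanishes
by the convention `f_{-1} = f_0`. The conditional expectations are those of nonnegative functions,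
with values in `[0, ∞]`, so no square integrability is presupposed. -/
def condSq (μ : Measure Ω) (ℱ : Filtration ℕ m) (f : ℕ → Ω → 𝕜) : Ω → ℝ≥0∞ := fun ω =>
  (∑' n : ℕ, condLExp (ℱ n) μ (fun x => ‖f (n + 1) x - f n x‖ₑ ^ (2 : ℕ)) ω) ^ (1 / 2 : ℝ)

/-- The quasi-norm `‖f‖ = ‖s(f)‖_{p(·)}` of the Hardy space. -/
def hardyNorm (μ : Measure Ω) (ℱ : Filtration ℕ m) (p : Ω → ℝ) (f : ℕ → Ω → 𝕜) : ℝ≥0∞ :=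
  varNorm μ (extExp p) (condSq μ ℱ f)

/-! ### Helper facts: the Hardy space is a vector space -/

theorem varModular_mono {μ : Measure Ω} {r g h : Ω → ℝ≥0∞} (hgh : g ≤ᵐ[μ] h) :
    varModular μ r g ≤ varModular μ r h := by
  unfold varModular
  refine add_le_add (lintegral_mono_ae ?_) (essSup_mono_ae (ae_restrict_of_ae hgh))
  filter_upwards [ae_restrict_of_ae hgh] with x hx
  exact ENNReal.rpow_le_rpow hx ENNReal.toReal_nonneg

theorem MemVar.mono {μ : Measure Ω} {r g h : Ω → ℝ≥0∞} (hh : MemVar μ r h) (hgh : g ≤ᵐ[μ] h) :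
    MemVar μ r g := by
  obtain ⟨t, ht, hlt⟩ := hh
  refine ⟨t, ht, lt_of_le_of_lt (varModular_mono ?_) hlt⟩
  filter_upwards [hgh] with x hx
  exact ENNReal.div_le_div_right hx _

theorem div_add_le_max (a b : ℝ≥0∞) {s t : ℝ≥0} (hs : 0 < s) (ht : 0 < t) :
    (a + b) / ((s + t : ℝ≥0) : ℝ≥0∞) ≤ max (a / s) (b / t) := by
  have hs' : (s : ℝ≥0∞) ≠ 0 := by exact_mod_cast hs.ne'
  have ht' : (t : ℝ≥0∞) ≠ 0 := by exact_mod_cast ht.ne'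
  apply ENNReal.div_le_of_le_mul
  have h1 : a ≤ max (a / s) (b / t) * s :=
    (ENNReal.div_le_iff hs' ENNReal.coe_ne_top).1 (le_max_left _ _)
  have h2 : b ≤ max (a / s) (b / t) * t :=
    (ENNReal.div_le_iff ht' ENNReal.coe_ne_top).1 (le_max_right _ _)
  calc a + b ≤ max (a / s) (b / t) * s + max (a / s) (b / t) * t := add_le_add h1 h2
    _ = _ := by push_cast; ring

theorem MemVar.add {μ : Measure Ω} {r g h : Ω → ℝ≥0∞} (hr : Measurable r) (hgm : Measurable g)
    (hg : MemVar μ r g) (hh : MemVar μ r h) : MemVar μ r (g + h) := by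
  obtain ⟨s, hs, hs'⟩ := hg
  obtain ⟨t, ht, ht'⟩ := hh
  refine ⟨s + t, by positivity, ?_⟩
  refine lt_of_le_of_lt ?_ (ENNReal.add_lt_top.2 ⟨hs', ht'⟩)
  unfold varModular
  rw [add_add_add_comm]
  refine add_le_add ?_ ?_
  · rw [← lintegral_add_left (by fun_prop)]
    refine lintegral_mono fun x => ?_
    refine (ENNReal.rpow_le_rpow (div_add_le_max (g x) (h x) hs ht)
      ENNReal.toReal_nonneg).trans ?_
    rcases le_total (g x / s) (h x / t) with h1 | h1
    · rw [max_eq_right h1]; exact le_add_self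
    · rw [max_eq_left h1]; exact le_self_add
  · refine le_trans (essSup_mono_ae (g := (fun x => g x / s) + fun x => h x / t)
      (Eventually.of_forall fun x => ?_)) (ENNReal.essSup_add_le _ _)
    exact (div_add_le_max (g x) (h x) hs ht).trans
      (max_le le_self_add le_add_self)

theorem MemVar.const_mul {μ : Measure Ω} {r g : Ω → ℝ≥0∞} (hg : MemVar μ r g) (c : ℝ≥0) :
    MemVar μ r (fun x => c * g x) := by
  obtain ⟨s, hs, hs'⟩ := hg
  refine ⟨(c + 1) * s, by positivity, lt_of_le_of_lt
    (varModular_mono (Eventually.of_forall fun x => ?_)) hs'⟩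
  have hs0 : (s : ℝ≥0∞) ≠ 0 := by exact_mod_cast hs.ne'
  apply ENNReal.div_le_of_le_mul
  have h1 : g x = g x / s * s := (ENNReal.div_mul_cancel hs0 ENNReal.coe_ne_top).symm
  calc (c : ℝ≥0∞) * g x ≤ (c + 1) * g x := by gcongr; exact le_self_add
    _ = (c + 1) * (g x / s * s) := by rw [← h1]
    _ = _ := by push_cast; ring

theorem measurable_condSq (μ : Measure Ω) (ℱ : Filtration ℕ m) (f : ℕ → Ω → 𝕜) :
    Measurable (condSq μ ℱ f) :=
  (Measurable.tsum fun _ => measurable_condLExp' _ _ _).pow_const _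

theorem condSq_add_le {μ : Measure Ω} [IsFiniteMeasure μ] {ℱ : Filtration ℕ m}
    {f g : ℕ → Ω → 𝕜} (hf : Martingale f ℱ μ) (hg : Martingale g ℱ μ) :
    condSq μ ℱ (f + g) ≤ᵐ[μ] fun x => (2 : ℝ≥0) * (condSq μ ℱ f + condSq μ ℱ g) x := by
  have hmeas : ∀ {u : ℕ → Ω → 𝕜}, Martingale u ℱ μ → ∀ n,
      Measurable (fun x => ‖u (n + 1) x - u n x‖ₑ ^ (2 : ℕ)) := by
    intro u hu n
    have h1 : StronglyMeasurable (u (n + 1)) := (hu.1 (n + 1)).mono (ℱ.le _)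
    have h2 : StronglyMeasurable (u n) := (hu.1 n).mono (ℱ.le _)
    exact ((h1.sub h2).enorm).pow_const 2
  have key : ∀ n, ∀ᵐ x ∂μ,
      condLExp (ℱ n) μ (fun x => ‖(f + g) (n + 1) x - (f + g) n x‖ₑ ^ (2 : ℕ)) x ≤
        4 * condLExp (ℱ n) μ (fun x => ‖f (n + 1) x - f n x‖ₑ ^ (2 : ℕ)) x +
        4 * condLExp (ℱ n) μ (fun x => ‖g (n + 1) x - g n x‖ₑ ^ (2 : ℕ)) x := by
    intro n
    have hpt : (fun x => ‖(f + g) (n + 1) x - (f + g) n x‖ₑ ^ (2 : ℕ)) ≤ᵐ[μ]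
        ((4 : ℝ≥0∞) • (fun x => ‖f (n + 1) x - f n x‖ₑ ^ (2 : ℕ))) +
        ((4 : ℝ≥0∞) • (fun x => ‖g (n + 1) x - g n x‖ₑ ^ (2 : ℕ))) := by
      refine Eventually.of_forall fun x => ?_
      simp only [Pi.add_apply, Pi.smul_apply, smul_eq_mul]
      set a := f (n + 1) x - f n x
      set b := g (n + 1) x - g n x
      have e : f (n + 1) x + g (n + 1) x - (f n x + g n x) = a + b := by
        simp only [a, b]; ring
      rw [e]
      have h1 : ‖a + b‖ₑ ≤ 2 * max ‖a‖ₑ ‖b‖ₑ := by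
        rw [two_mul]
        exact (enorm_add_le a b).trans (add_le_add (le_max_left _ _) (le_max_right _ _))
      calc ‖a + b‖ₑ ^ 2 ≤ (2 * max ‖a‖ₑ ‖b‖ₑ) ^ 2 := by gcongr
        _ = 4 * max ‖a‖ₑ ‖b‖ₑ ^ 2 := by rw [mul_pow]; norm_num
        _ ≤ 4 * ‖a‖ₑ ^ 2 + 4 * ‖b‖ₑ ^ 2 := by
          rcases le_total ‖a‖ₑ ‖b‖ₑ with h | h
          · rw [max_eq_right h]; exact le_add_self
          · rw [max_eq_left h]; exact le_self_add
    have e1 := condLExp_add_left (P := μ) (mΩ := ℱ n)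
      (X := (4 : ℝ≥0∞) • (fun x => ‖f (n + 1) x - f n x‖ₑ ^ (2 : ℕ)))
      ((4 : ℝ≥0∞) • (fun x => ‖g (n + 1) x - g n x‖ₑ ^ (2 : ℕ)))
      ((hmeas hf n).const_smul _).aemeasurable
    have e2 := condLExp_smul (P := μ) (mΩ := ℱ n) _ (hmeas hf n).aemeasurable (4 : ℝ≥0∞)
    have e3 := condLExp_smul (P := μ) (mΩ := ℱ n) _ (hmeas hg n).aemeasurable (4 : ℝ≥0∞)
    filter_upwards [condLExp_mono (mΩ := ℱ n) hpt, e1, e2, e3] with x h0 h1 h2 h3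
    exact h0.trans_eq (h1.trans (congrArg₂ (· + ·) h2 h3))
  filter_upwards [ae_all_iff.2 key] with x hx
  simp only [condSq, Pi.add_apply]
  have h1 := ENNReal.tsum_le_tsum hx
  rw [ENNReal.tsum_add, ENNReal.tsum_mul_left, ENNReal.tsum_mul_left, ← mul_add] at h1
  refine (ENNReal.rpow_le_rpow h1 (by norm_num : (0 : ℝ) ≤ 1 / 2)).trans ?_
  rw [ENNReal.mul_rpow_of_nonneg _ _ (by norm_num : (0 : ℝ) ≤ 1 / 2)]
  have h4 : (4 : ℝ≥0∞) ^ (1 / 2 : ℝ) = ((2 : ℝ≥0) : ℝ≥0∞) := by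
    have : (4 : ℝ≥0∞) = 2 ^ (2 : ℝ) := by norm_num
    rw [this, ← ENNReal.rpow_mul]; norm_num
  rw [h4]
  gcongr
  exact ENNReal.rpow_add_le_add_rpow _ _ (by norm_num) (by norm_num)

theorem condSq_smul_le {μ : Measure Ω} [IsFiniteMeasure μ] {ℱ : Filtration ℕ m}
    (c : 𝕜) (f : ℕ → Ω → 𝕜) :
    condSq μ ℱ (c • f) ≤ᵐ[μ] fun x => ‖c‖₊ * condSq μ ℱ f x := by
  have key : ∀ n, ∀ᵐ x ∂μ,
      condLExp (ℱ n) μ (fun x => ‖(c • f) (n + 1) x - (c • f) n x‖ₑ ^ (2 : ℕ)) x =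
        ‖c‖ₑ ^ (2 : ℕ) * condLExp (ℱ n) μ (fun x => ‖f (n + 1) x - f n x‖ₑ ^ (2 : ℕ)) x := by
    intro n
    have e : (fun x => ‖(c • f) (n + 1) x - (c • f) n x‖ₑ ^ (2 : ℕ)) =
        (‖c‖ₑ ^ (2 : ℕ)) • (fun x => ‖f (n + 1) x - f n x‖ₑ ^ (2 : ℕ)) := by
      funext x
      simp only [Pi.smul_apply, smul_eq_mul]
      rw [← mul_sub, enorm_mul, mul_pow]
    rw [e]
    exact condLExp_smul' _ (by finiteness)
  filter_upwards [ae_all_iff.2 key] with x hx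
  simp only [condSq]
  simp_rw [hx]
  rw [ENNReal.tsum_mul_left, ENNReal.mul_rpow_of_nonneg _ _ (by norm_num : (0 : ℝ) ≤ 1 / 2)]
  refine le_of_eq ?_
  congr 1
  rw [← ENNReal.rpow_natCast, ← ENNReal.rpow_mul]
  norm_num
  rfl

theorem martingale_smul {μ : Measure Ω} {ℱ : Filtration ℕ m} (c : 𝕜) {f : ℕ → Ω → 𝕜}
    (hf : Martingale f ℱ μ) : Martingale (c • f) ℱ μ := by
  refine ⟨fun n => (hf.1 n).const_smul c, fun i j hij => ?_⟩
  refine (condExp_smul c (f j) (ℱ i)).trans ?_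
  filter_upwards [hf.2 i j hij] with ω h
  simp [h]

/-- The Hardy space `H^s_{p(·)}`: the martingales `f = (f_n)` with `s(f) ∈ L^{p(·)}`. -/
def hardySpace (𝕜 : Type*) [RCLike 𝕜] (μ : Measure Ω) [IsFiniteMeasure μ] (ℱ : Filtration ℕ m)
    (p : Ω → ℝ) (hp : Measurable p) : Submodule 𝕜 (ℕ → Ω → 𝕜) where
  carrier := {f | Martingale f ℱ μ ∧ MemVar μ (extExp p) (condSq μ ℱ f)}
  add_mem' := fun {f g} hf hg => ⟨hf.1.add hg.1,
    (((hf.2.add (ENNReal.measurable_ofReal.comp hp) (measurable_condSq μ ℱ f) hg.2).const_mul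
      2).mono (condSq_add_le hf.1 hg.1))⟩
  zero_mem' := by
    refine ⟨martingale_zero _ _ _, 1, one_pos, ?_⟩
    have h0 : condSq μ ℱ (0 : ℕ → Ω → 𝕜) = 0 := by
      funext ω
      have : (fun _ : Ω => (0 : ℝ≥0∞)) = 0 := rfl
      simp [condSq, this]
    rw [h0]
    have h1 : ∀ x : Ω, ((0 : Ω → ℝ≥0∞) x / ((1 : ℝ≥0) : ℝ≥0∞)) = 0 := by simp
    simp only [varModular, h1]
    refine ENNReal.add_lt_top.2 ⟨?_, ?_⟩
    · refine lt_of_le_of_lt (lintegral_mono (g := fun _ => 1) fun x => ?_) ?_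
      · exact ENNReal.rpow_le_one zero_le_one ENNReal.toReal_nonneg
      · simp
    · have h2 : essSup (fun _ : Ω => (0 : ℝ≥0∞)) (μ.restrict {x | extExp p x = ∞}) = 0 :=
        ENNReal.essSup_eq_zero_iff.2 (Eventually.of_forall fun _ => rfl)
      rw [h2]; exact ENNReal.zero_lt_top
  smul_mem' := fun c f hf => ⟨martingale_smul c hf.1, (hf.2.const_mul ‖c‖₊).mono (condSq_smul_le c f)⟩

/-! ### The dual space -/

/-- The norm `sup {|l(f)| : ‖f‖ ≤ 1}` of a linear functional on the Hardy space. -/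
def dualNorm {μ : Measure Ω} [IsFiniteMeasure μ] {ℱ : Filtration ℕ m} {p : Ω → ℝ}
    {hp : Measurable p} (l : Module.Dual 𝕜 (hardySpace 𝕜 μ ℱ p hp)) : ℝ≥0∞ :=
  ⨆ (f : hardySpace 𝕜 μ ℱ p hp) (_ : hardyNorm μ ℱ p (f : ℕ → Ω → 𝕜) ≤ 1), ‖l f‖ₑ

/-- The dual of the Hardy space: its bounded linear functionals. -/
def hardyDual (𝕜 : Type*) [RCLike 𝕜] (μ : Measure Ω) [IsFiniteMeasure μ] (ℱ : Filtration ℕ m)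
    (p : Ω → ℝ) (hp : Measurable p) : Submodule 𝕜 (Module.Dual 𝕜 (hardySpace 𝕜 μ ℱ p hp)) where
  carrier := {l | dualNorm l < ∞}
  add_mem' := fun {l k} hl hk => by
    refine lt_of_le_of_lt (iSup₂_le fun f hf => ?_) (ENNReal.add_lt_top.2 ⟨hl, hk⟩)
    exact (enorm_add_le _ _).trans (add_le_add (le_iSup₂_of_le f hf le_rfl)
      (le_iSup₂_of_le f hf le_rfl))
  zero_mem' := by simp [dualNorm]
  smul_mem' := fun c l hl => by
    refine lt_of_le_of_lt (iSup₂_le fun f hf => ?_)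
      (ENNReal.mul_lt_top (enorm_lt_top (x := c)) hl)
    rw [LinearMap.smul_apply, smul_eq_mul, enorm_mul]
    gcongr
    exact le_iSup₂_of_le f hf le_rfl

/-! ### The variable Lipschitz space -/

/-- The stopped function `φ^τ`, which is `E(φ | F_n)` on `{τ = n}` and the limit
`E(φ | σ(⋃ F_n))` of the martingale generated by `φ` on `{τ = ∞}`. -/
def stoppedFun (μ : Measure Ω) (ℱ : Filtration ℕ m) (τ : Ω → WithTop ℕ) (φ : Ω → 𝕜) : Ω → 𝕜 :=
  fun ω => if τ ω = ⊤ then condExp (⨆ n, ℱ n) μ φ ω else condExp (ℱ (τ ω).untopA) μ φ ω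

/-- The Lipschitz norm
`sup_τ ‖χ_{τ<∞}‖_{1/α(·)}⁻¹ ‖χ_{τ<∞}‖_2⁻¹ ‖φ - φ^τ‖_2`, `α = 1/p - 1`, over all stopping times. -/
def lipNorm (μ : Measure Ω) (ℱ : Filtration ℕ m) (p : Ω → ℝ) (φ : Ω → 𝕜) : ℝ≥0∞ :=
  ⨆ (τ : Ω → WithTop ℕ) (_ : IsStoppingTime ℱ τ),
    (varNorm μ (dualExp p) ({ω | τ ω < ⊤}.indicator 1))⁻¹ *
      (eLpNorm ({ω | τ ω < ⊤}.indicator (1 : Ω → ℝ)) 2 μ)⁻¹ *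
      eLpNorm (φ - stoppedFun μ ℱ τ φ) 2 μ

theorem aestronglyMeasurable_stoppedFun {μ : Measure Ω} {ℱ : Filtration ℕ m}
    {τ : Ω → WithTop ℕ} (hτ : IsStoppingTime ℱ τ) (φ : Ω → 𝕜) :
    AEStronglyMeasurable (stoppedFun μ ℱ τ φ) μ := by
  have hfin : ∀ n : ℕ, MeasurableSet {ω | τ ω = n} := fun n =>
    ℱ.le n _ (hτ.measurableSet_eq_of_countable n)
  have hall : ∀ t : WithTop ℕ, MeasurableSet {ω | τ ω = t} := by
    intro t
    induction t using WithTop.recTopCoe with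
    | coe n => exact hfin n
    | top =>
      have : {ω | τ ω = ⊤} = (⋃ n : ℕ, {ω | τ ω = n})ᶜ := by
        ext ω
        simp only [mem_ofPred_eq, mem_compl_iff, mem_iUnion, not_exists]
        constructor
        · intro h n; rw [h]; exact WithTop.top_ne_coe
        · intro h
          by_contra hne
          obtain ⟨n, hn⟩ := WithTop.ne_top_iff_exists.1 hne
          exact h n hn.symm
      rw [this]
      exact (MeasurableSet.iUnion hfin).compl
  have hU : (⋃ t : WithTop ℕ, {ω | τ ω = t}) = univ := by
    ext ω; simp
  have : AEStronglyMeasurable (stoppedFun μ ℱ τ φ) (μ.restrict (⋃ t, {ω | τ ω = t})) := by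
    have : Countable (WithTop ℕ) := inferInstanceAs (Countable (Option ℕ))
    rw [aestronglyMeasurable_iUnion_iff]
    intro t
    induction t using WithTop.recTopCoe with
    | coe n =>
      refine ((stronglyMeasurable_condExp (m := ℱ n) (μ := μ) (f := φ)).mono
        (ℱ.le n)).aestronglyMeasurable.congr ?_
      refine ae_restrict_of_forall_mem (hall _) fun ω hω => ?_
      simp only [mem_ofPred_eq] at hω
      have h1 : τ ω ≠ ⊤ := by rw [hω]; exact WithTop.coe_ne_top
      have h2 : (τ ω).untopA = n := by rw [hω]; exact WithTop.untopD_coe _ n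
      simp only [stoppedFun, if_neg h1, h2]
    | top =>
      refine ((stronglyMeasurable_condExp (m := ⨆ n, ℱ n) (μ := μ) (f := φ)).mono
        (iSup_le ℱ.le)).aestronglyMeasurable.congr ?_
      refine ae_restrict_of_forall_mem (hall _) fun ω hω => ?_
      simp only [mem_ofPred_eq] at hω
      simp [stoppedFun, hω]
  rwa [hU, Measure.restrict_univ] at this

theorem stoppedFun_congr_ae {μ : Measure Ω} {ℱ : Filtration ℕ m} {τ : Ω → WithTop ℕ}
    {φ ψ : Ω → 𝕜} (h : φ =ᵐ[μ] ψ) : stoppedFun μ ℱ τ φ =ᵐ[μ] stoppedFun μ ℱ τ ψ := by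
  filter_upwards [ae_all_iff.2 fun n => condExp_congr_ae (m := ℱ n) h,
    condExp_congr_ae (m := ⨆ n, ℱ n) h] with ω h1 h2
  unfold stoppedFun
  split_ifs
  · exact h2
  · exact h1 _

theorem stoppedFun_add_ae {μ : Measure Ω} {ℱ : Filtration ℕ m} {τ : Ω → WithTop ℕ}
    {φ ψ : Ω → 𝕜} (hφ : Integrable φ μ) (hψ : Integrable ψ μ) :
    stoppedFun μ ℱ τ (φ + ψ) =ᵐ[μ] stoppedFun μ ℱ τ φ + stoppedFun μ ℱ τ ψ := by
  filter_upwards [ae_all_iff.2 fun n => condExp_add hφ hψ (ℱ n),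
    condExp_add hφ hψ (⨆ n, ℱ n)] with ω h1 h2
  unfold stoppedFun
  simp only [Pi.add_apply]
  split_ifs
  · exact h2
  · exact h1 _

theorem stoppedFun_smul_ae {μ : Measure Ω} {ℱ : Filtration ℕ m} {τ : Ω → WithTop ℕ}
    (c : 𝕜) (φ : Ω → 𝕜) :
    stoppedFun μ ℱ τ (c • φ) =ᵐ[μ] c • stoppedFun μ ℱ τ φ := by
  filter_upwards [ae_all_iff.2 fun n => condExp_smul (μ := μ) c φ (ℱ n),
    condExp_smul (μ := μ) c φ (⨆ n, ℱ n)] with ω h1 h2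
  unfold stoppedFun
  simp only [Pi.smul_apply]
  split_ifs
  · exact h2
  · exact h1 _

theorem lipNorm_congr_ae {μ : Measure Ω} {ℱ : Filtration ℕ m} {p : Ω → ℝ} {φ ψ : Ω → 𝕜}
    (h : φ =ᵐ[μ] ψ) : lipNorm μ ℱ p φ = lipNorm μ ℱ p ψ := by
  unfold lipNorm
  congr 1; funext τ; congr 1; funext _; congr 1
  exact eLpNorm_congr_ae (h.sub (stoppedFun_congr_ae h))

theorem lipNorm_add_le {μ : Measure Ω} {ℱ : Filtration ℕ m} {p : Ω → ℝ} {φ ψ : Ω → 𝕜}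
    (hφ : Integrable φ μ) (hψ : Integrable ψ μ) :
    lipNorm μ ℱ p (φ + ψ) ≤ lipNorm μ ℱ p φ + lipNorm μ ℱ p ψ := by
  refine iSup₂_le fun τ hτ => ?_
  have e : (φ + ψ) - stoppedFun μ ℱ τ (φ + ψ) =ᵐ[μ]
      (φ - stoppedFun μ ℱ τ φ) + (ψ - stoppedFun μ ℱ τ ψ) := by
    filter_upwards [stoppedFun_add_ae (ℱ := ℱ) (τ := τ) hφ hψ] with ω h
    simp only [Pi.sub_apply, Pi.add_apply] at h ⊢
    rw [h]; ring
  rw [eLpNorm_congr_ae e]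
  have h1 := eLpNorm_add_le (hφ.1.sub (aestronglyMeasurable_stoppedFun hτ φ))
    (hψ.1.sub (aestronglyMeasurable_stoppedFun hτ ψ)) (p := 2) (by norm_num)
  refine (mul_le_mul_right h1 _).trans ?_
  rw [mul_add]
  exact add_le_add (le_iSup₂_of_le τ hτ le_rfl) (le_iSup₂_of_le τ hτ le_rfl)

theorem lipNorm_smul_le {μ : Measure Ω} {ℱ : Filtration ℕ m} {p : Ω → ℝ} (c : 𝕜) (φ : Ω → 𝕜) :
    lipNorm μ ℱ p (c • φ) ≤ ‖c‖ₑ * lipNorm μ ℱ p φ := by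
  refine iSup₂_le fun τ hτ => ?_
  have e : (c • φ) - stoppedFun μ ℱ τ (c • φ) =ᵐ[μ] c • (φ - stoppedFun μ ℱ τ φ) := by
    filter_upwards [stoppedFun_smul_ae (μ := μ) (ℱ := ℱ) (τ := τ) c φ] with ω h
    simp only [Pi.sub_apply, Pi.smul_apply, smul_eq_mul] at h ⊢
    rw [h]; ring
  rw [eLpNorm_congr_ae e, eLpNorm_const_smul, mul_left_comm]
  gcongr
  exact le_iSup₂_of_le τ hτ le_rfl

/-- The Lipschitz space `Λ_2(α(·))`, `α = 1/p - 1`: the classes `φ ∈ L²` of finite Lipschitz norm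
that are limits of martingales (measurable for `σ(⋃ F_n)`) starting from `E(φ | F_0) = 0`. -/
def lipSpace (𝕜 : Type*) [RCLike 𝕜] (μ : Measure Ω) [IsFiniteMeasure μ] (ℱ : Filtration ℕ m)
    (p : Ω → ℝ) : Submodule 𝕜 (Lp 𝕜 2 μ) where
  carrier := {φ | AEStronglyMeasurable[⨆ n, ℱ n] φ μ ∧ condExp (ℱ 0) μ φ =ᵐ[μ] 0 ∧
    lipNorm μ ℱ p φ < ∞}
  add_mem' := fun {φ ψ} hφ hψ => by
    have h1 : Integrable φ μ := (Lp.memLp φ).integrable (by norm_num)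
    have h2 : Integrable ψ μ := (Lp.memLp ψ).integrable (by norm_num)
    refine ⟨(hφ.1.add hψ.1).congr (Lp.coeFn_add φ ψ).symm, ?_, ?_⟩
    · refine (condExp_congr_ae (Lp.coeFn_add φ ψ)).trans ((condExp_add h1 h2 _).trans ?_)
      simpa using hφ.2.1.add hψ.2.1
    · rw [lipNorm_congr_ae (Lp.coeFn_add φ ψ)]
      exact lt_of_le_of_lt (lipNorm_add_le h1 h2) (ENNReal.add_lt_top.2 ⟨hφ.2.2, hψ.2.2⟩)
  zero_mem' := by
    have h0 : (⇑(0 : Lp 𝕜 2 μ) : Ω → 𝕜) =ᵐ[μ] 0 := Lp.coeFn_zero _ _ _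
    refine ⟨(aestronglyMeasurable_const (b := (0 : 𝕜))).congr h0.symm, ?_, ?_⟩
    · refine (condExp_congr_ae h0).trans ?_
      rw [condExp_zero]
    · rw [lipNorm_congr_ae h0]
      have := lipNorm_smul_le (μ := μ) (ℱ := ℱ) (p := p) (0 : 𝕜) (0 : Ω → 𝕜)
      rw [zero_smul, enorm_zero, zero_mul] at this
      exact lt_of_le_of_lt this ENNReal.zero_lt_top
  smul_mem' := fun c φ hφ => by
    refine ⟨(hφ.1.const_smul c).congr (Lp.coeFn_smul c φ).symm, ?_, ?_⟩
    · refine (condExp_congr_ae (Lp.coeFn_smul c φ)).trans ((condExp_smul c _ _).trans ?_)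
      filter_upwards [hφ.2.1] with ω h
      simp [h]
    · rw [lipNorm_congr_ae (Lp.coeFn_smul c φ)]
      exact lt_of_le_of_lt (lipNorm_smul_le c _) (ENNReal.mul_lt_top enorm_lt_top hφ.2.2)

end VarHardy

end

namespace VarHardy

variable {Ω : Type*} {m : MeasurableSpace Ω} {𝕜 : Type*} [RCLike 𝕜] {μ : Measure Ω}

/-! ### Conditional expectations of square integrable functions -/

/-! The pairing E(fφ) is controlled from both sides by stopping times, and the variable exponent
enters only through one comparison of sizes. Let B have probability θ > 0, and let a and b be the
infimum and supremum of p on B. Then θ^(1/a) ≤ ‖χ_B‖_p and θ^(1/a-1) ≤ ‖χ_B‖_{1/α} ≤ D θ^(1/b-1),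
and a function h vanishing off B has ‖h‖_p ≤ D ‖h‖_2 θ^(1/b-1/2), where D depends only on p_-. The
oscillation condition makes θ^(1/b) and θ^(1/a) comparable uniformly in B. Up to constants,
therefore, θ‖χ_B‖_{1/α} ≤ ‖χ_B‖_p and ‖h‖_p ≤ ‖h‖_2 θ^(1/2) ‖χ_B‖_{1/α}
(`OscillationCondition.exists_const`).

Upper estimate. The partial sums of s(f)² are predictable. Let τ_k be the time at which they are
about to exceed 4^k, put B_k = {τ_k < ∞}, and cut f into the pieces f^(k) whose increments occur
while the sum lies in (4^k, 4^(k+1)]. Such a piece satisfies ‖f^(k)‖_2 ≤ 2^(k+1) P(B_k)^(1/2) and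
has zero conditional expectation given F_{τ_k}, so φ may be replaced by φ - φ^{τ_k}. The Lipschitz
norm and the comparison bound its pairing by a constant times ‖2^k χ_{B_k}‖_p. As p ≤ 1, the
quasi-norm satisfies the reverse triangle inequality (`add_varNorm_le`), so the sum over k is at
most ‖∑ 2^k χ_{B_k}‖_p ≤ 2‖s(f)‖_p, because B_k lies in {s(f) > 2^k}. This is
`enorm_integral_sub_mul_le`; martingale convergence gives `enorm_integral_mul_le_hardyNorm`.

Lower estimate. Testing the functional on the conjugate of u = φ - φ^τ produces ‖u‖_2². The square
function of this test function lives on {τ < ∞}, so the comparison bounds its Hardy quasi-norm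
linearly in ‖u‖_2, and one factor ‖u‖_2 cancels (`lipNorm_le_of_bound`).

Identification of the dual. Predictable truncation makes L² martingales dense
(`exists_memLp_hardyNorm_sub_lt`), so the pairing with φ extends uniquely. Conversely L² maps
boundedly into the Hardy space, so Riesz represents any bounded functional by some φ in L². The
functional sees only the increments of the martingale, and this forces φ to be measurable for the
limit σ-algebra and E(φ | F_0) = 0. -/

theorem eLpNorm_two_sq {E : Type*} [NormedAddCommGroup E] (f : Ω → E) :
    eLpNorm f 2 μ ^ 2 = ∫⁻ x, ‖f x‖ₑ ^ 2 ∂μ := by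
  have h := eLpNorm_nnreal_pow_eq_lintegral (μ := μ) (f := f) (p := 2) (by norm_num)
  have e : ((2 : ℝ≥0) : ℝ) = ((2 : ℕ) : ℝ) := by norm_num
  rw [e] at h
  simp_rw [ENNReal.rpow_natCast] at h
  exact_mod_cast h

theorem memLp_two_iff {E : Type*} [NormedAddCommGroup E] {f : Ω → E}
    (hf : AEStronglyMeasurable f μ) : MemLp f 2 μ ↔ ∫⁻ x, ‖f x‖ₑ ^ 2 ∂μ < ∞ := by
  rw [← eLpNorm_two_sq]
  constructor
  · intro h
    exact ENNReal.pow_lt_top h.2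
  · intro h
    refine ⟨hf, ?_⟩
    by_contra hne
    rw [not_lt, top_le_iff] at hne
    rw [hne] at h
    simp at h

theorem integrable_mul_of_memLp_two {f g : Ω → 𝕜} (hf : MemLp f 2 μ) (hg : MemLp g 2 μ) :
    Integrable (fun x => f x * g x) μ :=
  hf.integrable_mul hg

theorem enorm_integral_mul_le {f g : Ω → 𝕜} (hf : MemLp f 2 μ) (hg : MemLp g 2 μ) :
    ‖∫ x, f x * g x ∂μ‖ₑ ≤ eLpNorm f 2 μ * eLpNorm g 2 μ := by
  refine (enorm_integral_le_lintegral_enorm _).trans ?_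
  have h := eLpNorm_le_eLpNorm_mul_eLpNorm_of_nnnorm (μ := μ) (p := 2) (q := 2) (r := 1)
    hf.1 hg.1 (fun a b : 𝕜 => a * b) 1
    (Eventually.of_forall fun x => by simp [nnnorm_mul])
  simpa [eLpNorm_one_eq_lintegral_enorm] using h

theorem ae_eq_zero_of_integral_mul_eq_zero {ψ : Ω → 𝕜} (hψ : MemLp ψ 2 μ)
    (h : ∀ g : Ω → 𝕜, MemLp g 2 μ → ∫ x, g x * ψ x ∂μ = 0) : ψ =ᵐ[μ] 0 := by
  have h1 := h (fun x => star (ψ x)) hψ.star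
  have e : ∀ x, star (ψ x) * ψ x = ((‖ψ x‖ ^ 2 : ℝ) : 𝕜) := fun x => by
    rw [RCLike.star_def, RCLike.conj_mul]; norm_cast
  simp_rw [e] at h1
  rw [integral_ofReal] at h1
  have h2 : ∫ x, ‖ψ x‖ ^ 2 ∂μ = 0 := by exact_mod_cast h1
  have h3 := (integral_eq_zero_iff_of_nonneg (fun x => sq_nonneg _)
    ((memLp_two_iff_integrable_sq_norm hψ.1).1 hψ)).1 h2
  filter_upwards [h3] with x hx
  simpa using hx

/-- Pythagoras: the cross term in ‖X + Y‖² is twice the real part of the vanishing inner product. -/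
theorem lintegral_enorm_sq_add_of_integral_star_mul {X Y : Ω → 𝕜} (hX : MemLp X 2 μ)
    (hY : MemLp Y 2 μ) (hXY : ∫ x, star (X x) * Y x ∂μ = 0) :
    ∫⁻ x, ‖X x + Y x‖ₑ ^ 2 ∂μ = ∫⁻ x, ‖X x‖ₑ ^ 2 ∂μ + ∫⁻ x, ‖Y x‖ₑ ^ 2 ∂μ := by
  have hs : ∀ {Z : Ω → 𝕜}, MemLp Z 2 μ → Integrable (fun x => ‖Z x‖ ^ 2) μ := fun h =>
    (memLp_two_iff_integrable_sq_norm h.1).1 h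
  have key : ∀ {Z : Ω → 𝕜}, MemLp Z 2 μ →
      ∫⁻ x, ‖Z x‖ₑ ^ 2 ∂μ = ENNReal.ofReal (∫ x, ‖Z x‖ ^ 2 ∂μ) := fun {Z} h => by
    rw [ofReal_integral_eq_lintegral_ofReal (hs h) (Eventually.of_forall fun x => sq_nonneg _)]
    refine lintegral_congr fun x => ?_
    rw [ENNReal.ofReal_pow (norm_nonneg _), ofReal_norm]
  have h0 := congrArg RCLike.re hXY
  have hint : Integrable (fun x => star (X x) * Y x) μ := integrable_mul_of_memLp_two hX.star hY
  rw [map_zero, ← RCLike.reCLM_apply, ← RCLike.reCLM.integral_comp_comm hint] at h0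
  simp only [RCLike.reCLM_apply] at h0
  rw [key hX, key hY, key (Z := fun x => X x + Y x) (hX.add hY),
    ← ENNReal.ofReal_add (integral_nonneg fun _ => sq_nonneg _)
      (integral_nonneg fun _ => sq_nonneg _), ← integral_add (hs hX) (hs hY)]
  congr 1
  have e : ∀ x, ‖X x + Y x‖ ^ 2 = (‖X x‖ ^ 2 + ‖Y x‖ ^ 2) + 2 * RCLike.re (star (X x) * Y x) := by
    intro x
    have := norm_add_sq (𝕜 := 𝕜) (X x) (Y x)
    rw [RCLike.inner_apply, mul_comm (Y x), ← RCLike.star_def] at this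
    rw [this]
    ring
  simp_rw [e]
  have hXYs : Integrable (fun x => ‖X x‖ ^ 2 + ‖Y x‖ ^ 2) μ := (hs hX).add (hs hY)
  rw [integral_add hXYs (hint.re.const_mul 2), integral_const_mul,
    h0, mul_zero, add_zero]

variable [IsFiniteMeasure μ]

theorem integral_mul_eq_zero {G : MeasurableSpace Ω} (hG : G ≤ m) {X Y : Ω → 𝕜}
    (hX : MemLp X 2 μ) (hY : MemLp Y 2 μ) (hXG : AEStronglyMeasurable[G] X μ)
    (hY0 : μ[Y|G] =ᵐ[μ] 0) : ∫ x, X x * Y x ∂μ = 0 := by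
  have h := condExp_bilin_of_aestronglyMeasurable_left (ContinuousLinearMap.mul ℝ 𝕜) hXG
    (integrable_mul_of_memLp_two hX hY) (hY.integrable (by norm_num))
  rw [← integral_condExp hG]
  refine (integral_congr_ae (h.trans ?_)).trans (integral_zero Ω 𝕜)
  filter_upwards [hY0] with x hx
  simp [hx]

theorem condExp_sub_condExp_ae {G : MeasurableSpace Ω} (hG : G ≤ m) {f : Ω → 𝕜}
    (hf : Integrable f μ) : μ[f - μ[f|G]|G] =ᵐ[μ] 0 := by
  refine (condExp_sub hf integrable_condExp G).trans ?_
  rw [condExp_of_stronglyMeasurable hG stronglyMeasurable_condExp integrable_condExp, sub_self]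

/-- Conditional expectation is self-adjoint for the bilinear pairing: both sides equal the integral
of the product of the two conditional expectations. -/
theorem integral_mul_condExp {G : MeasurableSpace Ω} (hG : G ≤ m) {f φ : Ω → 𝕜}
    (hf : MemLp f 2 μ) (hφ : MemLp φ 2 μ) :
    ∫ x, f x * μ[φ|G] x ∂μ = ∫ x, μ[f|G] x * φ x ∂μ := by
  have hf' := hf.condExp (m := G) (by norm_num)
  have hφ' := hφ.condExp (m := G) (by norm_num)
  have h1 := integral_mul_eq_zero hG hφ' (hf.sub hf')
    stronglyMeasurable_condExp.aestronglyMeasurable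
    (condExp_sub_condExp_ae hG (hf.integrable (by norm_num)))
  have h2 := integral_mul_eq_zero hG hf' (hφ.sub hφ')
    stronglyMeasurable_condExp.aestronglyMeasurable
    (condExp_sub_condExp_ae hG (hφ.integrable (by norm_num)))
  simp only [Pi.sub_apply, mul_sub] at h1 h2
  rw [integral_sub (integrable_mul_of_memLp_two hφ' hf) (integrable_mul_of_memLp_two hφ' hf'),
    sub_eq_zero] at h1
  rw [integral_sub (integrable_mul_of_memLp_two hf' hφ) (integrable_mul_of_memLp_two hf' hφ'),
    sub_eq_zero] at h2
  rw [h2]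
  simp_rw [mul_comm (μ[f|G] _) (μ[φ|G] _)]
  rw [← h1]
  simp_rw [mul_comm]

theorem integral_star_mul_eq_zero {G : MeasurableSpace Ω} (hG : G ≤ m) {X Y : Ω → 𝕜}
    (hX : MemLp X 2 μ) (hY : MemLp Y 2 μ) (hXG : AEStronglyMeasurable[G] X μ)
    (hY0 : μ[Y|G] =ᵐ[μ] 0) : ∫ x, star (X x) * Y x ∂μ = 0 :=
  integral_mul_eq_zero hG hX.star hY (continuous_star.comp_aestronglyMeasurable hXG) hY0

theorem lintegral_enorm_sq_add {G : MeasurableSpace Ω} (hG : G ≤ m) {X Y : Ω → 𝕜}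
    (hX : MemLp X 2 μ) (hY : MemLp Y 2 μ) (hXG : AEStronglyMeasurable[G] X μ)
    (hY0 : μ[Y|G] =ᵐ[μ] 0) :
    ∫⁻ x, ‖X x + Y x‖ₑ ^ 2 ∂μ = ∫⁻ x, ‖X x‖ₑ ^ 2 ∂μ + ∫⁻ x, ‖Y x‖ₑ ^ 2 ∂μ :=
  lintegral_enorm_sq_add_of_integral_star_mul hX hY (integral_star_mul_eq_zero hG hX hY hXG hY0)

/-! ### Passage to the limit σ-algebra and to stopped functions. -/

theorem condExp_iSup_ae_eq_zero {ℱ : Filtration ℕ m} {f : Ω → 𝕜} (hf : Integrable f μ)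
    (h : ∀ n s, MeasurableSet[ℱ n] s → ∫ x in s, f x ∂μ = 0) : μ[f|⨆ n, ℱ n] =ᵐ[μ] 0 := by
  have hle : (⨆ n, ℱ n) ≤ m := iSup_le ℱ.le
  refine (ae_eq_condExp_of_forall_setIntegral_eq hle hf (g := 0)
    (fun _ _ _ => (integrable_zero _ _ _).integrableOn) ?_
    aestronglyMeasurable_zero).symm
  intro s hs _
  -- The union of the F_n is a π-system generating the limit σ-algebra, so a π-λ induction suffices.
  have hpi : IsPiSystem {s | ∃ n, MeasurableSet[ℱ n] s} := by
    rintro s ⟨n, hs⟩ t ⟨k, ht⟩ -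
    exact ⟨max n k, (ℱ.mono (le_max_left n k) _ hs).inter (ℱ.mono (le_max_right n k) _ ht)⟩
  simp only [Pi.zero_apply, integral_zero]
  symm
  induction s, hs using MeasurableSpace.induction_on_inter
    (MeasurableSpace.measurableSpace_iSup_eq ℱ) hpi with
  | empty => simp
  | basic s hs =>
    obtain ⟨n, hn⟩ := hs
    exact h n s hn
  | compl t ht ih =>
    rw [setIntegral_compl (hle _ ht) hf, ih (measure_lt_top _ _), ← setIntegral_univ, h 0 univ .univ,
      sub_zero]
  | iUnion t hd ht ih =>
    rw [integral_iUnion (fun i => hle _ (ht i)) hd hf.integrableOn]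
    simp [ih]

/-- On L² the operators E(· | F_n) are orthogonal projections onto increasing subspaces, hence
converge strongly to the projection onto the closure of their union. That projection fixes φ: the
remainder is orthogonal to the indicators of all sets in the F_n, so its conditional expectation on
the limit σ-algebra vanishes, and it is itself measurable there. -/
theorem tendsto_integral_mul_condExp {ℱ : Filtration ℕ m} {f φ : Ω → 𝕜}
    (hf : MemLp f 2 μ) (hφ : MemLp φ 2 μ) (hφm : AEStronglyMeasurable[⨆ n, ℱ n] φ μ) :
    Tendsto (fun n => ∫ x, f x * μ[φ|ℱ n] x ∂μ) atTop (nhds (∫ x, f x * φ x ∂μ)) := by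
  have hle : (⨆ n, ℱ n) ≤ m := iSup_le ℱ.le
  have hF : ∀ n, Fact (ℱ n ≤ m) := fun n => ⟨ℱ.le n⟩
  let U : ℕ → Submodule 𝕜 (Lp 𝕜 2 μ) := fun n => lpMeas 𝕜 𝕜 (ℱ n) 2 μ
  have hU : Monotone U := fun i j hij g hg =>
    mem_lpMeas_iff_aestronglyMeasurable.2
      ((mem_lpMeas_iff_aestronglyMeasurable.1 hg).mono (ℱ.mono hij))
  have hproj : ∀ n, (U n).HasOrthogonalProjection := fun n => by
    have := hF n
    exact inferInstanceAs ((lpMeas 𝕜 𝕜 (ℱ n) 2 μ).HasOrthogonalProjection)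
  set W := (⨆ n, U n).topologicalClosure with hW
  have hWc : CompleteSpace W := (Submodule.isClosed_topologicalClosure _).completeSpace_coe
  set x := hφ.toLp φ with hx
  have hconv := Submodule.starProjection_tendsto_closure_iSup U hU x
  set y := W.starProjection x with hy
  have hWle : W ≤ lpMeas 𝕜 𝕜 (⨆ n, ℱ n) 2 μ := by
    have : Fact ((⨆ n, ℱ n) ≤ m) := ⟨hle⟩
    refine Submodule.topologicalClosure_minimal _ (iSup_le fun n g hg => ?_) ?_
    · exact mem_lpMeas_iff_aestronglyMeasurable.2
        ((mem_lpMeas_iff_aestronglyMeasurable.1 hg).mono (le_iSup (fun n => ℱ n) n))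
    · have : CompleteSpace (lpMeas 𝕜 𝕜 (⨆ n, ℱ n) 2 μ) := inferInstance
      exact (completeSpace_coe_iff_isComplete.1 this).isClosed
  have hym : AEStronglyMeasurable[⨆ n, ℱ n] y μ :=
    mem_lpMeas_iff_aestronglyMeasurable.1 (hWle (Submodule.starProjection_apply_mem _ _))
  have hxm : AEStronglyMeasurable[⨆ n, ℱ n] x μ := hφm.congr hφ.coeFn_toLp.symm
  have hint : Integrable (x - y : Lp 𝕜 2 μ) μ := (Lp.memLp (x - y)).integrable (by norm_num)
  have h0 : μ[(x - y : Lp 𝕜 2 μ)|⨆ n, ℱ n] =ᵐ[μ] 0 := by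
    refine condExp_iSup_ae_eq_zero hint fun n s hs => ?_
    rw [← L2.inner_indicatorConstLp_one (𝕜 := 𝕜) (ℱ.le n s hs) (measure_ne_top _ _)]
    have hmem : indicatorConstLp 2 (ℱ.le n s hs) (measure_ne_top μ s) (1 : 𝕜) ∈ W :=
      Submodule.le_topologicalClosure _ (le_iSup U n (mem_lpMeas_indicatorConstLp (ℱ.le n) hs _))
    exact Submodule.inner_right_of_mem_orthogonal hmem
      (Submodule.sub_starProjection_mem_orthogonal x)
  have hxy : x = y := by
    rw [← sub_eq_zero]
    refine Lp.ext ?_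
    have hm' : AEStronglyMeasurable[⨆ n, ℱ n] (x - y : Lp 𝕜 2 μ) μ :=
      (hxm.sub hym).congr (Lp.coeFn_sub x y).symm
    exact ((condExp_of_aestronglyMeasurable' hle hm' hint).symm.trans h0).trans
      (Lp.coeFn_zero _ _ _).symm
  rw [← hxy] at hconv
  -- The inner product is conjugate linear in its first slot, so f enters through its conjugate.
  have hlim := (tendsto_const_nhds (x := (hf.star.toLp (star f)))).inner (𝕜 := 𝕜) hconv
  have einner : ∀ {ψ : Ω → 𝕜} {z : Lp 𝕜 2 μ}, z =ᵐ[μ] ψ →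
      inner 𝕜 (hf.star.toLp (star f)) z = ∫ x, f x * ψ x ∂μ := by
    intro ψ z hz
    rw [L2.inner_def]
    refine integral_congr_ae ?_
    filter_upwards [hf.star.coeFn_toLp, hz] with ω h1 h2
    rw [h1, h2, RCLike.inner_apply, mul_comm]
    simp
  rw [einner hφ.coeFn_toLp] at hlim
  refine hlim.congr fun n => einner ?_
  exact hφ.condExpL2_ae_eq_condExp (𝕜 := 𝕜) (ℱ.le n)

/-- Identifying φ^τ with E(φ | F_τ) reduces all stopping arguments to orthogonality. On {τ = n} the
σ-algebra F_τ has the same trace as F_n, and on {τ = ∞} the same trace as the limit σ-algebra. -/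
theorem stoppedFun_ae_eq_condExp {ℱ : Filtration ℕ m} {τ : Ω → WithTop ℕ}
    (hτ : IsStoppingTime ℱ τ) (φ : Ω → 𝕜) :
    stoppedFun μ ℱ τ φ =ᵐ[μ] μ[φ|hτ.measurableSpace] := by
  have hle : (⨆ n, ℱ n) ≤ m := iSup_le ℱ.le
  have h1 : ∀ n : ℕ, ∀ᵐ ω ∂μ, τ ω = n → μ[φ|hτ.measurableSpace] ω = μ[φ|ℱ n] ω := fun n =>
    (ae_restrict_iff' (ℱ.le n _ (hτ.measurableSet_eq n))).1
      (condExp_stopping_time_ae_eq_restrict_eq_of_countable hτ n)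
  have htop : MeasurableSet[hτ.measurableSpace] {ω | τ ω = ⊤} := by
    refine ⟨hτ.measurableSet_eq_top', fun i => ?_⟩
    convert @MeasurableSet.empty _ (ℱ i) using 1
    ext ω
    simp only [mem_inter_iff, mem_ofPred_eq, mem_empty_iff_false, iff_false]
    rintro ⟨h1, h2⟩
    rw [h1] at h2
    simp at h2
  have h2 : ∀ᵐ ω ∂μ, τ ω = ⊤ → μ[φ|hτ.measurableSpace] ω = μ[φ|⨆ n, ℱ n] ω := by
    refine (ae_restrict_iff' (hτ.measurableSpace_le _ htop)).1
      (condExp_ae_eq_restrict_of_measurableSpace_eq_on hτ.measurableSpace_le hle htop fun t => ?_)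
    refine ⟨fun h => h.1, fun h => ⟨h, fun i => ?_⟩⟩
    convert @MeasurableSet.empty _ (ℱ i) using 1
    ext ω
    simp only [mem_inter_iff, mem_ofPred_eq, mem_empty_iff_false, iff_false]
    rintro ⟨⟨h1, -⟩, h2⟩
    rw [h1] at h2
    simp at h2
  filter_upwards [ae_all_iff.2 h1, h2] with ω h1 h2
  unfold stoppedFun
  split_ifs with h
  · exact (h2 h).symm
  · obtain ⟨n, hn⟩ := WithTop.ne_top_iff_exists.1 h
    rw [h1 n hn.symm, ← hn]
    rfl

end VarHardy

namespace VarHardy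

variable {Ω : Type*} {m : MeasurableSpace Ω} {μ : Measure Ω}

/-! ### Variable Lebesgue quasi-norms with exponents bounded by one -/

theorem varNorm_le {r g : Ω → ℝ≥0∞} {t : ℝ≥0} (ht : 0 < t)
    (h : varModular μ r (fun x => g x / t) ≤ 1) : varNorm μ r g ≤ t :=
  iInf_le_of_le t (iInf_le_of_le ht (iInf_le_of_le h le_rfl))

theorem le_varNorm {r g : Ω → ℝ≥0∞} {c : ℝ≥0∞}
    (h : ∀ t : ℝ≥0, 0 < t → varModular μ r (fun x => g x / t) ≤ 1 → c ≤ t) :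
    c ≤ varNorm μ r g :=
  le_iInf fun t => le_iInf fun ht => le_iInf fun h' => h t ht h'

theorem varNorm_mono {r g h : Ω → ℝ≥0∞} (hgh : g ≤ᵐ[μ] h) : varNorm μ r g ≤ varNorm μ r h :=
  le_varNorm fun t ht h' => varNorm_le ht ((varModular_mono (by
    filter_upwards [hgh] with x hx
    exact ENNReal.div_le_div_right hx _)).trans h')

theorem varNorm_congr {r g h : Ω → ℝ≥0∞} (hgh : g =ᵐ[μ] h) : varNorm μ r g = varNorm μ r h :=
  le_antisymm (varNorm_mono hgh.le) (varNorm_mono hgh.symm.le)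

/-- The dilation constant `2 ^ (1 / q)`: dividing a function by it at least halves the modular of
any exponent bounded below by `q`. -/
noncomputable def dilConst (q : ℝ) : ℝ≥0 := 2 ^ (1 / q)

theorem dilConst_pos (q : ℝ) : 0 < dilConst q := NNReal.rpow_pos (by norm_num)

theorem dilConst_ne_zero (q : ℝ) : (dilConst q : ℝ≥0∞) ≠ 0 := by
  exact_mod_cast (dilConst_pos q).ne'

theorem two_le_dilConst_rpow {q r : ℝ} (hq : 0 < q) (hqr : q ≤ r) :
    2 ≤ (dilConst q : ℝ≥0∞) ^ r := by
  have h0 : 0 ≤ r := hq.le.trans hqr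
  have : (2 : ℝ≥0) ≤ dilConst q ^ r := by
    rw [dilConst, ← NNReal.rpow_mul]
    nth_rewrite 1 [← NNReal.rpow_one 2]
    refine NNReal.rpow_le_rpow_of_exponent_le (by norm_num) ?_
    rw [one_div_mul_eq_div, le_div_iff₀ hq]
    linarith
  rw [← ENNReal.coe_rpow_of_nonneg _ h0]
  exact_mod_cast this

theorem div_dilConst_rpow_le {q r : ℝ} (hq : 0 < q) (hqr : q ≤ r) (x : ℝ≥0∞) :
    (x / dilConst q) ^ r ≤ x ^ r / 2 := by
  rw [ENNReal.div_rpow_of_nonneg _ _ (hq.le.trans hqr)]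
  exact ENNReal.div_le_div_left (two_le_dilConst_rpow hq hqr) _

variable {p : Ω → ℝ}

theorem varModular_extExp (hp0 : ∀ x, 0 ≤ p x) (g : Ω → ℝ≥0∞) :
    varModular μ (extExp p) g = ∫⁻ x, g x ^ p x ∂μ := by
  have h1 : {x | extExp p x ≠ ∞} = univ := by
    ext x; simp [extExp]
  have h2 : {x | extExp p x = ∞} = ∅ := by
    ext x; simp [extExp]
  have h3 : essSup g (0 : Measure Ω) = 0 :=
    ENNReal.essSup_eq_zero_iff.2 (by rw [ae_zero]; exact eventually_bot)
  simp only [varModular, h1, h2, Measure.restrict_univ, Measure.restrict_empty]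
  rw [h3, add_zero]
  refine lintegral_congr fun x => ?_
  rw [extExp, ENNReal.toReal_ofReal (hp0 x)]

variable {q : ℝ}

theorem varModular_div_dilConst_le (hq : 0 < q) (hqp : ∀ x, q ≤ p x) (g : Ω → ℝ≥0∞) :
    varModular μ (extExp p) (fun x => g x / dilConst q) ≤ varModular μ (extExp p) g / 2 := by
  have hp0 : ∀ x, 0 ≤ p x := fun x => hq.le.trans (hqp x)
  rw [varModular_extExp hp0, varModular_extExp hp0, div_eq_mul_inv,
    ← lintegral_mul_const' _ _ (by norm_num)]
  refine lintegral_mono fun x => ?_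
  rw [← div_eq_mul_inv]
  exact div_dilConst_rpow_le hq (hqp x) _

theorem varNorm_zero (hq : 0 < q) (hqp : ∀ x, q ≤ p x) :
    varNorm μ (extExp p) (fun _ => 0) = 0 := by
  refine le_antisymm (le_of_forall_pos_le_add fun ε hε => ?_) bot_le
  rw [zero_add]
  obtain ⟨t, ht, htε⟩ := ENNReal.lt_iff_exists_nnreal_btwn.1 hε
  refine (varNorm_le (by exact_mod_cast ht) ?_).trans htε.le
  rw [varModular_extExp fun x => hq.le.trans (hqp x)]
  simp [ENNReal.zero_rpow_of_pos (hq.trans_le (hqp _))]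

theorem varNorm_const_mul_le (hq : 0 < q) (hqp : ∀ x, q ≤ p x) (c : ℝ≥0) (g : Ω → ℝ≥0∞) :
    varNorm μ (extExp p) (fun x => c * g x) ≤ c * varNorm μ (extExp p) g := by
  rcases eq_or_ne c 0 with rfl | hc
  · simp [varNorm_zero hq hqp]
  have hc' : (c : ℝ≥0∞) ≠ 0 := by exact_mod_cast hc
  rw [mul_comm, ← ENNReal.div_le_iff hc' ENNReal.coe_ne_top]
  refine le_varNorm fun t ht h => ?_
  rw [ENNReal.div_le_iff hc' ENNReal.coe_ne_top, mul_comm]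
  have := varNorm_le (μ := μ) (r := extExp p) (g := fun x => c * g x) (t := c * t)
    (mul_pos (pos_iff_ne_zero.2 hc) ht) (by
      refine le_trans (le_of_eq ?_) h
      congr 1
      funext x
      rw [ENNReal.coe_mul, ENNReal.mul_div_mul_left _ _ hc' ENNReal.coe_ne_top])
  rwa [ENNReal.coe_mul] at this

/-- Since (g + h)/(s + t) ≤ max(g/s, h/t), its modular is at most 2 when both others are at most 1;
one dilation brings it back below 1. -/
theorem varNorm_add_le (hp : Measurable p) (hq : 0 < q) (hqp : ∀ x, q ≤ p x) {g h : Ω → ℝ≥0∞}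
    (hg : Measurable g) :
    varNorm μ (extExp p) (g + h) ≤
      dilConst q * (varNorm μ (extExp p) g + varNorm μ (extExp p) h) := by
  have hp0 : ∀ x, 0 ≤ p x := fun x => hq.le.trans (hqp x)
  rw [mul_comm, ← ENNReal.div_le_iff (dilConst_ne_zero q) ENNReal.coe_ne_top]
  have key : ∀ s t : ℝ≥0, 0 < s → varModular μ (extExp p) (fun x => g x / s) ≤ 1 → 0 < t →
      varModular μ (extExp p) (fun x => h x / t) ≤ 1 →
      varNorm μ (extExp p) (g + h) / dilConst q ≤ s + t := by
    intro s t hs hs' ht ht'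
    rw [ENNReal.div_le_iff (dilConst_ne_zero q) ENNReal.coe_ne_top]
    have := varNorm_le (μ := μ) (r := extExp p) (g := g + h) (t := (s + t) * dilConst q)
      (mul_pos (add_pos hs ht) (dilConst_pos q)) ?_
    · simpa using this
    · have e : (fun x => (g + h) x / ((s + t) * dilConst q : ℝ≥0)) =
          fun x => (g x + h x) / (s + t : ℝ≥0) / dilConst q := by
        funext x
        rw [ENNReal.coe_mul, Pi.add_apply, ENNReal.div_eq_inv_mul, ENNReal.div_eq_inv_mul,
          ENNReal.div_eq_inv_mul, ENNReal.mul_inv (Or.inr ENNReal.coe_ne_top)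
          (Or.inl ENNReal.coe_ne_top)]
        ring
      rw [e]
      refine (varModular_div_dilConst_le hq hqp _).trans ?_
      refine ENNReal.div_le_of_le_mul ?_
      rw [one_mul, ← one_add_one_eq_two]
      refine le_trans ?_ (add_le_add hs' ht')
      rw [varModular_extExp hp0, varModular_extExp hp0, varModular_extExp hp0,
        ← lintegral_add_left (by fun_prop)]
      refine lintegral_mono fun x => ?_
      refine (ENNReal.rpow_le_rpow (div_add_le_max (g x) (h x) hs ht) (hp0 x)).trans ?_
      rcases le_total (g x / s) (h x / t) with h1 | h1
      · rw [max_eq_right h1]; exact le_add_self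
      · rw [max_eq_left h1]; exact le_self_add
  -- Moving one term at a time to the other side turns the bound for all admissible s and t into a
  -- bound for the two infima.
  rw [← tsub_le_iff_right]
  refine le_varNorm fun s hs hs' => ?_
  rw [tsub_le_iff_left, ← tsub_le_iff_right]
  refine le_varNorm fun t ht ht' => ?_
  rw [tsub_le_iff_right, add_comm (t : ℝ≥0∞)]
  exact key s t hs hs' ht ht'

/-- Each dilation halves the modular, so finitely many bring a finite modular below 1. -/
theorem MemVar.varNorm_lt_top (hq : 0 < q) (hqp : ∀ x, q ≤ p x) {g : Ω → ℝ≥0∞}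
    (hg : MemVar μ (extExp p) g) : varNorm μ (extExp p) g < ∞ := by
  obtain ⟨t, ht, hfin⟩ := hg
  have key : ∀ n : ℕ, varModular μ (extExp p) (fun x => g x / (dilConst q ^ n * t : ℝ≥0)) ≤
      varModular μ (extExp p) (fun x => g x / t) / 2 ^ n := by
    intro n
    induction n with
    | zero => simp
    | succ n ih =>
      have e : (fun x => g x / (dilConst q ^ (n + 1) * t : ℝ≥0)) =
          fun x => g x / (dilConst q ^ n * t : ℝ≥0) / dilConst q := by
        funext x
        rw [ENNReal.div_eq_inv_mul, ENNReal.div_eq_inv_mul, ENNReal.div_eq_inv_mul, ← mul_assoc,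
          ← ENNReal.mul_inv (Or.inr ENNReal.coe_ne_top) (Or.inl ENNReal.coe_ne_top),
          ← ENNReal.coe_mul, pow_succ']
        ring_nf
      rw [e]
      refine (varModular_div_dilConst_le hq hqp _).trans ((ENNReal.div_le_div_right ih _).trans ?_)
      rw [pow_succ, ENNReal.div_eq_inv_mul, ENNReal.div_eq_inv_mul, ENNReal.div_eq_inv_mul,
        ENNReal.mul_inv (by simp) (by simp)]
      exact le_of_eq (by ring)
  obtain ⟨n, hn⟩ := ENNReal.exists_nat_gt hfin.ne
  have h2 : (n : ℝ≥0∞) ≤ 2 ^ n := by exact_mod_cast Nat.lt_two_pow_self.le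
  refine (varNorm_le (t := dilConst q ^ n * t) (mul_pos (pow_pos (dilConst_pos q) n) ht)
    ((key n).trans ?_)).trans_lt ENNReal.coe_lt_top
  exact ENNReal.div_le_of_le_mul (by rw [one_mul]; exact hn.le.trans h2)

theorem MemVar.ae_lt_top (hpm : Measurable p) (hpos : ∀ x, 0 < p x) {g : Ω → ℝ≥0∞}
    (hg : MemVar μ (extExp p) g) (hgm : Measurable g) : ∀ᵐ x ∂μ, g x < ∞ := by
  obtain ⟨t, ht, hfin⟩ := hg
  rw [varModular_extExp fun x => (hpos x).le] at hfin
  filter_upwards [MeasureTheory.ae_lt_top (by fun_prop) hfin.ne] with x hx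
  by_contra! h
  rw [top_le_iff.1 h, ENNReal.top_div_coe, ENNReal.top_rpow_of_pos (hpos x)] at hx
  exact absurd hx (lt_irrefl _)

/-! ### Concavity of powers and the reverse triangle inequality. -/

theorem rpow_concave {w₁ w₂ a b : ℝ≥0∞} (hw : w₁ + w₂ = 1) {r : ℝ} (hr : 0 < r) (hr1 : r ≤ 1) :
    w₁ * a ^ r + w₂ * b ^ r ≤ (w₁ * a + w₂ * b) ^ r := by
  -- Concavity of the power r is read off from convexity of the power 1/r at the points a^r and b^r.
  have h := ENNReal.rpow_arith_mean_le_arith_mean2_rpow w₁ w₂ (a ^ r) (b ^ r) hw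
    (p := 1 / r) (by rw [le_div_iff₀ hr]; linarith)
  rw [← ENNReal.rpow_mul, ← ENNReal.rpow_mul, mul_one_div_cancel hr.ne', ENNReal.rpow_one,
    ENNReal.rpow_one] at h
  have h2 := ENNReal.rpow_le_rpow h hr.le
  rwa [← ENNReal.rpow_mul, one_div_mul_cancel hr.ne', ENNReal.rpow_one] at h2

/-- The triangle inequality reverses because x ↦ x^p(ω) is concave. If s and t lie just below the
two quasi-norms, the modulars of g/s and h/t exceed 1. As (g + h)/(s + t) is their convex
combination with weights s/(s + t) and t/(s + t), its modular exceeds 1 too, so no T ≤ s + t is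
admissible for g + h. -/
theorem add_varNorm_le (hp : Measurable p) (hpos : ∀ x, 0 < p x) (hup : ∀ x, p x ≤ 1)
    {g h : Ω → ℝ≥0∞} (hg : Measurable g) :
    varNorm μ (extExp p) g + varNorm μ (extExp p) h ≤ varNorm μ (extExp p) (g + h) := by
  have hp0 : ∀ x, 0 ≤ p x := fun x => (hpos x).le
  refine le_varNorm fun T hT hT' => ?_
  by_contra! hlt
  rcases eq_or_ne (varNorm μ (extExp p) g) 0 with h0 | hg0
  · rw [h0, zero_add] at hlt
    exact absurd (hlt.trans_le ((varNorm_mono (Eventually.of_forall fun x => le_add_self)).trans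
      (varNorm_le hT hT'))) (lt_irrefl _)
  rcases eq_or_ne (varNorm μ (extExp p) h) 0 with h0 | hh0
  · rw [h0, add_zero] at hlt
    exact absurd (hlt.trans_le ((varNorm_mono (Eventually.of_forall fun x => le_self_add)).trans
      (varNorm_le hT hT'))) (lt_irrefl _)
  obtain ⟨s, t, hs0, ht0, hs, ht, hst⟩ : ∃ s t : ℝ≥0, 0 < s ∧ 0 < t ∧
      (s : ℝ≥0∞) < varNorm μ (extExp p) g ∧ (t : ℝ≥0∞) < varNorm μ (extExp p) h ∧
      T ≤ s + t := by
    obtain ⟨c, hc, d, hd, hcd⟩ := ENNReal.exists_lt_add_of_lt_add hlt hg0 hh0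
    obtain ⟨s, hcs, hs⟩ := ENNReal.lt_iff_exists_nnreal_btwn.1 hc
    obtain ⟨t, hdt, ht⟩ := ENNReal.lt_iff_exists_nnreal_btwn.1 hd
    refine ⟨s, t, ENNReal.coe_pos.1 (bot_le.trans_lt hcs), ENNReal.coe_pos.1 (bot_le.trans_lt hdt),
      hs, ht, ?_⟩
    have : (T : ℝ≥0∞) ≤ s + t := hcd.le.trans (add_le_add hcs.le hdt.le)
    exact_mod_cast this
  have hs1 : 1 < varModular μ (extExp p) (fun x => g x / s) := by
    by_contra! hle
    exact absurd (hs.trans_le (varNorm_le hs0 hle)) (lt_irrefl _)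
  have ht1 : 1 < varModular μ (extExp p) (fun x => h x / t) := by
    by_contra! hle
    exact absurd (ht.trans_le (varNorm_le ht0 hle)) (lt_irrefl _)
  have hst0 : ((s + t : ℝ≥0) : ℝ≥0∞) ≠ 0 := by exact_mod_cast (add_pos hs0 ht0).ne'
  set w₁ : ℝ≥0∞ := s / (s + t : ℝ≥0) with hw₁
  set w₂ : ℝ≥0∞ := t / (s + t : ℝ≥0) with hw₂
  have hw : w₁ + w₂ = 1 := by
    rw [hw₁, hw₂, ENNReal.div_add_div_same, ← ENNReal.coe_add,
      ENNReal.div_self hst0 ENNReal.coe_ne_top]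
  have hw₁0 : w₁ ≠ 0 := by
    rw [hw₁, ne_eq, ENNReal.div_eq_zero_iff]
    push Not
    exact ⟨by exact_mod_cast hs0.ne', ENNReal.coe_ne_top⟩
  have hw₁t : w₁ ≠ ∞ := ENNReal.div_ne_top ENNReal.coe_ne_top hst0
  have hmod : w₁ * varModular μ (extExp p) (fun x => g x / s) +
      w₂ * varModular μ (extExp p) (fun x => h x / t) ≤
      varModular μ (extExp p) (fun x => (g + h) x / T) := by
    rw [varModular_extExp hp0, varModular_extExp hp0, varModular_extExp hp0,
      ← lintegral_const_mul _ (by fun_prop),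
      ← lintegral_const_mul' _ _ (ENNReal.div_ne_top ENNReal.coe_ne_top hst0),
      ← lintegral_add_left (by fun_prop)]
    refine lintegral_mono fun x => (rpow_concave hw (hpos x) (hup x)).trans ?_
    refine ENNReal.rpow_le_rpow ?_ (hp0 x)
    have hsx : ∀ (a : ℝ≥0∞) {u : ℝ≥0}, 0 < u → u / ((s + t : ℝ≥0) : ℝ≥0∞) * (a / u) =
        a / (s + t : ℝ≥0) := by
      intro a u hu
      have hu' : (u : ℝ≥0∞) ≠ 0 := by exact_mod_cast hu.ne'
      calc u / ((s + t : ℝ≥0) : ℝ≥0∞) * (a / u) = a / u * u / (s + t : ℝ≥0) := by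
            simp only [div_eq_mul_inv]; ring
        _ = _ := by rw [ENNReal.div_mul_cancel hu' ENNReal.coe_ne_top]
    rw [hw₁, hw₂, hsx _ hs0, hsx _ ht0, ENNReal.div_add_div_same]
    exact ENNReal.div_le_div_left (by exact_mod_cast hst) _
  refine absurd (hmod.trans hT') (not_le.2 ?_)
  calc (1 : ℝ≥0∞) = w₁ * 1 + w₂ * 1 := by rw [mul_one, mul_one, hw]
    _ < _ := ENNReal.add_lt_add_of_lt_of_le
      (ENNReal.mul_ne_top (ENNReal.div_ne_top ENNReal.coe_ne_top hst0) ENNReal.one_ne_top)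
      (ENNReal.mul_lt_mul_right hw₁0 hw₁t hs1) (by gcongr)

theorem sum_varNorm_le (hp : Measurable p) (hq : 0 < q) (hqp : ∀ x, q ≤ p x)
    (hup : ∀ x, p x ≤ 1) {ι : Type*} (s : Finset ι) {g : ι → Ω → ℝ≥0∞}
    (hg : ∀ i, Measurable (g i)) :
    ∑ i ∈ s, varNorm μ (extExp p) (g i) ≤ varNorm μ (extExp p) (fun x => ∑ i ∈ s, g i x) := by
  classical
  induction s using Finset.induction_on with
  | empty => simp
  | insert i s hi ih =>
    rw [Finset.sum_insert hi]
    simp_rw [Finset.sum_insert hi]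
    exact (add_le_add_right ih _).trans
      (add_varNorm_le hp (fun x => hq.trans_le (hqp x)) hup (hg i))

/-- Dominated convergence in the modular: for each fixed e the functions (h_n/e)^p tend to 0 under
one integrable majorant, so eventually e is admissible. -/
theorem tendsto_varNorm_zero (hp : Measurable p) (hq : 0 < q) (hqp : ∀ x, q ≤ p x)
    (hup : ∀ x, p x ≤ 1) {s : Ω → ℝ≥0∞} (hs : MemVar μ (extExp p) s) {h : ℕ → Ω → ℝ≥0∞}
    (hm : ∀ n, Measurable (h n)) (hle : ∀ n, h n ≤ᵐ[μ] s)
    (hlim : ∀ᵐ x ∂μ, Tendsto (fun n => h n x) atTop (nhds 0)) :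
    Tendsto (fun n => varNorm μ (extExp p) (h n)) atTop (nhds 0) := by
  have hp0 : ∀ x, 0 ≤ p x := fun x => hq.le.trans (hqp x)
  obtain ⟨t, ht, hfin⟩ := hs
  rw [varModular_extExp hp0] at hfin
  rw [ENNReal.tendsto_nhds_zero]
  intro ε hε
  obtain ⟨e, he, heε⟩ := ENNReal.lt_iff_exists_nnreal_btwn.1 hε
  have he0 : (e : ℝ≥0∞) ≠ 0 := he.ne'
  have ht0 : (t : ℝ≥0∞) ≠ 0 := by exact_mod_cast ht.ne'
  have hlim' : Tendsto (fun n => ∫⁻ x, (h n x / e) ^ p x ∂μ) atTop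
      (nhds (∫⁻ _, (0 : ℝ≥0∞) ∂μ)) := by
    -- Since 0 < p ≤ 1, the factor (t/e)^p is at most max(1, t/e), which is constant.
    refine tendsto_lintegral_of_dominated_convergence
      (fun x => max 1 ((t : ℝ≥0∞) / e) * (s x / t) ^ p x)
      (fun n => by fun_prop) (fun n => ?_) ?_ ?_
    · filter_upwards [hle n] with x hx
      calc (h n x / e) ^ p x ≤ (t / e * (s x / t)) ^ p x := by
            refine ENNReal.rpow_le_rpow ?_ (hp0 x)
            calc h n x / e ≤ s x / e := ENNReal.div_le_div_right hx _
              _ = s x / t * t / e := by rw [ENNReal.div_mul_cancel ht0 ENNReal.coe_ne_top]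
              _ = _ := by simp only [div_eq_mul_inv]; ring
        _ = (t / e) ^ p x * (s x / t) ^ p x := ENNReal.mul_rpow_of_nonneg _ _ (hp0 x)
        _ ≤ _ := by
          gcongr
          rcases le_total (t / e : ℝ≥0∞) 1 with h1 | h1
          · exact (ENNReal.rpow_le_one h1 (hp0 x)).trans (le_max_left _ _)
          · refine le_trans ?_ (le_max_right _ _)
            calc (t / e : ℝ≥0∞) ^ p x ≤ (t / e : ℝ≥0∞) ^ (1 : ℝ) :=
                  ENNReal.rpow_le_rpow_of_exponent_le h1 (hup x)
              _ = _ := ENNReal.rpow_one _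
    · have hc : max 1 (t / e : ℝ≥0∞) ≠ ∞ :=
        (max_lt ENNReal.one_lt_top (ENNReal.div_lt_top ENNReal.coe_ne_top he0)).ne
      rw [lintegral_const_mul' _ _ hc]
      exact ENNReal.mul_ne_top hc hfin.ne
    · filter_upwards [hlim] with x hx
      have h1 : Tendsto (fun n => h n x / e) atTop (nhds (0 / e)) :=
        ENNReal.Tendsto.div_const hx (Or.inr he0)
      rw [ENNReal.zero_div] at h1
      have h2 := ((ENNReal.continuous_rpow_const (y := p x)).tendsto 0).comp h1
      rwa [ENNReal.zero_rpow_of_pos (hq.trans_le (hqp x))] at h2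
  rw [lintegral_zero] at hlim'
  filter_upwards [hlim'.eventually (ge_mem_nhds zero_lt_one)] with n hn
  refine (varNorm_le (by exact_mod_cast he) ?_).trans heε.le
  rwa [varModular_extExp hp0]

end VarHardy

namespace VarHardy

variable {Ω : Type*} {m : MeasurableSpace Ω} {μ : Measure Ω} {p : Ω → ℝ} {q a b : ℝ}
  {B : Set Ω}

/-! ### Quasi-norms of indicator functions -/

theorem dualExp_eq_top_iff (hpos : ∀ x, 0 < p x) (hup : ∀ x, p x ≤ 1) {x : Ω} :
    dualExp p x = ∞ ↔ p x = 1 := by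
  rw [dualExp, ENNReal.inv_eq_top, ENNReal.ofReal_eq_zero, sub_nonpos, div_le_one (hpos x)]
  exact ⟨fun h => le_antisymm (hup x) h, fun h => h.ge⟩

theorem measurable_dualExp (hp : Measurable p) : Measurable (dualExp p) :=
  (ENNReal.measurable_ofReal.comp ((measurable_const.div hp).sub measurable_const)).inv

theorem one_div_sub_one_pos (hpos : ∀ x, 0 < p x) (hup : ∀ x, p x ≤ 1) {x : Ω} (h : p x ≠ 1) :
    0 < 1 / p x - 1 :=
  sub_pos.2 ((one_lt_div (hpos x)).2 (lt_of_le_of_ne (hup x) h))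

theorem toReal_dualExp (hpos : ∀ x, 0 < p x) (hup : ∀ x, p x ≤ 1) {x : Ω} :
    (dualExp p x).toReal = (1 / p x - 1)⁻¹ := by
  rw [dualExp, ENNReal.toReal_inv, ENNReal.toReal_ofReal]
  exact sub_nonneg.2 ((one_le_div (hpos x)).2 (hup x))

/-- A value t < μ(B)^(1/a) is at most 1, so t^(-p) ≥ t^(-a) > 1/μ(B) on B and the modular exceeds 1.
-/
theorem rpow_le_varNorm_indicator (hB : MeasurableSet B) (hpos : ∀ x, 0 < p x)
    (ha : 0 < a) (hap : ∀ x ∈ B, a ≤ p x) (hB1 : μ B ≤ 1) :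
    μ B ^ (1 / a) ≤ varNorm μ (extExp p) (B.indicator 1) := by
  have hp0 : ∀ x, 0 ≤ p x := fun x => (hpos x).le
  refine le_varNorm fun t ht h => ?_
  by_contra! hlt
  have ht0 : (t : ℝ≥0∞) ≠ 0 := by exact_mod_cast ht.ne'
  have ht1 : (t : ℝ≥0∞) ≤ 1 := hlt.le.trans (ENNReal.rpow_le_one hB1 (by positivity))
  have hta : (t : ℝ≥0∞) ^ a < μ B := by
    have := ENNReal.rpow_lt_rpow hlt ha
    rwa [← ENNReal.rpow_mul, one_div_mul_cancel ha.ne', ENNReal.rpow_one] at this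
  rw [varModular_extExp hp0] at h
  refine absurd h (not_le.2 ?_)
  have hta0 : (t : ℝ≥0∞) ^ a ≠ 0 := by simp [ht0]
  have htat : (t : ℝ≥0∞) ^ a ≠ ∞ := (hta.trans_le (hB1.trans le_top)).ne
  calc (1 : ℝ≥0∞) < μ B / (t : ℝ≥0∞) ^ a := by
        rwa [ENNReal.lt_div_iff_mul_lt (Or.inl hta0) (Or.inl htat), one_mul]
    _ = ∫⁻ _ in B, ((t : ℝ≥0∞) ^ a)⁻¹ ∂μ := by
        rw [setLIntegral_const, div_eq_mul_inv, mul_comm]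
    _ ≤ ∫⁻ x in B, (B.indicator 1 x / t) ^ p x ∂μ := by
        refine setLIntegral_mono' hB fun x hx => ?_
        rw [indicator_of_mem hx, Pi.one_apply, one_div, ← ENNReal.inv_rpow]
        exact ENNReal.rpow_le_rpow_of_exponent_le (by rwa [ENNReal.one_le_inv]) (hap x hx)
    _ ≤ _ := setLIntegral_le_lintegral _ _

theorem varNorm_dualExp_indicator_le (hp : Measurable p) (hB : MeasurableSet B) (hq : 0 < q)
    (hqp : ∀ x, q ≤ p x) (hup : ∀ x, p x ≤ 1) (hb : 0 < b) (hb1 : b ≤ 1)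
    (hpb : ∀ x ∈ B, p x ≤ b) (hB0 : μ B ≠ 0) (hB1 : μ B ≤ 1) :
    varNorm μ (dualExp p) (B.indicator 1) ≤ dilConst q * μ B ^ (1 / b - 1) := by
  have hpos : ∀ x, 0 < p x := fun x => hq.trans_le (hqp x)
  have hBt : μ B ≠ ∞ := (hB1.trans_lt ENNReal.one_lt_top).ne
  have hb0 : 0 ≤ 1 / b - 1 := sub_nonneg.2 ((one_le_div hb).2 hb1)
  have hfin : dilConst q * μ B ^ (1 / b - 1) ≠ ∞ :=
    ENNReal.mul_ne_top ENNReal.coe_ne_top (ENNReal.rpow_ne_top_of_nonneg hb0 hBt)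
  -- With this t each of the two parts of the modular is at most 1/2. Where r = 1/α is finite,
  -- `dilConst q` raised to r is at least 2 because q ≤ p ≤ r, and the power of μ(B) raised to r is
  -- at least μ(B) because (1/b - 1) r ≤ 1; hence t^r ≥ 2 μ(B).
  obtain ⟨t, ht⟩ : ∃ t : ℝ≥0, (t : ℝ≥0∞) = dilConst q * μ B ^ (1 / b - 1) :=
    ⟨_, ENNReal.coe_toNNReal hfin⟩
  have ht0 : (t : ℝ≥0∞) ≠ 0 := by
    rw [ht]
    exact mul_ne_zero (dilConst_ne_zero q) (by simp [hB0, hBt])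
  rw [← ht]
  refine varNorm_le (pos_iff_ne_zero.2 (by exact_mod_cast ht0)) ?_
  rw [varModular, ← ENNReal.inv_two_add_inv_two]
  refine add_le_add ?_ ?_
  · calc ∫⁻ x in {x | dualExp p x ≠ ∞}, (B.indicator 1 x / t) ^ (dualExp p x).toReal ∂μ
        ≤ ∫⁻ x in {x | dualExp p x ≠ ∞}, B.indicator (fun _ => (2 * μ B)⁻¹) x ∂μ := by
          refine setLIntegral_mono' (measurable_dualExp hp (measurableSet_singleton _).compl)
            fun x hx => ?_
          have hx1 : p x ≠ 1 := fun h => hx ((dualExp_eq_top_iff hpos hup).2 h)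
          have hα := one_div_sub_one_pos hpos hup hx1
          rw [toReal_dualExp hpos hup]
          set r := (1 / p x - 1)⁻¹ with hr
          have hr0 : 0 < r := inv_pos.2 hα
          by_cases hxB : x ∈ B
          · rw [indicator_of_mem hxB, indicator_of_mem hxB, Pi.one_apply, one_div,
              ENNReal.inv_rpow, ENNReal.inv_le_inv, ht, ENNReal.mul_rpow_of_nonneg _ _ hr0.le]
            refine mul_le_mul' (two_le_dilConst_rpow hq ?_) ?_
            · refine (hqp x).trans ?_
              rw [hr, le_inv_comm₀ (hpos x) hα, ← one_div]
              linarith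
            · rw [← ENNReal.rpow_mul]
              nth_rewrite 1 [← ENNReal.rpow_one (μ B)]
              refine ENNReal.rpow_le_rpow_of_exponent_ge hB1 ?_
              rw [hr, ← div_eq_mul_inv, div_le_one hα]
              exact sub_le_sub_right (one_div_le_one_div_of_le (hpos x) (hpb x hxB)) 1
          · rw [indicator_of_notMem hxB, indicator_of_notMem hxB, ENNReal.zero_div,
              ENNReal.zero_rpow_of_pos hr0]
      _ ≤ ∫⁻ x, B.indicator (fun _ => (2 * μ B)⁻¹) x ∂μ := setLIntegral_le_lintegral _ _
      _ = 2⁻¹ := by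
          rw [lintegral_indicator_const hB, ENNReal.mul_inv (by simp) (by simp), mul_assoc,
            ENNReal.inv_mul_cancel hB0 hBt, mul_one]
  · refine essSup_le_of_ae_le _ ?_
    refine ae_restrict_of_forall_mem (measurable_dualExp hp (measurableSet_singleton _))
      fun x hx => ?_
    by_cases hxB : x ∈ B
    · have hx1 : p x = 1 := (dualExp_eq_top_iff hpos hup).1 hx
      -- A point of B with p = 1 forces b = 1, so t is the dilation constant alone, which is at
      -- least 2 there.
      have hb' : b = 1 := le_antisymm hb1 (hx1 ▸ hpb x hxB)
      have h2 := two_le_dilConst_rpow hq (hqp x)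
      rw [hx1, ENNReal.rpow_one] at h2
      change B.indicator 1 x / (t : ℝ≥0∞) ≤ 2⁻¹
      rw [indicator_of_mem hxB, Pi.one_apply, one_div, ht, hb']
      simpa using h2
    · simp [indicator_of_notMem hxB]

theorem rpow_le_varNorm_dualExp_indicator (hp : Measurable p) (hB : MeasurableSet B)
    (hpos : ∀ x, 0 < p x) (hup : ∀ x, p x ≤ 1) (ha : 0 < a) (hap : ∀ x ∈ B, a ≤ p x)
    (ha1 : a ≤ 1) (hB0 : μ B ≠ 0) (hB1 : μ B ≤ 1) :
    μ B ^ (1 / a - 1) ≤ varNorm μ (dualExp p) (B.indicator 1) := by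
  have hBt : μ B ≠ ∞ := (hB1.trans_lt ENNReal.one_lt_top).ne
  have ha0 : 0 ≤ 1 / a - 1 := sub_nonneg.2 ((one_le_div ha).2 ha1)
  refine le_varNorm fun t ht h => ?_
  by_contra! hlt
  have ht0 : (t : ℝ≥0∞) ≠ 0 := by exact_mod_cast ht.ne'
  have ht1 : (t : ℝ≥0∞) < 1 := hlt.trans_le (ENNReal.rpow_le_one hB1 ha0)
  refine absurd h (not_le.2 ?_)
  rw [varModular]
  have hT : MeasurableSet {x | dualExp p x = ∞} := measurable_dualExp hp (measurableSet_singleton _)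
  -- If p < 1 almost everywhere on B, the integral part exceeds 1. Otherwise B meets {p = 1} in
  -- positive measure and the essential supremum is at least 1/t > 1.
  by_cases hnull : μ ({x | dualExp p x = ∞} ∩ B) = 0
  · refine lt_of_lt_of_le ?_ le_self_add
    have hBeq : μ (B ∩ {x | dualExp p x ≠ ∞}) = μ B := by
      rw [inter_comm] at hnull
      have := measure_inter_add_sdiff (μ := μ) B hT
      rw [hnull, zero_add] at this
      exact this
    have hne : (B ∩ {x | dualExp p x ≠ ∞}).Nonempty :=
      nonempty_of_measure_ne_zero (by rwa [hBeq])
    have hpow : ∀ x ∈ B, dualExp p x ≠ ∞ →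
        0 < 1 / p x - 1 ∧ 1 / p x - 1 ≤ 1 / a - 1 := by
      intro x hxB hx
      have hx1 : p x ≠ 1 := fun h => hx ((dualExp_eq_top_iff hpos hup).2 h)
      exact ⟨one_div_sub_one_pos hpos hup hx1,
        sub_le_sub_right (one_div_le_one_div_of_le ha (hap x hxB)) 1⟩
    have hα : 0 < 1 / a - 1 := by
      obtain ⟨x, hxB, hx⟩ := hne
      exact (hpow x hxB hx).1.trans_le (hpow x hxB hx).2
    set r := (1 / a - 1)⁻¹ with hr
    have hr0 : 0 < r := inv_pos.2 hα
    have htr : (t : ℝ≥0∞) ^ r < μ B := by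
      have := ENNReal.rpow_lt_rpow hlt hr0
      rwa [← ENNReal.rpow_mul, mul_inv_cancel₀ hα.ne', ENNReal.rpow_one] at this
    have htr0 : (t : ℝ≥0∞) ^ r ≠ 0 := by simp [ht0]
    have htrt : (t : ℝ≥0∞) ^ r ≠ ∞ := (htr.trans_le (hB1.trans le_top)).ne
    calc (1 : ℝ≥0∞) < μ B / (t : ℝ≥0∞) ^ r := by
          rwa [ENNReal.lt_div_iff_mul_lt (Or.inl htr0) (Or.inl htrt), one_mul]
      _ = ∫⁻ _ in B ∩ {x | dualExp p x ≠ ∞}, ((t : ℝ≥0∞) ^ r)⁻¹ ∂μ := by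
          rw [setLIntegral_const, hBeq, div_eq_mul_inv, mul_comm]
      _ ≤ ∫⁻ x in B ∩ {x | dualExp p x ≠ ∞},
            (B.indicator 1 x / t) ^ (dualExp p x).toReal ∂μ := by
          refine setLIntegral_mono' (hB.inter hT.compl) fun x hx => ?_
          rw [indicator_of_mem hx.1, Pi.one_apply, one_div, ← ENNReal.inv_rpow,
            toReal_dualExp hpos hup]
          refine ENNReal.rpow_le_rpow_of_exponent_le (by rw [ENNReal.one_le_inv]; exact ht1.le) ?_
          exact inv_anti₀ (hpow x hx.1 hx.2).1 (hpow x hx.1 hx.2).2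
      _ ≤ _ := lintegral_mono_set inter_subset_right
  · refine lt_of_lt_of_le ?_ le_add_self
    refine lt_of_lt_of_le (ENNReal.one_lt_inv.2 ht1) ?_
    by_contra! hess
    have h1 := ae_lt_of_essSup_lt hess
    rw [ae_restrict_iff' hT] at h1
    refine hnull (measure_mono_null ?_ h1)
    rintro x ⟨hx, hxB⟩
    simp only [mem_compl_iff, mem_ofPred_eq, Classical.not_imp, not_lt]
    exact ⟨hx, by rw [indicator_of_mem hxB]; simp⟩

/-- A Hölder inequality with variable exponent. Let y = h μ(B)^(1/2)/‖h‖_2, whose mean square over B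
is at most 1, and divide h by s = ‖h‖_2 μ(B)^(1/b-1/2). On B the integrand is y^p μ(B)^(-p/b) ≤ (1 +
y²)/μ(B), because p ≤ 1 and p ≤ b. The modular is thus at most 2, and one dilation halves it. -/
theorem varNorm_le_of_support (hB : MeasurableSet B) (hq : 0 < q) (hqp : ∀ x, q ≤ p x)
    (hup : ∀ x, p x ≤ 1)
    (hb : 0 < b) (hpb : ∀ x ∈ B, p x ≤ b) (hB0 : μ B ≠ 0) (hB1 : μ B ≤ 1) {h : Ω → ℝ≥0∞}
    (hh : Measurable h) (hsupp : ∀ᵐ x ∂μ, x ∉ B → h x = 0) :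
    varNorm μ (extExp p) h ≤
      dilConst q * ((∫⁻ x, h x ^ 2 ∂μ) ^ (1 / 2 : ℝ) * μ B ^ (1 / b - 1 / 2)) := by
  have hp0 : ∀ x, 0 ≤ p x := fun x => hq.le.trans (hqp x)
  have hBt : μ B ≠ ∞ := (hB1.trans_lt ENNReal.one_lt_top).ne
  set H := ∫⁻ x, h x ^ 2 ∂μ with hH
  have hθ0 : ∀ s : ℝ, μ B ^ s ≠ 0 := fun s => by simp [hB0, hBt]
  have hθt : ∀ s : ℝ, μ B ^ s ≠ ∞ := fun s => by simp [hB0, hBt]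
  rcases eq_or_ne H 0 with h0 | hH0
  · have : h =ᵐ[μ] fun _ => 0 := by
      have := (lintegral_eq_zero_iff (hh.pow_const 2)).1 h0
      filter_upwards [this] with x hx
      simpa using hx
    rw [varNorm_congr this, varNorm_zero hq hqp]
    exact bot_le
  rcases eq_or_ne H ∞ with hT | hHt
  · rw [hT, ENNReal.top_rpow_of_pos (by norm_num), ENNReal.top_mul (hθ0 _),
      ENNReal.mul_top (dilConst_ne_zero q)]
    exact le_top
  have hs0 : H ^ (1 / 2 : ℝ) * μ B ^ (1 / b - 1 / 2) ≠ 0 :=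
    mul_ne_zero (by simp [hH0, hHt]) (hθ0 _)
  have hst : H ^ (1 / 2 : ℝ) * μ B ^ (1 / b - 1 / 2) ≠ ∞ :=
    ENNReal.mul_ne_top (by simp [hHt]) (hθt _)
  obtain ⟨s, hs⟩ : ∃ s : ℝ≥0, (s : ℝ≥0∞) = H ^ (1 / 2 : ℝ) * μ B ^ (1 / b - 1 / 2) :=
    ⟨_, ENNReal.coe_toNNReal hst⟩
  have hs0' : 0 < s := pos_iff_ne_zero.2 (by rw [← hs] at hs0; exact_mod_cast hs0)
  rw [← hs, ← ENNReal.coe_mul]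
  refine varNorm_le (mul_pos (dilConst_pos q) hs0') ?_
  have e : (fun x => h x / (dilConst q * s : ℝ≥0)) = fun x => h x / s / dilConst q := by
    funext x
    rw [ENNReal.coe_mul, ENNReal.div_eq_inv_mul, ENNReal.div_eq_inv_mul, ENNReal.div_eq_inv_mul,
      ENNReal.mul_inv (Or.inr ENNReal.coe_ne_top) (Or.inl ENNReal.coe_ne_top)]
    ring
  rw [e]
  refine (varModular_div_dilConst_le hq hqp _).trans (ENNReal.div_le_of_le_mul ?_)
  rw [varModular_extExp hp0, one_mul]
  calc ∫⁻ x, (h x / s) ^ p x ∂μ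
      ≤ ∫⁻ x, B.indicator (fun x => (μ B)⁻¹ + H⁻¹ * h x ^ 2) x ∂μ := by
        refine lintegral_mono_ae ?_
        filter_upwards [hsupp] with x hx
        by_cases hxB : x ∈ B
        · rw [indicator_of_mem hxB]
          set y := h x * μ B ^ (1 / 2 : ℝ) / H ^ (1 / 2 : ℝ) with hy
          have hys : h x / s = y * μ B ^ (-(1 / b)) := by
            rw [hs, hy, ENNReal.div_eq_inv_mul, ENNReal.div_eq_inv_mul,
              ENNReal.mul_inv (Or.inr (hθt _)) (Or.inr (hθ0 _)), ← ENNReal.rpow_neg (μ B),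
              show -(1 / b - 1 / 2) = 1 / 2 + -(1 / b) by ring, ENNReal.rpow_add _ _ hB0 hBt]
            ring
          have hy1 : y ^ p x ≤ 1 + y ^ 2 := by
            rcases le_total y 1 with h1 | h1
            · exact (ENNReal.rpow_le_one h1 (hp0 x)).trans le_self_add
            · refine le_trans ?_ (le_add_self (a := y ^ 2))
              rw [← ENNReal.rpow_natCast]
              exact ENNReal.rpow_le_rpow_of_exponent_le h1 ((hup x).trans (by norm_num))
          have hy2 : y ^ 2 = h x ^ 2 * μ B / H := by
            rw [hy, div_eq_mul_inv, mul_pow, mul_pow, ← ENNReal.inv_pow, ← ENNReal.rpow_natCast,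
              ← ENNReal.rpow_natCast (μ B ^ _), ← ENNReal.rpow_natCast (H ^ _),
              ← ENNReal.rpow_mul, ← ENNReal.rpow_mul]
            norm_num [div_eq_mul_inv]
          have hθ : (μ B ^ (-(1 / b))) ^ p x ≤ (μ B)⁻¹ := by
            rw [← ENNReal.rpow_mul, ← ENNReal.rpow_neg_one]
            refine ENNReal.rpow_le_rpow_of_exponent_ge hB1 ?_
            have := (div_le_one hb).2 (hpb x hxB)
            have e2 : -(1 / b) * p x = -(p x / b) := by ring
            linarith
          rw [hys, ENNReal.mul_rpow_of_nonneg _ _ (hp0 x)]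
          calc _ ≤ (1 + y ^ 2) * (μ B)⁻¹ := mul_le_mul' hy1 hθ
            _ = (μ B)⁻¹ + H⁻¹ * h x ^ 2 * (μ B * (μ B)⁻¹) := by
              rw [hy2, div_eq_mul_inv]; ring
            _ = _ := by rw [ENNReal.mul_inv_cancel hB0 hBt, mul_one]
        · rw [indicator_of_notMem hxB, hx hxB, ENNReal.zero_div,
            ENNReal.zero_rpow_of_pos (hq.trans_le (hqp x))]
    _ = ∫⁻ x in B, ((μ B)⁻¹ + H⁻¹ * h x ^ 2) ∂μ := lintegral_indicator hB _
    _ = 1 + H⁻¹ * ∫⁻ x in B, h x ^ 2 ∂μ := by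
        rw [lintegral_add_left measurable_const, setLIntegral_const,
          ENNReal.inv_mul_cancel hB0 hBt, lintegral_const_mul _ (hh.pow_const 2)]
    _ ≤ 1 + H⁻¹ * H := by gcongr; exact setLIntegral_le_lintegral _ _
    _ = 2 := by rw [ENNReal.inv_mul_cancel hH0 hHt]; norm_num

/-! ### Consequences of the oscillation condition -/

theorem rpow_inv_le_of_oscillation {θ K : ℝ≥0∞} (hθ0 : θ ≠ 0) (hθ1 : θ ≤ 1) (hq : 0 < q)
    (hqa : q ≤ a) (hab : a ≤ b) (hK : 1 ≤ K) (h : θ ^ (a - b) ≤ K) :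
    θ ^ (1 / b) ≤ K ^ (1 / q ^ 2) * θ ^ (1 / a) := by
  have hθt : θ ≠ ∞ := (hθ1.trans_lt ENNReal.one_lt_top).ne
  have ha : 0 < a := hq.trans_le hqa
  have hb : 0 < b := ha.trans_le hab
  -- This splits off the exponent a - b of the oscillation condition; the remaining factor 1/(ab) is
  -- at most 1/q², whence the power of K.
  have e : 1 / b = (a - b) * (1 / (a * b)) + 1 / a := by
    field_simp
    ring
  rw [e, ENNReal.rpow_add _ _ hθ0 hθt, ENNReal.rpow_mul]
  gcongr
  refine (ENNReal.rpow_le_rpow h (by positivity)).trans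
    (ENNReal.rpow_le_rpow_of_exponent_le hK ?_)
  refine one_div_le_one_div_of_le (by positivity) ?_
  rw [sq]
  exact mul_le_mul hqa (hqa.trans hab) hq.le ha.le

/-- The constant `C` compares the quasi-norms of indicator functions for the exponents `p` and
`1 / α`, `α = 1 / p - 1`, and bounds the inclusion of `L²` in `L^{p(·)}` on every set. -/
def IndicatorComparison (μ : Measure Ω) (p : Ω → ℝ) (C : ℝ≥0) : Prop :=
  ∀ B : Set Ω, MeasurableSet B → μ B ≠ 0 →
    μ B * varNorm μ (dualExp p) (B.indicator 1) ≤ C * varNorm μ (extExp p) (B.indicator 1) ∧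
    varNorm μ (dualExp p) (B.indicator 1) ≠ ∞ ∧
    varNorm μ (dualExp p) (B.indicator 1) ≠ 0 ∧
    ∀ h : Ω → ℝ≥0∞, Measurable h → (∀ᵐ x ∂μ, x ∉ B → h x = 0) →
      varNorm μ (extExp p) h ≤ C * ((∫⁻ x, h x ^ 2 ∂μ) ^ (1 / 2 : ℝ) *
        (μ B ^ (1 / 2 : ℝ) * varNorm μ (dualExp p) (B.indicator 1)))

/-- The indicator estimates lose only the gap between μ(B)^(1/b) and μ(B)^(1/a), and the oscillation
condition bounds this gap uniformly in B. -/
theorem OscillationCondition.exists_const [IsProbabilityMeasure μ]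
    (hcond : OscillationCondition μ p)
    (hp : Measurable p) (hq : 0 < q) (hqp : ∀ x, q ≤ p x) (hup : ∀ x, p x ≤ 1) :
    ∃ C : ℝ≥0, 0 < C ∧ IndicatorComparison μ p C := by
  obtain ⟨K, hK1, hK⟩ := hcond
  have hpos : ∀ x, 0 < p x := fun x => hq.trans_le (hqp x)
  have hKpos : 0 < K := one_pos.trans_le hK1
  set K' : ℝ≥0 := K.toNNReal ^ (1 / q ^ 2) with hK'
  refine ⟨dilConst q * K', mul_pos (dilConst_pos q)
    (NNReal.rpow_pos (Real.toNNReal_pos.2 hKpos)), fun B hB hB0 => ?_⟩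
  have hB1 : μ B ≤ 1 := prob_le_one
  have hBt : μ B ≠ ∞ := measure_ne_top _ _
  have hne : (p '' B).Nonempty := (nonempty_of_measure_ne_zero hB0).image p
  have hbelow : BddBelow (p '' B) := ⟨q, by rintro _ ⟨x, -, rfl⟩; exact hqp x⟩
  have habove : BddAbove (p '' B) := ⟨1, by rintro _ ⟨x, -, rfl⟩; exact hup x⟩
  have hap : ∀ x ∈ B, lowerExp p B ≤ p x := fun x hx => csInf_le hbelow ⟨x, hx, rfl⟩
  have hpb : ∀ x ∈ B, p x ≤ upperExp p B := fun x hx => le_csSup habove ⟨x, hx, rfl⟩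
  have hqa : q ≤ lowerExp p B := le_csInf hne (by rintro _ ⟨x, -, rfl⟩; exact hqp x)
  have hb1 : upperExp p B ≤ 1 := csSup_le hne (by rintro _ ⟨x, -, rfl⟩; exact hup x)
  have hab : lowerExp p B ≤ upperExp p B := by
    obtain ⟨x, hx⟩ := nonempty_of_measure_ne_zero hB0
    exact (hap x hx).trans (hpb x hx)
  have hKB := hK B hB hB0
  set a := lowerExp p B
  set b := upperExp p B
  have ha : 0 < a := hq.trans_le hqa
  have hb : 0 < b := ha.trans_le hab
  have hosc : μ B ^ (1 / b) ≤ K' * μ B ^ (1 / a) := by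
    have h1 : μ B ^ (a - b) ≤ ENNReal.ofReal K := by
      rw [← ENNReal.ofReal_toReal hBt,
        ENNReal.ofReal_rpow_of_pos (ENNReal.toReal_pos hB0 hBt)]
      exact ENNReal.ofReal_le_ofReal hKB
    have h2 := rpow_inv_le_of_oscillation hB0 hB1 hq hqa hab
      (by rw [← ENNReal.ofReal_one]; exact ENNReal.ofReal_le_ofReal hK1) h1
    rwa [ENNReal.ofReal, ← ENNReal.coe_rpow_of_nonneg _ (by positivity)] at h2
  have hU := varNorm_dualExp_indicator_le hp hB hq hqp hup hb hb1 hpb hB0 hB1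
  have hL := rpow_le_varNorm_dualExp_indicator hp hB hpos hup ha hap (hab.trans hb1) hB0 hB1
  have hb0 : 0 ≤ 1 / b - 1 := sub_nonneg.2 ((one_le_div hb).2 hb1)
  refine ⟨?_, ?_, ?_, fun h hh hsupp => ?_⟩
  · calc μ B * varNorm μ (dualExp p) (B.indicator 1)
        ≤ μ B * (dilConst q * μ B ^ (1 / b - 1)) := by gcongr
      _ = dilConst q * μ B ^ (1 / b) := by
        rw [ENNReal.rpow_sub _ _ hB0 hBt, ENNReal.rpow_one, mul_left_comm,
          ENNReal.mul_div_cancel hB0 hBt]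
      _ ≤ dilConst q * (K' * μ B ^ (1 / a)) := by gcongr
      _ ≤ dilConst q * (K' * varNorm μ (extExp p) (B.indicator 1)) := by
        gcongr
        exact rpow_le_varNorm_indicator hB hpos ha hap hB1
      _ = _ := by rw [ENNReal.coe_mul, mul_assoc]
  · exact (hU.trans_lt (ENNReal.mul_lt_top ENNReal.coe_lt_top
      (ENNReal.rpow_lt_top_of_nonneg hb0 hBt))).ne
  · refine (lt_of_lt_of_le (pos_iff_ne_zero.2 ?_) hL).ne'
    simp [hB0, hBt]
  · refine (varNorm_le_of_support hB hq hqp hup hb hpb hB0 hB1 hh hsupp).trans ?_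
    rw [ENNReal.coe_mul, mul_assoc]
    refine mul_le_mul' le_rfl ?_
    rw [mul_left_comm]
    refine mul_le_mul' le_rfl ?_
    calc μ B ^ (1 / b - 1 / 2) = μ B ^ (1 / b) * μ B ^ (-1 / 2 : ℝ) := by
          rw [← ENNReal.rpow_add _ _ hB0 hBt]; congr 1; ring
      _ ≤ K' * μ B ^ (1 / a) * μ B ^ (-1 / 2 : ℝ) := by gcongr
      _ = K' * (μ B ^ (1 / 2 : ℝ) * μ B ^ (1 / a - 1)) := by
          rw [mul_assoc, ← ENNReal.rpow_add _ _ hB0 hBt, ← ENNReal.rpow_add _ _ hB0 hBt]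
          congr 2; ring
      _ ≤ _ := by gcongr

end VarHardy

namespace VarHardy

variable {Ω : Type*} {m : MeasurableSpace Ω} {𝕜 : Type*} [RCLike 𝕜] {μ : Measure Ω}
  {ℱ : Filtration ℕ m}

/-! ### Increments of martingales -/

/-- The term `E(|f_{n+1} - f_n|² | F_n)` of the conditional square function. -/
noncomputable def incrSq (μ : Measure Ω) (ℱ : Filtration ℕ m) (f : ℕ → Ω → 𝕜) (n : ℕ) :
    Ω → ℝ≥0∞ :=
  condLExp (ℱ n) μ (fun x => ‖f (n + 1) x - f n x‖ₑ ^ (2 : ℕ))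

/-- The partial sums of the square of the conditional square function. -/
noncomputable def partialSq (μ : Measure Ω) (ℱ : Filtration ℕ m) (f : ℕ → Ω → 𝕜) (n : ℕ) :
    Ω → ℝ≥0∞ :=
  fun ω => ∑ j ∈ Finset.range n, incrSq μ ℱ f j ω

theorem measurable_incrSq (f : ℕ → Ω → 𝕜) (n : ℕ) : Measurable[ℱ n] (incrSq μ ℱ f n) :=
  measurable_condLExp _ _ _

/-- Predictability: the sum through the increment from n to n + 1 is already known at time n. Hence
level sets of it may multiply that increment without destroying the martingale property. -/
theorem measurable_partialSq (f : ℕ → Ω → 𝕜) (n : ℕ) :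
    Measurable[ℱ n] (partialSq μ ℱ f (n + 1)) :=
  Finset.measurable_fun_sum _ fun j hj => (measurable_incrSq f j).mono
    (ℱ.mono (Nat.lt_succ_iff.1 (Finset.mem_range.1 hj))) le_rfl

theorem partialSq_mono (f : ℕ → Ω → 𝕜) (ω : Ω) : Monotone fun n => partialSq μ ℱ f n ω :=
  fun _ _ h => Finset.sum_le_sum_of_subset (Finset.range_mono h)

theorem condSq_sq (f : ℕ → Ω → 𝕜) (ω : Ω) : condSq μ ℱ f ω ^ 2 = ∑' n, incrSq μ ℱ f n ω := by
  rw [condSq, ← ENNReal.rpow_natCast, ← ENNReal.rpow_mul]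
  norm_num
  rfl

theorem partialSq_le_condSq_sq (f : ℕ → Ω → 𝕜) (n : ℕ) (ω : Ω) :
    partialSq μ ℱ f n ω ≤ condSq μ ℱ f ω ^ 2 := by
  rw [condSq_sq]
  exact ENNReal.sum_le_tsum _

/-- Partial sums increase, so the retained indices form an initial segment and their total is one of
the partial sums bounded by c. -/
theorem sum_ite_le_of_partial_sum_le (v : ℕ → ℝ≥0∞) (c : ℝ≥0∞) (N : ℕ) :
    ∑ j ∈ Finset.range N, (if ∑ i ∈ Finset.range (j + 1), v i ≤ c then v j else 0) ≤ c := by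
  induction N with
  | zero => simp
  | succ N ih =>
    by_cases h : ∑ i ∈ Finset.range (N + 1), v i ≤ c
    · refine (Finset.sum_le_sum fun j _ => ?_).trans h
      split_ifs
      · exact le_rfl
      · exact bot_le
    · rw [Finset.sum_range_succ, if_neg h, add_zero]
      exact ih

/-- The martingale transform `∑_{j < N} χ_{A_j} (f_{j+1} - f_j)` of `f` by a sequence of sets. -/
noncomputable def setTransform (f : ℕ → Ω → 𝕜) (A : ℕ → Set Ω) (N : ℕ) : Ω → 𝕜 :=
  fun x => ∑ j ∈ Finset.range N, (A j).indicator (f (j + 1) - f j) x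

theorem stronglyMeasurable_setTransform {f : ℕ → Ω → 𝕜} (hf : Martingale f ℱ μ)
    {A : ℕ → Set Ω} (hA : ∀ j, MeasurableSet[ℱ j] (A j)) (N : ℕ) :
    StronglyMeasurable[ℱ N] (setTransform f A N) := by
  refine Finset.stronglyMeasurable_fun_sum _ fun j hj => ?_
  have hj' : j + 1 ≤ N := Finset.mem_range.1 hj
  refine (((hf.1 (j + 1)).mono (ℱ.mono hj')).sub
    ((hf.1 j).mono (ℱ.mono (j.le_succ.trans hj')))).indicator ?_
  exact ℱ.mono (j.le_succ.trans hj') _ (hA j)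

theorem memLp_setTransform {f : ℕ → Ω → 𝕜} {A : ℕ → Set Ω}
    (hL : ∀ j, MemLp ((A j).indicator (f (j + 1) - f j)) 2 μ) (N : ℕ) :
    MemLp (setTransform f A N) 2 μ :=
  memLp_finsetSum _ fun j _ => hL j

theorem condExp_indicator_increment {f : ℕ → Ω → 𝕜} (hf : Martingale f ℱ μ) {n : ℕ}
    {A : Set Ω} (hA : MeasurableSet[ℱ n] A) :
    μ[A.indicator (f (n + 1) - f n)|ℱ n] =ᵐ[μ] 0 := by
  refine (condExp_indicator ((hf.integrable _).sub (hf.integrable _)) hA).trans ?_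
  filter_upwards [condExp_sub (hf.integrable (n + 1)) (hf.integrable n) (ℱ n),
    hf.2 n (n + 1) n.le_succ, hf.2 n n le_rfl] with x h1 h2 h3
  refine (indicator_apply_eq_zero (s := A)).2 fun _ => ?_
  rw [h1, Pi.sub_apply, h2, h3, sub_self]

variable [IsProbabilityMeasure μ]

theorem condLExp_indicator {G : MeasurableSpace Ω} (hG : G ≤ m) {A : Set Ω}
    (hA : MeasurableSet[G] A) (X : Ω → ℝ≥0∞) :
    condLExp G μ (A.indicator X) =ᵐ[μ] A.indicator (condLExp G μ X) := by
  refine (ae_eq_condLExp hG μ _ ((measurable_condLExp G μ X).indicator hA) fun s hs => ?_).symm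
  rw [setLIntegral_indicator (hG _ hA), setLIntegral_indicator (hG _ hA),
    setLIntegral_condLExp hG _ _ (hA.inter hs)]

theorem setLIntegral_incrSq (f : ℕ → Ω → 𝕜) (n : ℕ) {A : Set Ω} (hA : MeasurableSet[ℱ n] A) :
    ∫⁻ x in A, incrSq μ ℱ f n x ∂μ = ∫⁻ x in A, ‖f (n + 1) x - f n x‖ₑ ^ 2 ∂μ :=
  setLIntegral_condLExp (ℱ.le n) _ _ hA

theorem lintegral_incrSq (f : ℕ → Ω → 𝕜) (n : ℕ) :
    ∫⁻ x, incrSq μ ℱ f n x ∂μ = ∫⁻ x, ‖f (n + 1) x - f n x‖ₑ ^ 2 ∂μ :=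
  lintegral_condLExp (ℱ.le n) _ _

theorem lintegral_condSq_sq (f : ℕ → Ω → 𝕜) :
    ∫⁻ x, condSq μ ℱ f x ^ 2 ∂μ = ∑' n, ∫⁻ x, ‖f (n + 1) x - f n x‖ₑ ^ 2 ∂μ := by
  simp_rw [condSq_sq, ← lintegral_incrSq (μ := μ) (ℱ := ℱ)]
  exact lintegral_tsum fun n => (measurable_condLExp' _ _ _).aemeasurable

theorem incrSq_ae_eq_indicator {f g : ℕ → Ω → 𝕜} {n : ℕ} {A : Set Ω}
    (hA : MeasurableSet[ℱ n] A)
    (h : g (n + 1) - g n =ᵐ[μ] A.indicator (f (n + 1) - f n)) :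
    incrSq μ ℱ g n =ᵐ[μ] A.indicator (incrSq μ ℱ f n) := by
  refine (condLExp_congr_ae ?_).trans (condLExp_indicator (ℱ.le n) hA _)
  filter_upwards [h] with x hx
  simp only [Pi.sub_apply] at hx
  rw [hx]
  by_cases hxA : x ∈ A
  · simp [hxA]
  · simp [hxA]

/-- The zero set of the conditional variance belongs to F_n, so the increment has zero square
integral over it. This disposes of the points that no dyadic layer contains. -/
theorem ae_sub_eq_zero_of_incrSq_eq_zero {f : ℕ → Ω → 𝕜} (hf : Martingale f ℱ μ) (n : ℕ) :
    ∀ᵐ x ∂μ, incrSq μ ℱ f n x = 0 → f (n + 1) x - f n x = 0 := by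
  have hA : MeasurableSet[ℱ n] {x | incrSq μ ℱ f n x = 0} :=
    measurable_incrSq f n (measurableSet_singleton 0)
  have h0 : ∫⁻ x in {x | incrSq μ ℱ f n x = 0}, ‖f (n + 1) x - f n x‖ₑ ^ 2 ∂μ = 0 := by
    rw [← setLIntegral_incrSq f n hA]
    exact setLIntegral_eq_zero (ℱ.le n _ hA) fun x hx => hx
  have hm : AEMeasurable (fun x => ‖f (n + 1) x - f n x‖ₑ ^ 2)
      (μ.restrict {x | incrSq μ ℱ f n x = 0}) := by
    have h1 : StronglyMeasurable (f (n + 1)) := (hf.1 (n + 1)).mono (ℱ.le _)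
    have h2 : StronglyMeasurable (f n) := (hf.1 n).mono (ℱ.le _)
    exact ((h1.sub h2).enorm.pow_const 2).aemeasurable
  rw [lintegral_eq_zero_iff' hm, EventuallyEq, ae_restrict_iff' (ℱ.le n _ hA)] at h0
  filter_upwards [h0] with x hx h
  simpa using hx h

/-- An increment used only once τ has occurred is orthogonal to the past of τ: for s in F_τ, s ∩ A =
(s ∩ {τ ≤ n}) ∩ A lies in F_n. -/
theorem condExp_stopping_indicator_increment {f : ℕ → Ω → 𝕜} (hf : Martingale f ℱ μ)
    {τ : Ω → WithTop ℕ} (hτ : IsStoppingTime ℱ τ) {n : ℕ} {A : Set Ω}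
    (hA : MeasurableSet[ℱ n] A) (hAτ : ∀ x ∈ A, τ x ≤ n) :
    μ[A.indicator (f (n + 1) - f n)|hτ.measurableSpace] =ᵐ[μ] 0 := by
  have hAm : MeasurableSet A := ℱ.le n _ hA
  have hint := (hf.integrable (n + 1)).sub (hf.integrable n)
  refine (ae_eq_condExp_of_forall_setIntegral_eq hτ.measurableSpace_le (hint.indicator hAm)
    (g := 0) (fun _ _ _ => (integrable_zero _ _ _).integrableOn) ?_
    aestronglyMeasurable_zero).symm
  intro s hs _
  have hsA : MeasurableSet[ℱ n] (s ∩ A) := by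
    have e : s ∩ A = s ∩ {x | τ x ≤ n} ∩ A := by
      ext x
      exact ⟨fun h => ⟨⟨h.1, hAτ x h.2⟩, h.2⟩, fun h => ⟨h.1.1, h.2⟩⟩
    rw [e]
    exact (hs.2 n).inter hA
  rw [setIntegral_indicator hAm]
  simp only [Pi.zero_apply, integral_zero, Pi.sub_apply]
  rw [integral_sub (hf.integrable _).integrableOn (hf.integrable _).integrableOn,
    hf.setIntegral_eq n.le_succ hsA, sub_self]

/-- Orthogonality of martingale increments, with each squared increment replaced by its conditional
expectation; this is allowed because the set at index j lies in F_j. -/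
theorem lintegral_setTransform_sq {f : ℕ → Ω → 𝕜} (hf : Martingale f ℱ μ)
    {A : ℕ → Set Ω} (hA : ∀ j, MeasurableSet[ℱ j] (A j))
    (hL : ∀ j, MemLp ((A j).indicator (f (j + 1) - f j)) 2 μ) (N : ℕ) :
    ∫⁻ x, ‖setTransform f A N x‖ₑ ^ 2 ∂μ =
      ∫⁻ x, ∑ j ∈ Finset.range N, (A j).indicator (incrSq μ ℱ f j) x ∂μ := by
  rw [lintegral_finsetSum _ fun j _ =>
    (((measurable_incrSq f j).indicator (hA j)).mono (ℱ.le j) le_rfl)]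
  induction N with
  | zero => simp [setTransform]
  | succ N ih =>
    rw [Finset.sum_range_succ, ← ih]
    simp_rw [setTransform, Finset.sum_range_succ]
    have h := lintegral_enorm_sq_add (ℱ.le N) (memLp_setTransform hL N) (hL N)
      (stronglyMeasurable_setTransform hf hA N).aestronglyMeasurable
      (condExp_indicator_increment hf (hA N))
    rw [show (fun x => ‖∑ j ∈ Finset.range N, (A j).indicator (f (j + 1) - f j) x +
      (A N).indicator (f (N + 1) - f N) x‖ₑ ^ 2) = fun x => ‖setTransform f A N x +
      (A N).indicator (f (N + 1) - f N) x‖ₑ ^ 2 from rfl, h]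
    congr 1
    rw [lintegral_indicator (ℱ.le N _ (hA N)), setLIntegral_incrSq f N (hA N),
      ← lintegral_indicator (ℱ.le N _ (hA N))]
    refine lintegral_congr fun x => ?_
    by_cases hx : x ∈ A N
    · simp [hx]
    · simp [hx]

/-- Bessel's inequality for the orthogonal increments. -/
theorem lintegral_condSq_condExp_le {f : Ω → 𝕜} (hf : MemLp f 2 μ) :
    ∫⁻ x, condSq μ ℱ (fun n => μ[f|ℱ n]) x ^ 2 ∂μ ≤ ∫⁻ x, ‖f x‖ₑ ^ 2 ∂μ := by
  have hM : Martingale (fun n => μ[f|ℱ n]) ℱ μ := martingale_condExp f ℱ μ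
  have hL : ∀ n, MemLp (μ[f|ℱ n]) 2 μ := fun n => hf.condExp (by norm_num)
  rw [lintegral_condSq_sq, ENNReal.tsum_eq_iSup_nat]
  refine iSup_le fun N => ?_
  have key : ∑ j ∈ Finset.range N, ∫⁻ x, ‖μ[f|ℱ (j + 1)] x - μ[f|ℱ j] x‖ₑ ^ 2 ∂μ ≤
      ∫⁻ x, ‖μ[f|ℱ N] x‖ₑ ^ 2 ∂μ := by
    induction N with
    | zero => simp
    | succ N ih =>
      rw [Finset.sum_range_succ]
      refine (add_le_add_left ih _).trans (le_of_eq ?_)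
      have h0 := condExp_indicator_increment hM (n := N) MeasurableSet.univ
      rw [indicator_univ] at h0
      have h := lintegral_enorm_sq_add (ℱ.le N) (hL N) ((hL (N + 1)).sub (hL N))
        stronglyMeasurable_condExp.aestronglyMeasurable h0
      simp only [Pi.sub_apply, add_sub_cancel] at h
      exact h.symm
  refine key.trans ?_
  rw [← eLpNorm_two_sq, ← eLpNorm_two_sq]
  gcongr
  exact eLpNorm_condExp_le_eLpNorm f (by norm_num)

end VarHardy

namespace VarHardy

variable {Ω : Type*} {m : MeasurableSpace Ω} {𝕜 : Type*} [RCLike 𝕜] {μ : Measure Ω}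
  {ℱ : Filtration ℕ m}

/-! ### The upper estimate by decomposition along level sets -/

theorem four_zpow_eq (k : ℤ) : (4 : ℝ≥0∞) ^ k = (((2 : ℝ≥0) ^ k : ℝ≥0) : ℝ≥0∞) ^ 2 := by
  have h4 : (4 : ℝ≥0∞) = ((4 : ℝ≥0) : ℝ≥0∞) := by norm_num
  rw [h4, ← ENNReal.coe_zpow (by norm_num), ← ENNReal.coe_pow]
  congr 1
  rw [show (4 : ℝ≥0) = 2 ^ 2 by norm_num, ← zpow_natCast, ← zpow_natCast, ← zpow_mul, ← zpow_mul,
    mul_comm]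

theorem sum_two_zpow_le (K : Finset ℤ) (n : ℤ) (h : ∀ k ∈ K, k ≤ n) :
    ∑ k ∈ K, (2 : ℝ≥0) ^ k ≤ 2 ^ (n + 1) := by
  induction K using Finset.induction_on_max generalizing n with
  | empty => simp
  | insert a s has ih =>
    rw [Finset.sum_insert fun ha => lt_irrefl _ (has a ha)]
    have h1 := ih (a - 1) fun k hk => Int.le_sub_one_of_lt (has k hk)
    rw [sub_add_cancel] at h1
    calc (2 : ℝ≥0) ^ a + ∑ k ∈ s, (2 : ℝ≥0) ^ k ≤ 2 ^ a + 2 ^ a := by gcongr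
      _ = 2 ^ (a + 1) := by rw [zpow_add₀ (by norm_num), zpow_one]; ring
      _ ≤ 2 ^ (n + 1) := by
        refine zpow_le_zpow_right₀ (by norm_num) ?_
        have := h a (Finset.mem_insert_self _ _)
        omega

/-- The set where the partial sum of index `j + 1` lies in `(4 ^ k, 4 ^ (k + 1)]`. -/
def layer (μ : Measure Ω) (ℱ : Filtration ℕ m) (f : ℕ → Ω → 𝕜) (k : ℤ) (j : ℕ) : Set Ω :=
  partialSq μ ℱ f (j + 1) ⁻¹' Ioc (4 ^ k) (4 ^ (k + 1))

open scoped Classical in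
/-- The first index at which the partial sums exceed `4 ^ k`, shifted by one. -/
noncomputable def crossTime (μ : Measure Ω) (ℱ : Filtration ℕ m) (f : ℕ → Ω → 𝕜) (k : ℤ) :
    Ω → WithTop ℕ := fun ω =>
  if h : ∃ j, (4 : ℝ≥0∞) ^ k < partialSq μ ℱ f (j + 1) ω then ((Nat.find h : ℕ) : WithTop ℕ) else ⊤

theorem crossTime_le_iff (f : ℕ → Ω → 𝕜) (k : ℤ) (n : ℕ) (ω : Ω) :
    crossTime μ ℱ f k ω ≤ n ↔ (4 : ℝ≥0∞) ^ k < partialSq μ ℱ f (n + 1) ω := by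
  classical
  unfold crossTime
  split_ifs with h
  · rw [Nat.cast_le, Nat.find_le_iff]
    constructor
    · rintro ⟨j, hj, hlt⟩
      exact hlt.trans_le (partialSq_mono f ω (Nat.succ_le_succ hj))
    · exact fun hlt => ⟨n, le_rfl, hlt⟩
  · simp only [top_le_iff, WithTop.natCast_ne_top, false_iff]
    exact fun hlt => h ⟨n, hlt⟩

theorem crossTime_lt_top_iff (f : ℕ → Ω → 𝕜) (k : ℤ) (ω : Ω) :
    crossTime μ ℱ f k ω < ⊤ ↔ ∃ n, (4 : ℝ≥0∞) ^ k < partialSq μ ℱ f (n + 1) ω := by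
  constructor
  · intro h
    obtain ⟨n, hn⟩ := WithTop.ne_top_iff_exists.1 h.ne
    exact ⟨n, (crossTime_le_iff f k n ω).1 hn.ge⟩
  · rintro ⟨n, hn⟩
    exact ((crossTime_le_iff f k n ω).2 hn).trans_lt (WithTop.coe_lt_top n)

theorem isStoppingTime_crossTime (f : ℕ → Ω → 𝕜) (k : ℤ) :
    IsStoppingTime ℱ (crossTime μ ℱ f k) := fun n => by
  have e : {ω | crossTime μ ℱ f k ω ≤ n} = partialSq μ ℱ f (n + 1) ⁻¹' Ioi (4 ^ k) := by
    ext ω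
    exact crossTime_le_iff f k n ω
  change MeasurableSet[ℱ n] {ω | crossTime μ ℱ f k ω ≤ n}
  rw [e]
  exact measurable_partialSq f n measurableSet_Ioi

theorem measurableSet_layer (f : ℕ → Ω → 𝕜) (k : ℤ) (j : ℕ) :
    MeasurableSet[ℱ j] (layer μ ℱ f k j) :=
  measurable_partialSq f j measurableSet_Ioc

theorem measurableSet_crossTime_lt_top (f : ℕ → Ω → 𝕜) (k : ℤ) :
    MeasurableSet {ω | crossTime μ ℱ f k ω < ⊤} := by
  have e : {ω | crossTime μ ℱ f k ω < ⊤} =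
      ⋃ n : ℕ, partialSq μ ℱ f (n + 1) ⁻¹' Ioi (4 ^ k) := by
    ext ω
    simp only [mem_ofPred_eq, mem_iUnion, mem_preimage, mem_Ioi]
    exact crossTime_lt_top_iff f k ω
  rw [e]
  exact MeasurableSet.iUnion fun n => ℱ.le n _ (measurable_partialSq f n measurableSet_Ioi)

theorem pairwise_disjoint_layer (f : ℕ → Ω → 𝕜) (j : ℕ) :
    Pairwise (Function.onFun Disjoint fun k => layer μ ℱ f k j) := by
  have key : ∀ {k l : ℤ}, k < l → Disjoint (layer μ ℱ f k j) (layer μ ℱ f l j) := by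
    intro k l hkl
    rw [Set.disjoint_left]
    intro ω h1 h2
    have : (4 : ℝ≥0∞) ^ (k + 1) ≤ 4 ^ l := ENNReal.zpow_le_of_le (by norm_num) hkl
    exact absurd (h2.1.trans_le (h1.2.trans this)) (lt_irrefl _)
  intro k l hkl
  rcases lt_or_gt_of_ne hkl with h | h
  · exact key h
  · exact (key h).symm

/-- Every term kept in layer k comes with a partial sum, itself included, of at most 4^(k+1), so all
of them together stay below that level. Including the current term, as predictability permits, is
what avoids any overshoot. -/
theorem sum_indicator_layer_le (f : ℕ → Ω → 𝕜) (k : ℤ) (N : ℕ) (ω : Ω) :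
    ∑ j ∈ Finset.range N, (layer μ ℱ f k j).indicator (incrSq μ ℱ f j) ω ≤
      {ω | crossTime μ ℱ f k ω < ⊤}.indicator (fun _ => 4 ^ (k + 1)) ω := by
  by_cases hω : ω ∈ {ω | crossTime μ ℱ f k ω < ⊤}
  · rw [indicator_of_mem hω]
    refine le_trans (Finset.sum_le_sum fun j _ => ?_)
      (sum_ite_le_of_partial_sum_le (fun j => incrSq μ ℱ f j ω) (4 ^ (k + 1)) N)
    by_cases h : ω ∈ layer μ ℱ f k j
    · rw [indicator_of_mem h]
      exact (if_pos (show ∑ i ∈ Finset.range (j + 1), incrSq μ ℱ f i ω ≤ 4 ^ (k + 1) from h.2)).ge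
    · rw [indicator_of_notMem h]
      exact bot_le
  · rw [indicator_of_notMem hω]
    refine (Finset.sum_eq_zero fun j _ => indicator_of_notMem (fun h => hω ?_) _).le
    exact (crossTime_lt_top_iff f k ω).2 ⟨j, h.1⟩

/-- Crossing 4^k forces s(f) > 2^k, so at each point this is a geometric sum dominated by its
largest term. -/
theorem sum_two_zpow_indicator_le (f : ℕ → Ω → 𝕜) (K : Finset ℤ) (ω : Ω) :
    ∑ k ∈ K, (((2 : ℝ≥0) ^ k : ℝ≥0) : ℝ≥0∞) * {ω | crossTime μ ℱ f k ω < ⊤}.indicator 1 ω ≤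
      ((2 : ℝ≥0) : ℝ≥0∞) * condSq μ ℱ f ω := by
  classical
  set s := condSq μ ℱ f ω with hs
  have hlt : ∀ k, crossTime μ ℱ f k ω < ⊤ → (((2 : ℝ≥0) ^ k : ℝ≥0) : ℝ≥0∞) < s := by
    intro k hk
    obtain ⟨n, hn⟩ := (crossTime_lt_top_iff f k ω).1 hk
    have h2 := hn.trans_le (partialSq_le_condSq_sq f (n + 1) ω)
    rw [four_zpow_eq] at h2
    exact not_le.1 fun h => absurd h2 (not_lt.2 (pow_le_pow_left' h 2))
  rcases eq_or_ne s ∞ with hT | hT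
  · rw [hT, ENNReal.mul_top (by norm_num)]
    exact le_top
  rcases eq_or_ne s 0 with h0 | h0
  · refine (Finset.sum_eq_zero fun k _ => ?_).trans_le (by positivity)
    rw [indicator_of_notMem, mul_zero]
    intro hk
    exact absurd (hlt k hk) (by rw [h0]; exact not_lt_bot)
  -- With 2^n < s ≤ 2^(n+1), only indices k ≤ n contribute, and they add up to at most 2^(n+1) ≤ 2s.
  obtain ⟨n, hn1, hn2⟩ := ENNReal.exists_mem_Ioc_zpow h0 hT (y := ((2 : ℝ≥0) : ℝ≥0∞))
    (by norm_num) ENNReal.coe_ne_top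
  rw [← ENNReal.coe_zpow (by norm_num)] at hn1 hn2
  calc ∑ k ∈ K, (((2 : ℝ≥0) ^ k : ℝ≥0) : ℝ≥0∞) * {ω | crossTime μ ℱ f k ω < ⊤}.indicator 1 ω
      = ∑ k ∈ K.filter (fun k => crossTime μ ℱ f k ω < ⊤), (((2 : ℝ≥0) ^ k : ℝ≥0) : ℝ≥0∞) := by
        rw [Finset.sum_filter]
        refine Finset.sum_congr rfl fun k _ => ?_
        by_cases hk : crossTime μ ℱ f k ω < ⊤
        · rw [if_pos hk, indicator_of_mem (by exact hk), Pi.one_apply, mul_one]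
        · rw [if_neg hk, indicator_of_notMem (by exact hk), mul_zero]
    _ ≤ ((2 : ℝ≥0) ^ (n + 1) : ℝ≥0) := by
        rw [← ENNReal.ofNNReal_finsetSum]
        refine ENNReal.coe_le_coe.2 (sum_two_zpow_le _ n fun k hk => ?_)
        have h1 := (hlt k (Finset.mem_filter.1 hk).2).trans_le hn2
        rw [ENNReal.coe_lt_coe, zpow_lt_zpow_iff_right₀ (by norm_num)] at h1
        omega
    _ = ((2 : ℝ≥0) : ℝ≥0∞) * ((2 : ℝ≥0) ^ n : ℝ≥0) := by
        rw [← ENNReal.coe_mul, zpow_add₀ (by norm_num), zpow_one, mul_comm]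
    _ ≤ _ := by gcongr

variable [IsProbabilityMeasure μ] {p : Ω → ℝ}

/-- The transform acts only after τ, so it is orthogonal to E(φ | F_τ), that is, to φ^τ. Subtracting
φ^τ from φ leaves the pairing unchanged, and Cauchy–Schwarz applies. -/
theorem enorm_integral_setTransform_le {f : ℕ → Ω → 𝕜} (hf : Martingale f ℱ μ)
    {τ : Ω → WithTop ℕ} (hτ : IsStoppingTime ℱ τ) {A : ℕ → Set Ω}
    (hA : ∀ j, MeasurableSet[ℱ j] (A j)) (hAτ : ∀ j, ∀ x ∈ A j, τ x ≤ j)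
    (hL : ∀ j, MemLp ((A j).indicator (f (j + 1) - f j)) 2 μ) (N : ℕ)
    {φ : Ω → 𝕜} (hφ : MemLp φ 2 μ) :
    ‖∫ x, setTransform f A N x * φ x ∂μ‖ₑ ≤
      eLpNorm (setTransform f A N) 2 μ * eLpNorm (φ - stoppedFun μ ℱ τ φ) 2 μ := by
  have hst := stoppedFun_ae_eq_condExp (μ := μ) hτ φ
  have hX := memLp_setTransform hL N
  have hφτ : MemLp (μ[φ|hτ.measurableSpace]) 2 μ := hφ.condExp (by norm_num)
  have h0 : μ[setTransform f A N|hτ.measurableSpace] =ᵐ[μ] 0 := by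
    have e : setTransform f A N =
        ∑ j ∈ Finset.range N, (A j).indicator (f (j + 1) - f j) := by
      funext x
      simp [setTransform]
    rw [e]
    refine (condExp_finsetSum (fun j _ => (hL j).integrable (by norm_num)) _).trans ?_
    filter_upwards [ae_all_iff.2 fun j =>
      condExp_stopping_indicator_increment hf hτ (hA j) (hAτ j)] with x hx
    rw [Finset.sum_apply]
    exact Finset.sum_eq_zero fun j _ => hx j
  have h1 : ∫ x, setTransform f A N x * μ[φ|hτ.measurableSpace] x ∂μ = 0 := by
    rw [integral_mul_condExp hτ.measurableSpace_le hX hφ]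
    refine (integral_congr_ae ?_).trans (integral_zero Ω 𝕜)
    filter_upwards [h0] with x hx
    rw [hx, Pi.zero_apply, zero_mul]
  have h2 : ∫ x, setTransform f A N x * φ x ∂μ =
      ∫ x, setTransform f A N x * (φ - μ[φ|hτ.measurableSpace]) x ∂μ := by
    simp only [Pi.sub_apply, mul_sub]
    rw [integral_sub (integrable_mul_of_memLp_two hX hφ) (integrable_mul_of_memLp_two hX hφτ), h1,
      sub_zero]
  rw [h2, eLpNorm_congr_ae (EventuallyEq.rfl.sub hst)]
  exact enorm_integral_mul_le hX (hφ.sub hφτ)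

theorem eLpNorm_sub_stoppedFun_le {τ : Ω → WithTop ℕ} (hτ : IsStoppingTime ℱ τ)
    (hτm : MeasurableSet {ω | τ ω < ⊤}) (φ : Ω → 𝕜) (h0 : μ {ω | τ ω < ⊤} ≠ 0)
    (hV0 : varNorm μ (dualExp p) ({ω | τ ω < ⊤}.indicator 1) ≠ 0)
    (hVt : varNorm μ (dualExp p) ({ω | τ ω < ⊤}.indicator 1) ≠ ∞) :
    eLpNorm (φ - stoppedFun μ ℱ τ φ) 2 μ ≤ lipNorm μ ℱ p φ *
      (varNorm μ (dualExp p) ({ω | τ ω < ⊤}.indicator 1) * μ {ω | τ ω < ⊤} ^ (1 / 2 : ℝ)) := by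
  have h := le_iSup₂_of_le (f := fun (τ : Ω → WithTop ℕ) (_ : IsStoppingTime ℱ τ) =>
    (varNorm μ (dualExp p) ({ω | τ ω < ⊤}.indicator 1))⁻¹ *
      (eLpNorm ({ω | τ ω < ⊤}.indicator (1 : Ω → ℝ)) 2 μ)⁻¹ *
      eLpNorm (φ - stoppedFun μ ℱ τ φ) 2 μ) τ hτ le_rfl
  change _ ≤ lipNorm μ ℱ p φ at h
  have e : eLpNorm ({ω | τ ω < ⊤}.indicator (1 : Ω → ℝ)) 2 μ =
      μ {ω | τ ω < ⊤} ^ (1 / 2 : ℝ) := by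
    have := eLpNorm_indicator_const (μ := μ) (p := 2) (c := (1 : ℝ)) hτm (by norm_num)
      (by norm_num)
    simpa [Pi.one_def] using this
  have hE0 : μ {ω | τ ω < ⊤} ^ (1 / 2 : ℝ) ≠ 0 := by simp [h0]
  have hEt : μ {ω | τ ω < ⊤} ^ (1 / 2 : ℝ) ≠ ∞ := by simp
  simp only [e] at h
  rw [← ENNReal.mul_inv (Or.inl hV0) (Or.inl hVt), ← ENNReal.div_eq_inv_mul,
    ENNReal.div_le_iff (mul_ne_zero hV0 hE0) (ENNReal.mul_ne_top hVt hEt)] at h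
  exact h

theorem eLpNorm_setTransform_layer_le {f : ℕ → Ω → 𝕜} (hf : Martingale f ℱ μ) (k : ℤ)
    (hL : ∀ j, MemLp ((layer μ ℱ f k j).indicator (f (j + 1) - f j)) 2 μ) (N : ℕ) :
    eLpNorm (setTransform f (layer μ ℱ f k) N) 2 μ ≤
      ((2 : ℝ≥0) ^ (k + 1) : ℝ≥0) * μ {ω | crossTime μ ℱ f k ω < ⊤} ^ (1 / 2 : ℝ) := by
  refine (ENNReal.pow_le_pow_left_iff two_ne_zero).1 ?_
  rw [eLpNorm_two_sq, lintegral_setTransform_sq hf (measurableSet_layer f k) hL, mul_pow,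
    ← four_zpow_eq, ← ENNReal.rpow_natCast, ← ENNReal.rpow_mul]
  refine (lintegral_mono fun ω => sum_indicator_layer_le f k N ω).trans ?_
  rw [lintegral_indicator_const (measurableSet_crossTime_lt_top f k)]
  norm_num

/-- The layers at index j partition the points where the partial sum is positive and finite. Where
it vanishes the increment vanishes almost everywhere, and it is infinite only on a null set because
the increments are in L². -/
theorem hasSum_integral_layer {f : ℕ → Ω → 𝕜} (hf : Martingale f ℱ μ)
    (hL : ∀ n, MemLp (f n) 2 μ) {φ : Ω → 𝕜} (hφ : MemLp φ 2 μ) (j : ℕ) :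
    HasSum (fun k => ∫ x, (layer μ ℱ f k j).indicator (f (j + 1) - f j) x * φ x ∂μ)
      (∫ x, (f (j + 1) x - f j x) * φ x ∂μ) := by
  have hmeas : ∀ k, MeasurableSet (layer μ ℱ f k j) := fun k =>
    ℱ.le j _ (measurableSet_layer f k j)
  have hint : Integrable (fun x => (f (j + 1) x - f j x) * φ x) μ :=
    integrable_mul_of_memLp_two ((hL (j + 1)).sub (hL j)) hφ
  have h := hasSum_integral_iUnion hmeas (pairwise_disjoint_layer f j) hint.integrableOn
  have hfin : ∀ i, ∀ᵐ x ∂μ, incrSq μ ℱ f i x < ∞ := by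
    intro i
    refine ae_lt_top (measurable_condLExp' _ _ _) ?_
    rw [lintegral_incrSq]
    exact ((memLp_two_iff ((hL (i + 1)).sub (hL i)).1).1 ((hL (i + 1)).sub (hL i))).ne
  rw [setIntegral_eq_integral_of_ae_compl_eq_zero] at h
  · refine h.congr_fun fun k => ?_
    rw [← integral_indicator (hmeas k)]
    congr 1
    funext x
    by_cases hx : x ∈ layer μ ℱ f k j
    · simp [hx]
    · simp [hx]
  · filter_upwards [ae_all_iff.2 hfin, ae_sub_eq_zero_of_incrSq_eq_zero hf j] with x h1 h2 hx
    rcases eq_or_ne (partialSq μ ℱ f (j + 1) x) 0 with h0 | h0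
    · rw [h2 ?_, zero_mul]
      exact (Finset.sum_eq_zero_iff.1 h0) j (Finset.self_mem_range_succ j)
    · have ht : partialSq μ ℱ f (j + 1) x ≠ ∞ := (ENNReal.sum_lt_top.2 fun i _ => h1 i).ne
      obtain ⟨k, hk⟩ := ENNReal.exists_mem_Ioc_zpow h0 ht (y := 4) (by norm_num) (by norm_num)
      exact absurd (mem_iUnion.2 ⟨k, hk⟩) hx

variable {q : ℝ} {C : ℝ≥0}

/-- The L² bound of the layer and the Lipschitz bound each supply a factor μ(B)^(1/2). Their product
μ(B)‖χ_B‖_{1/α} is what the comparison turns into ‖χ_B‖_p; the 2 comes from 2^(k+1) = 2·2^k. -/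
theorem enorm_integral_layer_le (hC : IndicatorComparison μ p C) (hq : 0 < q)
    (hqp : ∀ x, q ≤ p x) {f : ℕ → Ω → 𝕜} (hf : Martingale f ℱ μ)
    (hL : ∀ n, MemLp (f n) 2 μ) {φ : Ω → 𝕜} (hφ : MemLp φ 2 μ) (k : ℤ) (N : ℕ) :
    ‖∫ x, setTransform f (layer μ ℱ f k) N x * φ x ∂μ‖ₑ ≤
      2 * C * lipNorm μ ℱ p φ * varNorm μ (extExp p)
        (fun x => (((2 : ℝ≥0) ^ k : ℝ≥0) : ℝ≥0∞) *
          {ω | crossTime μ ℱ f k ω < ⊤}.indicator 1 x) := by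
  set B := {ω | crossTime μ ℱ f k ω < ⊤} with hBdef
  have hB : MeasurableSet B := measurableSet_crossTime_lt_top f k
  have hA : ∀ j, MemLp ((layer μ ℱ f k j).indicator (f (j + 1) - f j)) 2 μ := fun j =>
    ((hL (j + 1)).sub (hL j)).indicator (ℱ.le j _ (measurableSet_layer f k j))
  have h1 := enorm_integral_setTransform_le hf (isStoppingTime_crossTime f k)
    (measurableSet_layer f k) (fun j x hx => (crossTime_le_iff f k j x).2 hx.1) hA N hφ
  have h2 := eLpNorm_setTransform_layer_le hf k hA N
  rcases eq_or_ne (μ B) 0 with h0 | h0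
  · rw [← hBdef, h0, ENNReal.zero_rpow_of_pos (by norm_num), mul_zero, nonpos_iff_eq_zero] at h2
    rw [h2, zero_mul] at h1
    exact h1.trans (by positivity)
  obtain ⟨hC1, hVt, hV0, -⟩ := hC B hB h0
  have h3 := eLpNorm_sub_stoppedFun_le (p := p) (isStoppingTime_crossTime f k) hB φ h0 hV0 hVt
  refine h1.trans ((mul_le_mul' h2 h3).trans ?_)
  rw [← hBdef]
  set V := varNorm μ (dualExp p) (B.indicator 1)
  have hpow : μ B ^ (1 / 2 : ℝ) * μ B ^ (1 / 2 : ℝ) = μ B := by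
    rw [← ENNReal.rpow_add _ _ h0 (measure_ne_top _ _)]
    norm_num
  have h2k : (((2 : ℝ≥0) ^ (k + 1) : ℝ≥0) : ℝ≥0∞) = 2 * (((2 : ℝ≥0) ^ k : ℝ≥0) : ℝ≥0∞) := by
    rw [zpow_add₀ (by norm_num), zpow_one, ENNReal.coe_mul, mul_comm]
    norm_num
  have h2k0 : ((2 : ℝ≥0) ^ k : ℝ≥0) ≠ 0 := (zpow_pos (by norm_num) k).ne'
  -- The other half of homogeneity follows by scaling back with 2^(-k).
  have hscale : (((2 : ℝ≥0) ^ k : ℝ≥0) : ℝ≥0∞) * varNorm μ (extExp p) (B.indicator 1) ≤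
      varNorm μ (extExp p) (fun x => (((2 : ℝ≥0) ^ k : ℝ≥0) : ℝ≥0∞) * B.indicator 1 x) := by
    have h := varNorm_const_mul_le (μ := μ) hq hqp (((2 : ℝ≥0) ^ k)⁻¹)
      (fun x => (((2 : ℝ≥0) ^ k : ℝ≥0) : ℝ≥0∞) * B.indicator 1 x)
    have e : (fun x => (((2 : ℝ≥0) ^ k)⁻¹ : ℝ≥0) * ((((2 : ℝ≥0) ^ k : ℝ≥0) : ℝ≥0∞) *
        B.indicator 1 x)) = B.indicator 1 := by
      funext x
      rw [← mul_assoc, ← ENNReal.coe_mul, inv_mul_cancel₀ h2k0, ENNReal.coe_one, one_mul]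
    rw [e] at h
    refine (mul_le_mul' le_rfl h).trans (le_of_eq ?_)
    rw [← mul_assoc, ← ENNReal.coe_mul, mul_inv_cancel₀ h2k0, ENNReal.coe_one, one_mul]
  calc (((2 : ℝ≥0) ^ (k + 1) : ℝ≥0) : ℝ≥0∞) * μ B ^ (1 / 2 : ℝ) *
        (lipNorm μ ℱ p φ * (V * μ B ^ (1 / 2 : ℝ)))
      = 2 * lipNorm μ ℱ p φ * (((2 : ℝ≥0) ^ k : ℝ≥0) : ℝ≥0∞) *
          (μ B ^ (1 / 2 : ℝ) * μ B ^ (1 / 2 : ℝ) * V) := by rw [h2k]; ring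
    _ ≤ 2 * lipNorm μ ℱ p φ * (((2 : ℝ≥0) ^ k : ℝ≥0) : ℝ≥0∞) *
          (C * varNorm μ (extExp p) (B.indicator 1)) := by rw [hpow]; gcongr
    _ = 2 * C * lipNorm μ ℱ p φ * ((((2 : ℝ≥0) ^ k : ℝ≥0) : ℝ≥0∞) *
          varNorm μ (extExp p) (B.indicator 1)) := by ring
    _ ≤ _ := by gcongr

theorem enorm_integral_sub_mul_le (hC : IndicatorComparison μ p C) (hp : Measurable p)
    (hq : 0 < q) (hqp : ∀ x, q ≤ p x) (hup : ∀ x, p x ≤ 1)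
    {f : ℕ → Ω → 𝕜} (hf : Martingale f ℱ μ)
    (hL : ∀ n, MemLp (f n) 2 μ) {φ : Ω → 𝕜} (hφ : MemLp φ 2 μ) (N : ℕ) :
    ‖∫ x, (f N x - f 0 x) * φ x ∂μ‖ₑ ≤ 4 * C * lipNorm μ ℱ p φ * hardyNorm μ ℱ p f := by
  have hA : ∀ k j, MemLp ((layer μ ℱ f k j).indicator (f (j + 1) - f j)) 2 μ := fun k j =>
    ((hL (j + 1)).sub (hL j)).indicator (ℱ.le j _ (measurableSet_layer f k j))
  have hsum : HasSum (fun k => ∫ x, setTransform f (layer μ ℱ f k) N x * φ x ∂μ)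
      (∫ x, (f N x - f 0 x) * φ x ∂μ) := by
    have h := hasSum_sum (s := Finset.range N) fun j _ => hasSum_integral_layer hf hL hφ j
    have e1 : ∑ j ∈ Finset.range N, ∫ x, (f (j + 1) x - f j x) * φ x ∂μ =
        ∫ x, (f N x - f 0 x) * φ x ∂μ := by
      have hint : ∀ j ∈ Finset.range N, Integrable (fun x => (f (j + 1) x - f j x) * φ x) μ :=
        fun j _ => integrable_mul_of_memLp_two ((hL (j + 1)).sub (hL j)) hφ
      rw [← integral_finsetSum _ hint]
      congr 1
      funext x
      rw [← Finset.sum_mul, Finset.sum_range_sub (fun j => f j x)]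
    rw [e1] at h
    refine h.congr_fun fun k => ?_
    rw [← integral_finsetSum _ fun j _ => integrable_mul_of_memLp_two (hA k j) hφ]
    congr 1
    funext x
    rw [← Finset.sum_mul]
    rfl
  rw [← hsum.tsum_eq]
  refine enorm_tsum_le_tsum_enorm.trans
    ((ENNReal.tsum_le_tsum fun k => enorm_integral_layer_le hC hq hqp hf hL hφ k N).trans ?_)
  -- One factor 2 is the width of a layer; the other is the geometric sum of the levels.
  rw [ENNReal.tsum_mul_left, show (4 : ℝ≥0∞) = 2 * 2 by norm_num]
  have key : ∑' k : ℤ, varNorm μ (extExp p) (fun x => (((2 : ℝ≥0) ^ k : ℝ≥0) : ℝ≥0∞) *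
      {ω | crossTime μ ℱ f k ω < ⊤}.indicator 1 x) ≤ 2 * hardyNorm μ ℱ p f := by
    rw [ENNReal.tsum_eq_iSup_sum]
    refine iSup_le fun K => ?_
    refine (sum_varNorm_le hp hq hqp hup K fun k => ?_).trans ?_
    · exact (measurable_one.indicator (measurableSet_crossTime_lt_top f k)).const_mul _
    · refine (varNorm_mono (Eventually.of_forall fun ω => sum_two_zpow_indicator_le f K ω)).trans ?_
      exact varNorm_const_mul_le hq hqp 2 _
  calc _ ≤ 2 * C * lipNorm μ ℱ p φ * (2 * hardyNorm μ ℱ p f) := by gcongr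
    _ = _ := by ring

theorem enorm_integral_mul_le_hardyNorm (hC : IndicatorComparison μ p C) (hp : Measurable p)
    (hq : 0 < q) (hqp : ∀ x, q ≤ p x) (hup : ∀ x, p x ≤ 1) {f φ : Ω → 𝕜}
    (hf : MemLp f 2 μ) (hφ : MemLp φ 2 μ) (hφm : AEStronglyMeasurable[⨆ n, ℱ n] φ μ)
    (hφ0 : μ[φ|ℱ 0] =ᵐ[μ] 0) :
    ‖∫ x, f x * φ x ∂μ‖ₑ ≤
      4 * C * lipNorm μ ℱ p φ * hardyNorm μ ℱ p (fun n => μ[f|ℱ n]) := by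
  have hL : ∀ n, MemLp (μ[f|ℱ n]) 2 μ := fun n => hf.condExp (by norm_num)
  refine le_of_tendsto (tendsto_integral_mul_condExp (ℱ := ℱ) hf hφ hφm).enorm
    (Eventually.of_forall fun N => ?_)
  have h := enorm_integral_sub_mul_le hC hp hq hqp hup (martingale_condExp f ℱ μ) hL hφ N
  refine le_trans (le_of_eq ?_) h
  congr 1
  simp only [sub_mul]
  rw [integral_sub (integrable_mul_of_memLp_two (hL N) hφ)
    (integrable_mul_of_memLp_two (hL 0) hφ), integral_mul_condExp (ℱ.le N) hf hφ,
    ← integral_mul_condExp (ℱ.le 0) hf hφ]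
  -- The contribution of time 0 disappears because E(φ | F_0) = 0.
  refine (sub_eq_self.2 ?_).symm
  refine (integral_congr_ae ?_).trans (integral_zero Ω 𝕜)
  filter_upwards [hφ0] with x hx
  rw [hx, Pi.zero_apply, mul_zero]

end VarHardy

namespace VarHardy

variable {Ω : Type*} {m : MeasurableSpace Ω} {𝕜 : Type*} [RCLike 𝕜] {μ : Measure Ω}
  {ℱ : Filtration ℕ m} {p : Ω → ℝ} {q : ℝ} {C : ℝ≥0}

/-! ### Truncations of martingales -/

/-- The set where the partial sum of index `j + 1` is at most `k`, empty when `k ≤ j`. -/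
def truncSet (μ : Measure Ω) (ℱ : Filtration ℕ m) (f : ℕ → Ω → 𝕜) (k j : ℕ) : Set Ω :=
  {x | j < k ∧ partialSq μ ℱ f (j + 1) x ≤ k}

theorem measurableSet_truncSet (f : ℕ → Ω → 𝕜) (k j : ℕ) :
    MeasurableSet[ℱ j] (truncSet μ ℱ f k j) := by
  by_cases h : j < k
  · have e : truncSet μ ℱ f k j = partialSq μ ℱ f (j + 1) ⁻¹' Iic (k : ℝ≥0∞) := by
      ext x
      simp [truncSet, h]
    rw [e]
    exact measurable_partialSq f j measurableSet_Iic
  · have e : truncSet μ ℱ f k j = ∅ := by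
      ext x
      simp [truncSet, h]
    rw [e]
    exact @MeasurableSet.empty _ (ℱ j)

theorem incrSq_le_of_mem_truncSet (f : ℕ → Ω → 𝕜) (k j : ℕ) {x : Ω}
    (hx : x ∈ truncSet μ ℱ f k j) : incrSq μ ℱ f j x ≤ k :=
  (Finset.single_le_sum (f := fun j => incrSq μ ℱ f j x) (fun _ _ => bot_le)
    (Finset.self_mem_range_succ j)).trans hx.2

theorem setTransform_truncSet_of_le (f : ℕ → Ω → 𝕜) {k N : ℕ} (hkN : k ≤ N) :
    setTransform f (truncSet μ ℱ f k) N = setTransform f (truncSet μ ℱ f k) k := by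
  funext x
  refine (Finset.sum_subset (Finset.range_mono hkN) fun j _ hj => ?_).symm
  exact indicator_of_notMem (fun h => hj (Finset.mem_range.2 h.1)) _

/-- Once k exceeds the total sum, truncation discards no index below k, so what remains is dominated
by the tail of a convergent series. -/
theorem tendsto_tsum_truncSet_compl {f : ℕ → Ω → 𝕜} {x : Ω} (hfin : condSq μ ℱ f x < ∞) :
    Tendsto (fun k => (∑' n, (truncSet μ ℱ f k n)ᶜ.indicator (incrSq μ ℱ f n) x) ^ (1 / 2 : ℝ))
      atTop (nhds 0) := by
  have hS : ∑' n, incrSq μ ℱ f n x ≠ ∞ := by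
    rw [← condSq_sq]
    exact (ENNReal.pow_lt_top hfin).ne
  obtain ⟨K, hK⟩ := ENNReal.exists_nat_gt hS
  have htail := ENNReal.tendsto_sum_nat_add (fun n => incrSq μ ℱ f n x) hS
  have hle : ∀ᶠ k in atTop, ∑' n, (truncSet μ ℱ f k n)ᶜ.indicator (incrSq μ ℱ f n) x ≤
      ∑' n, incrSq μ ℱ f (n + k) x := by
    filter_upwards [eventually_ge_atTop K] with k hk
    have h0 : ∑ n ∈ Finset.range k, (truncSet μ ℱ f k n)ᶜ.indicator (incrSq μ ℱ f n) x = 0 := by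
      refine Finset.sum_eq_zero fun j hj => indicator_of_notMem (not_not.2 ?_) _
      refine ⟨Finset.mem_range.1 hj, (ENNReal.sum_le_tsum _).trans (hK.le.trans ?_)⟩
      exact_mod_cast hk
    rw [← Summable.sum_add_tsum_nat_add' (k := k) ENNReal.summable, h0, zero_add]
    exact ENNReal.tsum_le_tsum fun n => indicator_le_self' (fun _ _ => bot_le) x
  have h0 := tendsto_of_tendsto_of_tendsto_of_le_of_le' tendsto_const_nhds htail
    (Eventually.of_forall fun _ => bot_le) hle
  have h1 := ((ENNReal.continuous_rpow_const (y := (1 / 2 : ℝ))).tendsto 0).comp h0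
  rwa [ENNReal.zero_rpow_of_pos (by norm_num)] at h1

variable [IsProbabilityMeasure μ]

/-! ### The lower estimate -/

/-- For s in F_n the set s ∩ {n ≤ τ} belongs to F_τ: before time n it cannot meet {τ ≤ i}, and
afterwards it is already known. So w integrates to 0 over it. -/
theorem condExp_eq_zero_of_le_stopping {τ : Ω → WithTop ℕ} (hτ : IsStoppingTime ℱ τ)
    {w : Ω → 𝕜} (hw : Integrable w μ) (hw0 : μ[w|hτ.measurableSpace] =ᵐ[μ] 0) (n : ℕ) :
    ∀ᵐ x ∂μ, (n : WithTop ℕ) ≤ τ x → μ[w|ℱ n] x = 0 := by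
  set S := {x | (n : WithTop ℕ) ≤ τ x} with hSdef
  have hS : MeasurableSet[ℱ n] S := hτ.measurableSet_ge n
  have hSm : MeasurableSet S := ℱ.le n _ hS
  have h0 : μ[S.indicator w|ℱ n] =ᵐ[μ] 0 := by
    refine (ae_eq_condExp_of_forall_setIntegral_eq (ℱ.le n) (hw.indicator hSm)
      (g := 0) (fun _ _ _ => (integrable_zero _ _ _).integrableOn) ?_
      aestronglyMeasurable_zero).symm
    intro s hs _
    have hsS : MeasurableSet[hτ.measurableSpace] (s ∩ S) := by
      refine ⟨le_iSup (fun n => ℱ n) n _ (hs.inter hS), fun i => ?_⟩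
      rcases le_or_gt n i with hni | hni
      · exact (ℱ.mono hni _ (hs.inter hS)).inter (hτ i)
      · convert @MeasurableSet.empty _ (ℱ i) using 1
        ext x
        simp only [mem_inter_iff, mem_ofPred_eq, mem_empty_iff_false, iff_false]
        rintro ⟨⟨-, h1⟩, h2⟩
        have h3 : (n : WithTop ℕ) ≤ (i : WithTop ℕ) := le_trans h1 h2
        exact absurd (WithTop.coe_le_coe.1 h3) (not_le.2 hni)
    rw [setIntegral_indicator hSm, ← setIntegral_condExp hτ.measurableSpace_le hw hsS]
    simp only [Pi.zero_apply, integral_zero]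
    symm
    refine (setIntegral_congr_ae (hτ.measurableSpace_le _ hsS)
      (hw0.mono fun x hx _ => hx)).trans ?_
    simp
  filter_upwards [h0, condExp_indicator hw hS] with x h1 h2 hx
  rw [h1, indicator_of_mem (by exact hx)] at h2
  exact h2.symm

/-- On {τ > n} both E(w | F_n) and E(w | F_{n+1}) vanish, the second because n + 1 ≤ τ there. Hence
increments start only after τ has occurred. -/
theorem condSq_eq_zero_of_stopping {τ : Ω → WithTop ℕ} (hτ : IsStoppingTime ℱ τ)
    {w : Ω → 𝕜} (hw : Integrable w μ) (hw0 : μ[w|hτ.measurableSpace] =ᵐ[μ] 0) :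
    ∀ᵐ x ∂μ, x ∉ {ω | τ ω < ⊤} → condSq μ ℱ (fun n => μ[w|ℱ n]) x = 0 := by
  have key : ∀ n, incrSq μ ℱ (fun n => μ[w|ℱ n]) n =ᵐ[μ]
      {x | τ x ≤ n}.indicator (incrSq μ ℱ (fun n => μ[w|ℱ n]) n) := by
    intro n
    refine incrSq_ae_eq_indicator (hτ n) ?_
    filter_upwards [condExp_eq_zero_of_le_stopping hτ hw hw0 n,
      condExp_eq_zero_of_le_stopping hτ hw hw0 (n + 1)] with x h1 h2
    by_cases hx : x ∈ {x | τ x ≤ n}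
    · rw [indicator_of_mem hx]
    · rw [indicator_of_notMem hx]
      have hlt : (n : WithTop ℕ) < τ x := not_le.1 hx
      have h3 : ((n + 1 : ℕ) : WithTop ℕ) ≤ τ x := by
        by_contra! h
        obtain ⟨k, hk⟩ := WithTop.ne_top_iff_exists.1 (h.trans (WithTop.coe_lt_top _)).ne
        rw [← hk] at hlt h
        have h4 : n < k := WithTop.coe_lt_coe.1 hlt
        have h5 : k < n + 1 := WithTop.coe_lt_coe.1 h
        omega
      rw [Pi.sub_apply, h1 hlt.le, h2 h3, sub_zero]
  filter_upwards [ae_all_iff.2 key] with x hx hxτ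
  rw [← pow_eq_zero_iff two_ne_zero, condSq_sq, ENNReal.tsum_eq_zero]
  intro n
  rw [hx n]
  refine indicator_of_notMem (fun h => hxτ ?_) _
  exact lt_of_le_of_lt (show τ x ≤ n from h) (WithTop.coe_lt_top n)

theorem measurableSet_stopping_lt_top {τ : Ω → WithTop ℕ} (hτ : IsStoppingTime ℱ τ) :
    MeasurableSet {ω | τ ω < ⊤} := by
  have h := ((iSup_le ℱ.le : (⨆ n, ℱ n) ≤ m) _ hτ.measurableSet_eq_top').compl
  convert h using 1
  ext ω
  simp [lt_top_iff_ne_top]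

theorem eLpNorm_sub_stoppedFun_le_of_bound (hC : IndicatorComparison μ p C) {φ : Ω → 𝕜}
    (hφ : MemLp φ 2 μ) {D : ℝ≥0∞}
    (hD : ∀ f : Ω → 𝕜, MemLp f 2 μ →
      ‖∫ x, f x * φ x ∂μ‖ₑ ≤ D * hardyNorm μ ℱ p (fun n => μ[f|ℱ n]))
    {τ : Ω → WithTop ℕ} (hτ : IsStoppingTime ℱ τ) (h0 : μ {ω | τ ω < ⊤} ≠ 0) :
    eLpNorm (φ - stoppedFun μ ℱ τ φ) 2 μ ≤ 2 * C * D *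
      (μ {ω | τ ω < ⊤} ^ (1 / 2 : ℝ) *
        varNorm μ (dualExp p) ({ω | τ ω < ⊤}.indicator 1)) := by
  have hle := hτ.measurableSpace_le
  have hB := measurableSet_stopping_lt_top hτ
  set B := {ω | τ ω < ⊤}
  rw [eLpNorm_congr_ae (EventuallyEq.rfl.sub (stoppedFun_ae_eq_condExp (μ := μ) hτ φ))]
  have hφτ : MemLp (μ[φ|hτ.measurableSpace]) 2 μ := hφ.condExp (by norm_num)
  set u := φ - μ[φ|hτ.measurableSpace] with hu
  have huL : MemLp u 2 μ := hφ.sub hφτ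
  set X := eLpNorm u 2 μ with hX
  have hv : MemLp (star u) 2 μ := huL.star
  have hXv : eLpNorm (star u) 2 μ = X :=
    eLpNorm_congr_norm_ae (Eventually.of_forall fun x => norm_star (u x))
  have hvτ : MemLp (μ[star u|hτ.measurableSpace]) 2 μ := hv.condExp (by norm_num)
  -- Since u has zero conditional expectation on F_τ, w equals `star u` almost everywhere.
  -- Subtracting the conditional expectation makes the cancellation immediate, at the price of the
  -- factor 2 in `hwX`.
  set w := star u - μ[star u|hτ.measurableSpace] with hw
  have hwL : MemLp w 2 μ := hv.sub hvτ
  have hw0 : μ[w|hτ.measurableSpace] =ᵐ[μ] 0 :=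
    condExp_sub_condExp_ae hle (hv.integrable (by norm_num))
  have hwX : eLpNorm w 2 μ ≤ 2 * X := by
    refine (eLpNorm_sub_le hv.1 hvτ.1 (by norm_num)).trans ?_
    rw [two_mul, ← hXv]
    gcongr
    exact eLpNorm_condExp_le_eLpNorm _ (by norm_num)
  have hint : ∫ x, w x * φ x ∂μ = ∫ x, star (u x) * u x ∂μ := by
    have e1 : ∀ x, w x * φ x = star (u x) * φ x - μ[star u|hτ.measurableSpace] x * φ x := by
      intro x
      rw [hw, Pi.sub_apply, Pi.star_apply, sub_mul]
    have e2 : ∀ x, star (u x) * u x =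
        star (u x) * φ x - star (u x) * μ[φ|hτ.measurableSpace] x := by
      intro x
      rw [← mul_sub]
      rfl
    simp_rw [e1, e2]
    have i1 : Integrable (fun x => star (u x) * φ x) μ := integrable_mul_of_memLp_two hv hφ
    have i2 : Integrable (fun x => star (u x) * μ[φ|hτ.measurableSpace] x) μ :=
      integrable_mul_of_memLp_two hv hφτ
    rw [integral_sub i1 (integrable_mul_of_memLp_two hvτ hφ), integral_sub i1 i2]
    congr 1
    exact (integral_mul_condExp hle hv hφ).symm
  have hsq : ‖∫ x, w x * φ x ∂μ‖ₑ = X ^ 2 := by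
    have e : ∀ x, star (u x) * u x = ((‖u x‖ ^ 2 : ℝ) : 𝕜) := fun x => by
      rw [RCLike.star_def, RCLike.conj_mul]; norm_cast
    rw [hint, hX, eLpNorm_two_sq]
    simp_rw [e]
    rw [integral_ofReal, ← ofReal_norm, RCLike.norm_ofReal,
      abs_of_nonneg (integral_nonneg fun x => sq_nonneg _),
      ofReal_integral_eq_lintegral_ofReal ((memLp_two_iff_integrable_sq_norm huL.1).1 huL)
        (Eventually.of_forall fun x => sq_nonneg _)]
    refine lintegral_congr fun x => ?_
    rw [ENNReal.ofReal_pow (norm_nonneg _), ofReal_norm]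
  obtain ⟨-, -, -, hC4⟩ := hC B hB h0
  set V := varNorm μ (dualExp p) (B.indicator 1)
  have hN : hardyNorm μ ℱ p (fun n => μ[w|ℱ n]) ≤ C * (2 * X * (μ B ^ (1 / 2 : ℝ) * V)) := by
    refine (hC4 _ (measurable_condSq μ ℱ _) (condSq_eq_zero_of_stopping hτ
      (hwL.integrable (by norm_num)) hw0)).trans ?_
    gcongr
    refine le_trans ?_ hwX
    refine (ENNReal.pow_le_pow_left_iff two_ne_zero).1 ?_
    rw [eLpNorm_two_sq, ← ENNReal.rpow_natCast, ← ENNReal.rpow_mul]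
    norm_num
    exact lintegral_condSq_condExp_le hwL
  have hX2 : X * X ≤ X * (2 * C * D * (μ B ^ (1 / 2 : ℝ) * V)) := by
    rw [← sq, ← hsq]
    refine (hD w hwL).trans ((mul_le_mul' le_rfl hN).trans (le_of_eq (by ring)))
  -- Cancelling one factor X requires it to be nonzero and finite.
  rcases eq_or_ne X 0 with hX0 | hX0
  · rw [hX0]; positivity
  · exact (ENNReal.mul_le_mul_iff_right hX0 huL.2.ne).1 hX2

theorem lipNorm_le_of_bound (hC : IndicatorComparison μ p C) {φ : Ω → 𝕜}
    (hφ : MemLp φ 2 μ) (hφm : AEStronglyMeasurable[⨆ n, ℱ n] φ μ) {D : ℝ≥0∞}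
    (hD : ∀ f : Ω → 𝕜, MemLp f 2 μ →
      ‖∫ x, f x * φ x ∂μ‖ₑ ≤ D * hardyNorm μ ℱ p (fun n => μ[f|ℱ n])) :
    lipNorm μ ℱ p φ ≤ 2 * C * D := by
  refine iSup₂_le fun τ hτ => ?_
  have hB := measurableSet_stopping_lt_top hτ
  rcases eq_or_ne (μ {ω | τ ω < ⊤}) 0 with h0 | h0
  -- When τ is almost surely infinite, φ^τ is the conditional expectation of φ on the limit
  -- σ-algebra, which is φ itself.
  · have e : φ - stoppedFun μ ℱ τ φ =ᵐ[μ] 0 := by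
      filter_upwards [measure_eq_zero_iff_ae_notMem.1 h0, condExp_of_aestronglyMeasurable'
        (iSup_le ℱ.le) hφm (hφ.integrable (by norm_num))] with x hx h1
      have hx' : τ x = ⊤ := not_lt_top_iff.1 hx
      rw [Pi.sub_apply, stoppedFun, if_pos hx', h1, sub_self, Pi.zero_apply]
    rw [eLpNorm_congr_ae e, eLpNorm_zero, mul_zero]
    positivity
  · obtain ⟨-, hVt, hV0, -⟩ := hC _ hB h0
    have h := eLpNorm_sub_stoppedFun_le_of_bound hC hφ hD hτ h0
    have e : eLpNorm ({ω | τ ω < ⊤}.indicator (1 : Ω → ℝ)) 2 μ =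
        μ {ω | τ ω < ⊤} ^ (1 / 2 : ℝ) := by
      have := eLpNorm_indicator_const (μ := μ) (p := 2) (c := (1 : ℝ)) hB (by norm_num)
        (by norm_num)
      simpa [Pi.one_def] using this
    have hE0 : μ {ω | τ ω < ⊤} ^ (1 / 2 : ℝ) ≠ 0 := by simp [h0]
    have hEt : μ {ω | τ ω < ⊤} ^ (1 / 2 : ℝ) ≠ ∞ := by simp
    rw [e, ← ENNReal.mul_inv (Or.inl hV0) (Or.inl hVt), ← ENNReal.div_eq_inv_mul,
      ENNReal.div_le_iff (mul_ne_zero hV0 hE0) (ENNReal.mul_ne_top hVt hEt)]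
    rwa [mul_comm (varNorm _ _ _)]

/-! ### Square integrable martingales in the Hardy space -/

theorem memVar_condSq_condExp (hq : 0 < q) (hqp : ∀ x, q ≤ p x) (hup : ∀ x, p x ≤ 1)
    {f : Ω → 𝕜} (hf : MemLp f 2 μ) :
    MemVar μ (extExp p) (condSq μ ℱ (fun n => μ[f|ℱ n])) := by
  have hp0 : ∀ x, 0 ≤ p x := fun x => hq.le.trans (hqp x)
  refine ⟨1, one_pos, ?_⟩
  rw [varModular_extExp hp0]
  calc ∫⁻ x, (condSq μ ℱ (fun n => μ[f|ℱ n]) x / (1 : ℝ≥0)) ^ p x ∂μ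
      ≤ ∫⁻ x, (1 + condSq μ ℱ (fun n => μ[f|ℱ n]) x ^ 2) ∂μ := by
        refine lintegral_mono fun x => ?_
        rw [ENNReal.coe_one, div_one]
        set y := condSq μ ℱ (fun n => μ[f|ℱ n]) x
        rcases le_total y 1 with h1 | h1
        · exact (ENNReal.rpow_le_one h1 (hp0 x)).trans le_self_add
        · refine le_trans ?_ (le_add_self (a := y ^ 2))
          rw [← ENNReal.rpow_natCast]
          exact ENNReal.rpow_le_rpow_of_exponent_le h1 ((hup x).trans (by norm_num))
    _ = 1 + ∫⁻ x, condSq μ ℱ (fun n => μ[f|ℱ n]) x ^ 2 ∂μ := by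
        rw [lintegral_add_left measurable_const]
        simp
    _ ≤ 1 + ∫⁻ x, ‖f x‖ₑ ^ 2 ∂μ := add_le_add le_rfl (lintegral_condSq_condExp_le hf)
    _ < ∞ := ENNReal.add_lt_top.2 ⟨ENNReal.one_lt_top, (memLp_two_iff hf.1).1 hf⟩

theorem condExp_mem_hardySpace (hp : Measurable p) (hq : 0 < q) (hqp : ∀ x, q ≤ p x)
    (hup : ∀ x, p x ≤ 1) {f : Ω → 𝕜} (hf : MemLp f 2 μ) :
    (fun n => μ[f|ℱ n]) ∈ hardySpace 𝕜 μ ℱ p hp :=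
  ⟨martingale_condExp f ℱ μ, memVar_condSq_condExp hq hqp hup hf⟩

/-- The support estimate with B = Ω; the resulting constant does not involve the filtration. -/
theorem exists_hardyNorm_condExp_le (hC : IndicatorComparison μ p C) :
    ∃ C' : ℝ≥0, ∀ (ℱ : Filtration ℕ m) (f : Ω → 𝕜), MemLp f 2 μ →
      hardyNorm μ ℱ p (fun n => μ[f|ℱ n]) ≤ C' * eLpNorm f 2 μ := by
  obtain ⟨-, hVt, -, hC4⟩ := hC univ MeasurableSet.univ (by simp)
  refine ⟨C * (varNorm μ (dualExp p) (univ.indicator 1)).toNNReal, fun ℱ f hf => ?_⟩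
  refine (hC4 _ (measurable_condSq μ ℱ _) (Eventually.of_forall fun x hx =>
    absurd (mem_univ x) hx)).trans ?_
  rw [measure_univ, ENNReal.one_rpow, one_mul, ENNReal.coe_mul, ENNReal.coe_toNNReal hVt, mul_assoc,
    mul_comm (varNorm _ _ _)]
  gcongr
  refine (ENNReal.pow_le_pow_left_iff two_ne_zero).1 ?_
  rw [eLpNorm_two_sq, ← ENNReal.rpow_natCast, ← ENNReal.rpow_mul]
  norm_num
  exact lintegral_condSq_condExp_le hf

/-! ### Density of the square integrable martingales -/

theorem condExp_setTransform {f : ℕ → Ω → 𝕜} (hf : Martingale f ℱ μ) {A : ℕ → Set Ω}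
    (hA : ∀ j, MeasurableSet[ℱ j] (A j))
    (hL : ∀ j, MemLp ((A j).indicator (f (j + 1) - f j)) 2 μ) {n N : ℕ} (hnN : n ≤ N) :
    μ[setTransform f A N|ℱ n] =ᵐ[μ] setTransform f A n := by
  induction N, hnN using Nat.le_induction with
  | base =>
    rw [condExp_of_stronglyMeasurable (ℱ.le n) (stronglyMeasurable_setTransform hf hA n)
      ((memLp_setTransform hL n).integrable (by norm_num))]
  | succ N hnN ih =>
    have e : setTransform f A (N + 1) =
        setTransform f A N + (A N).indicator (f (N + 1) - f N) := by
      funext x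
      simp [setTransform, Finset.sum_range_succ]
    rw [e]
    have h1 : μ[(A N).indicator (f (N + 1) - f N)|ℱ n] =ᵐ[μ] 0 := by
      refine (condExp_condExp_of_le (ℱ.mono hnN) (ℱ.le N)).symm.trans ?_
      refine (condExp_congr_ae (condExp_indicator_increment hf (hA N))).trans ?_
      rw [condExp_zero]
    refine (condExp_add ((memLp_setTransform hL N).integrable (by norm_num))
      ((hL N).integrable (by norm_num)) _).trans ?_
    filter_upwards [ih, h1] with x h2 h3
    rw [Pi.add_apply, h2, h3, Pi.zero_apply, add_zero]

/-- The martingale itself need not be square integrable, but on this set in F_j the conditional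
second moment of the increment is at most k. -/
theorem memLp_indicator_truncSet {f : ℕ → Ω → 𝕜} (hM : Martingale f ℱ μ) (k j : ℕ) :
    MemLp ((truncSet μ ℱ f k j).indicator (f (j + 1) - f j)) 2 μ := by
  have hAm := ℱ.le j _ (measurableSet_truncSet (μ := μ) f k j)
  have h1 : StronglyMeasurable (f (j + 1)) := (hM.1 (j + 1)).mono (ℱ.le _)
  have h2 : StronglyMeasurable (f j) := (hM.1 j).mono (ℱ.le _)
  rw [memLp_two_iff ((h1.sub h2).indicator hAm).aestronglyMeasurable]
  have e : ∀ x, ‖(truncSet μ ℱ f k j).indicator (f (j + 1) - f j) x‖ₑ ^ 2 =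
      (truncSet μ ℱ f k j).indicator (fun x => ‖f (j + 1) x - f j x‖ₑ ^ 2) x := by
    intro x
    by_cases hx : x ∈ truncSet μ ℱ f k j
    · simp [hx]
    · simp [hx]
  simp_rw [e]
  rw [lintegral_indicator hAm, ← setLIntegral_incrSq f j (measurableSet_truncSet f k j)]
  calc ∫⁻ x in truncSet μ ℱ f k j, incrSq μ ℱ f j x ∂μ
      ≤ ∫⁻ _ in truncSet μ ℱ f k j, (k : ℝ≥0∞) ∂μ :=
        setLIntegral_mono' hAm fun x hx => incrSq_le_of_mem_truncSet f k j hx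
    _ = k * μ (truncSet μ ℱ f k j) := setLIntegral_const _ _
    _ < ∞ := ENNReal.mul_lt_top (ENNReal.natCast_lt_top k) (measure_lt_top _ _)

theorem condExp_setTransform_truncSet {f : ℕ → Ω → 𝕜} (hM : Martingale f ℱ μ) (k n : ℕ) :
    μ[setTransform f (truncSet μ ℱ f k) k|ℱ n] =ᵐ[μ] setTransform f (truncSet μ ℱ f k) n := by
  -- The transform is stationary from index k on, so it may be read at `max n k`; this covers n > k
  -- as well.
  rw [← setTransform_truncSet_of_le f (le_max_right n k)]
  exact condExp_setTransform hM (measurableSet_truncSet f k) (memLp_indicator_truncSet hM k)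
    (le_max_left _ _)

theorem condSq_sub_truncated {f : ℕ → Ω → 𝕜} (hM : Martingale f ℱ μ) (k : ℕ) :
    ∀ᵐ x ∂μ, condSq μ ℱ (f - fun n => μ[setTransform f (truncSet μ ℱ f k) k|ℱ n]) x =
      (∑' n, (truncSet μ ℱ f k n)ᶜ.indicator (incrSq μ ℱ f n) x) ^ (1 / 2 : ℝ) := by
  have hincr : ∀ᵐ x ∂μ, ∀ n,
      incrSq μ ℱ (f - fun n => μ[setTransform f (truncSet μ ℱ f k) k|ℱ n]) n x =
      (truncSet μ ℱ f k n)ᶜ.indicator (incrSq μ ℱ f n) x := by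
    refine ae_all_iff.2 fun n => incrSq_ae_eq_indicator (measurableSet_truncSet f k n).compl ?_
    filter_upwards [condExp_setTransform_truncSet hM k n,
      condExp_setTransform_truncSet hM k (n + 1)] with x h1 h2
    simp only [Pi.sub_apply, h1, h2]
    have e : setTransform f (truncSet μ ℱ f k) (n + 1) x =
        setTransform f (truncSet μ ℱ f k) n x +
          (truncSet μ ℱ f k n).indicator (f (n + 1) - f n) x := by
      simp [setTransform, Finset.sum_range_succ]
    rw [e]
    by_cases hx : x ∈ truncSet μ ℱ f k n
    · rw [indicator_of_mem hx, indicator_of_notMem (not_not.2 hx), Pi.sub_apply]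
      ring
    · rw [indicator_of_notMem hx, indicator_of_mem (by exact hx), Pi.sub_apply]
      ring
  filter_upwards [hincr] with x hx
  rw [← tsum_congr hx]
  rfl

/-- Removing the truncated transform leaves exactly the increments off the truncation sets. Their
square function is dominated by s(f) and tends to 0 wherever s(f) is finite, which is almost
everywhere. -/
theorem exists_memLp_hardyNorm_sub_lt (hp : Measurable p) (hq : 0 < q) (hqp : ∀ x, q ≤ p x)
    (hup : ∀ x, p x ≤ 1) {f : ℕ → Ω → 𝕜} (hf : f ∈ hardySpace 𝕜 μ ℱ p hp) {ε : ℝ≥0∞}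
    (hε : 0 < ε) :
    ∃ g : Ω → 𝕜, MemLp g 2 μ ∧ hardyNorm μ ℱ p (f - fun n => μ[g|ℱ n]) < ε := by
  obtain ⟨hM, hmem⟩ := hf
  have hlim : Tendsto (fun k => varNorm μ (extExp p)
      (condSq μ ℱ (f - fun n => μ[setTransform f (truncSet μ ℱ f k) k|ℱ n]))) atTop (nhds 0) := by
    refine tendsto_varNorm_zero hp hq hqp hup hmem (fun k => measurable_condSq μ ℱ _)
      (fun k => ?_) ?_
    · filter_upwards [condSq_sub_truncated hM k] with x hx
      rw [hx]
      refine ENNReal.rpow_le_rpow (ENNReal.tsum_le_tsum fun n => ?_) (by norm_num)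
      exact indicator_le_self' (fun _ _ => bot_le) x
    · filter_upwards [ae_all_iff.2 (condSq_sub_truncated hM), MemVar.ae_lt_top hp
        (fun x => hq.trans_le (hqp x)) hmem (measurable_condSq μ ℱ f)] with x hx hfin
      simp_rw [hx]
      exact tendsto_tsum_truncSet_compl hfin
  obtain ⟨k, hk⟩ := (hlim.eventually (gt_mem_nhds hε)).exists
  exact ⟨_, memLp_setTransform (memLp_indicator_truncSet hM k) k, hk⟩

end VarHardy

namespace VarHardy

/-! ### Extension of bounded functionals along a dense almost linear map -/

theorem eq_of_forall_norm_sub_le {𝕜 : Type*} [RCLike 𝕜] {x y : 𝕜} (K : ℝ)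
    (h : ∀ ε : ℝ, 0 < ε → ‖x - y‖ ≤ K * ε) : x = y := by
  rw [← sub_eq_zero, ← norm_le_zero_iff]
  have hlim : Tendsto (fun n : ℕ => K * (1 / ((n : ℝ) + 1))) atTop (nhds (K * 0)) :=
    tendsto_one_div_add_atTop_nhds_zero_nat.const_mul K
  rw [mul_zero] at hlim
  exact ge_of_tendsto' hlim fun n => h _ Nat.one_div_pos_of_nat

/-- Extension by density for a quasi-seminorm N and a map i that is linear only up to N-null
vectors, as versions of conditional expectations are. In Bκ³ two factors κ come from comparing two
approximants of the same vector, and the third from N(f - i 0) ≤ κ N f. -/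
theorem exists_linear_extension {𝕜 E V : Type*} [RCLike 𝕜] [AddCommGroup E] [Module 𝕜 E]
    [AddCommGroup V] [Module 𝕜 V] (L : E →ₗ[𝕜] 𝕜) (i : E → V) (N : V → ℝ) {κ B : ℝ}
    (hκ : 0 ≤ κ) (hB : 0 ≤ B) (hN : ∀ x, 0 ≤ N x)
    (htri : ∀ x y, N (x + y) ≤ κ * (N x + N y)) (hsmul : ∀ (c : 𝕜) x, N (c • x) ≤ ‖c‖ * N x)
    (hadd : ∀ g h, N (i (g + h) - (i g + i h)) = 0)
    (hism : ∀ (c : 𝕜) g, N (i (c • g) - c • i g) = 0)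
    (hbound : ∀ g, ‖L g‖ ≤ B * N (i g))
    (hdense : ∀ f, ∀ ε : ℝ, 0 < ε → ∃ g, N (f - i g) < ε) :
    ∃ l : V →ₗ[𝕜] 𝕜, (∀ g, l (i g) = L g) ∧ ∀ f, ‖l f‖ ≤ B * κ ^ 3 * N f := by
  have hneg : ∀ x, N (-x) ≤ N x := fun x => by
    simpa using hsmul (-1) x
  have hzero : N 0 = 0 := le_antisymm (by simpa using hsmul 0 0) (hN 0)
  have hzi : N (i 0) = 0 := by simpa using hism 0 0
  have hisub : ∀ g h, N (i (g - h) - (i g - i h)) = 0 := by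
    intro g h
    refine le_antisymm ?_ (hN _)
    have h1 := htri (i (g + (-1 : 𝕜) • h) - (i g + i ((-1 : 𝕜) • h)))
      (i ((-1 : 𝕜) • h) - (-1 : 𝕜) • i h)
    rw [hadd, hism, add_zero, mul_zero] at h1
    have e : i (g - h) - (i g - i h) = (i (g + (-1 : 𝕜) • h) - (i g + i ((-1 : 𝕜) • h))) +
        (i ((-1 : 𝕜) • h) - (-1 : 𝕜) • i h) := by
      rw [neg_smul _ (i h), one_smul 𝕜 (i h), show g - h = g + (-1 : 𝕜) • h by
        rw [neg_smul, one_smul, sub_eq_add_neg]]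
      abel
    rwa [e]
  set M := B * κ ^ 2 with hMdef
  have hM : 0 ≤ M := by positivity
  have hpair : ∀ f g h, ‖L g - L h‖ ≤ M * (N (f - i g) + N (f - i h)) := by
    intro f g h
    rw [← map_sub]
    have h1 : N (i (g - h)) ≤ κ * N (i g - i h) := by
      have := htri (i (g - h) - (i g - i h)) (i g - i h)
      rwa [sub_add_cancel, hisub, zero_add] at this
    have h2 : N (i g - i h) ≤ κ * (N (f - i g) + N (f - i h)) := by
      have := htri (-(f - i g)) (f - i h)
      rw [show -(f - i g) + (f - i h) = i g - i h by abel] at this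
      refine this.trans ?_
      gcongr
      exact hneg _
    calc ‖L (g - h)‖ ≤ B * N (i (g - h)) := hbound _
      _ ≤ B * (κ * (κ * (N (f - i g) + N (f - i h)))) := by
        gcongr
        exact h1.trans (by gcongr)
      _ = _ := by rw [hMdef]; ring
  -- The limit is recorded by its distance to L h for every h, not only along the chosen sequence;
  -- linearity and boundedness both follow from this estimate.
  have hex : ∀ f, ∃ z : 𝕜, ∀ h, ‖z - L h‖ ≤ M * N (f - i h) := by
    intro f
    choose g hg using fun n : ℕ => hdense f (1 / ((n : ℝ) + 1)) Nat.one_div_pos_of_nat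
    have hlim0 : Tendsto (fun n : ℕ => 1 / ((n : ℝ) + 1)) atTop (nhds 0) :=
      tendsto_one_div_add_atTop_nhds_zero_nat
    have hcauchy : CauchySeq fun n => L (g n) := by
      refine cauchySeq_of_le_tendsto_0 (fun n : ℕ => M * (1 / ((n : ℝ) + 1) + 1 / ((n : ℝ) + 1)))
        (fun n k K hn hk => ?_) ?_
      · rw [dist_eq_norm]
        refine (hpair f _ _).trans ?_
        gcongr
        · exact (hg n).le.trans (Nat.one_div_le_one_div hn)
        · exact (hg k).le.trans (Nat.one_div_le_one_div hk)
      · simpa using (hlim0.add hlim0).const_mul M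
    obtain ⟨z, hz⟩ := cauchySeq_tendsto_of_complete hcauchy
    refine ⟨z, fun h => ?_⟩
    have h1 := (hz.sub_const (L h)).norm
    have h2 : Tendsto (fun n : ℕ => M * (1 / ((n : ℝ) + 1) + N (f - i h))) atTop
        (nhds (M * (0 + N (f - i h)))) := (hlim0.add_const _).const_mul M
    rw [zero_add] at h2
    refine le_of_tendsto_of_tendsto' h1 h2 fun n => (hpair f _ _).trans ?_
    gcongr
    exact (hg n).le
  choose z hz using hex
  have hzadd : ∀ f h, z (f + h) = z f + z h := by
    intro f h
    refine eq_of_forall_norm_sub_le (M * (κ * (κ * 2)) + M * 2) fun ε hε => ?_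
    obtain ⟨g₁, hg₁⟩ := hdense f ε hε
    obtain ⟨g₂, hg₂⟩ := hdense h ε hε
    have h1 : N (f + h - i (g₁ + g₂)) ≤ κ * (κ * (ε + ε)) := by
      have e : f + h - i (g₁ + g₂) = ((f - i g₁) + (h - i g₂)) +
          -(i (g₁ + g₂) - (i g₁ + i g₂)) := by abel
      rw [e]
      refine (htri _ _).trans ?_
      have h3 : N (-(i (g₁ + g₂) - (i g₁ + i g₂))) ≤ 0 := (hneg _).trans (hadd _ _).le
      have h4 : N ((f - i g₁) + (h - i g₂)) ≤ κ * (ε + ε) :=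
        (htri _ _).trans (by gcongr)
      gcongr
      linarith
    have e : z (f + h) - (z f + z h) =
        (z (f + h) - L (g₁ + g₂)) - ((z f - L g₁) + (z h - L g₂)) := by
      rw [map_add]; ring
    rw [e]
    refine (norm_sub_le _ _).trans ?_
    refine (add_le_add ((hz _ _).trans (mul_le_mul_of_nonneg_left h1 hM)) ((norm_add_le _ _).trans
      (add_le_add ((hz _ _).trans (mul_le_mul_of_nonneg_left hg₁.le hM))
        ((hz _ _).trans (mul_le_mul_of_nonneg_left hg₂.le hM))))).trans (le_of_eq (by ring))
  have hzsmul : ∀ (c : 𝕜) f, z (c • f) = c * z f := by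
    intro c f
    refine eq_of_forall_norm_sub_le (M * (κ * ‖c‖) + ‖c‖ * M) fun ε hε => ?_
    obtain ⟨g, hg⟩ := hdense f ε hε
    have h1 : N (c • f - i (c • g)) ≤ κ * (‖c‖ * ε) := by
      have e : c • f - i (c • g) = c • (f - i g) + -(i (c • g) - c • i g) := by
        rw [smul_sub]; abel
      rw [e]
      refine (htri _ _).trans ?_
      have h3 : N (-(i (c • g) - c • i g)) ≤ 0 := (hneg _).trans (hism _ _).le
      have h4 : N (c • (f - i g)) ≤ ‖c‖ * ε := (hsmul _ _).trans (by gcongr)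
      gcongr
      linarith
    have e : z (c • f) - c * z f = (z (c • f) - L (c • g)) - c * (z f - L g) := by
      rw [map_smul, smul_eq_mul]; ring
    rw [e]
    refine (norm_sub_le _ _).trans ?_
    rw [norm_mul]
    refine (add_le_add ((hz _ _).trans (mul_le_mul_of_nonneg_left h1 hM))
      (mul_le_mul_of_nonneg_left ((hz _ _).trans (mul_le_mul_of_nonneg_left hg.le hM))
        (norm_nonneg c))).trans (le_of_eq (by ring))
  refine ⟨{ toFun := z, map_add' := hzadd, map_smul' := hzsmul }, fun g => ?_, fun f => ?_⟩
  · have h := hz (i g) g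
    rw [sub_self, hzero, mul_zero, norm_le_zero_iff, sub_eq_zero] at h
    exact h
  · have h := hz f 0
    rw [map_zero, sub_zero] at h
    refine h.trans ?_
    have h1 := htri f (-(i 0))
    have h2 : N (-(i 0)) ≤ 0 := (hneg _).trans hzi.le
    rw [← sub_eq_add_neg] at h1
    calc M * N (f - i 0) ≤ M * (κ * N f) := by
          gcongr
          refine h1.trans ?_
          gcongr
          linarith
      _ = _ := by rw [hMdef]; ring

variable {Ω : Type*} {m : MeasurableSpace Ω} {𝕜 : Type*} [RCLike 𝕜] {μ : Measure Ω}
  {ℱ : Filtration ℕ m} {p : Ω → ℝ} {q : ℝ} {C : ℝ≥0}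

/-! ### The Hardy quasi-norm -/

theorem hardyNorm_congr {f g : ℕ → Ω → 𝕜} (h : ∀ n, f n =ᵐ[μ] g n) :
    hardyNorm μ ℱ p f = hardyNorm μ ℱ p g := by
  refine varNorm_congr ?_
  have key : ∀ n, condLExp (ℱ n) μ (fun x => ‖f (n + 1) x - f n x‖ₑ ^ (2 : ℕ)) =ᵐ[μ]
      condLExp (ℱ n) μ (fun x => ‖g (n + 1) x - g n x‖ₑ ^ (2 : ℕ)) := fun n => by
    refine condLExp_congr_ae ?_
    filter_upwards [h n, h (n + 1)] with x h1 h2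
    rw [h1, h2]
  filter_upwards [ae_all_iff.2 key] with x hx
  simp only [condSq, hx]

variable [IsProbabilityMeasure μ]

/-- The quasi-norm sees only increments, so it is blind to the initial value and to changes on null
sets. -/
theorem hardyNorm_eq_zero (hq : 0 < q) (hqp : ∀ x, q ≤ p x) {f : ℕ → Ω → 𝕜}
    (h : ∀ n, f (n + 1) =ᵐ[μ] f n) : hardyNorm μ ℱ p f = 0 := by
  have h0 : condSq μ ℱ f =ᵐ[μ] fun _ => 0 := by
    have h1 : ∀ n, incrSq μ ℱ f n =ᵐ[μ] 0 := by
      intro n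
      have := incrSq_ae_eq_indicator (μ := μ) (ℱ := ℱ) (f := f) (g := f) (n := n)
        (@MeasurableSet.empty _ (ℱ n)) (by
          filter_upwards [h n] with x hx
          rw [Pi.sub_apply, hx, sub_self, indicator_empty])
      rwa [indicator_empty] at this
    filter_upwards [ae_all_iff.2 h1] with x hx
    rw [← pow_eq_zero_iff two_ne_zero, condSq_sq, ENNReal.tsum_eq_zero]
    exact hx
  rw [hardyNorm, varNorm_congr h0, varNorm_zero hq hqp]

theorem hardyNorm_add_le (hp : Measurable p) (hq : 0 < q) (hqp : ∀ x, q ≤ p x)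
    {f g : ℕ → Ω → 𝕜} (hf : Martingale f ℱ μ) (hg : Martingale g ℱ μ) :
    hardyNorm μ ℱ p (f + g) ≤
      (2 * dilConst q : ℝ≥0) * (hardyNorm μ ℱ p f + hardyNorm μ ℱ p g) := by
  refine (varNorm_mono (condSq_add_le hf hg)).trans ((varNorm_const_mul_le hq hqp 2 _).trans ?_)
  rw [ENNReal.coe_mul, mul_assoc]
  exact mul_le_mul' le_rfl (varNorm_add_le hp hq hqp (measurable_condSq μ ℱ f))

theorem hardyNorm_smul_le (hq : 0 < q) (hqp : ∀ x, q ≤ p x) (c : 𝕜) (f : ℕ → Ω → 𝕜) :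
    hardyNorm μ ℱ p (c • f) ≤ ‖c‖ₑ * hardyNorm μ ℱ p f :=
  (varNorm_mono (condSq_smul_le c f)).trans (varNorm_const_mul_le hq hqp ‖c‖₊ _)

theorem hardyNorm_lt_top (hq : 0 < q) (hqp : ∀ x, q ≤ p x) {hp : Measurable p}
    (f : hardySpace 𝕜 μ ℱ p hp) : hardyNorm μ ℱ p (f : ℕ → Ω → 𝕜) < ∞ :=
  MemVar.varNorm_lt_top hq hqp f.2.2

variable {hp : Measurable p}

theorem enorm_le_dualNorm_mul (hq : 0 < q) (hqp : ∀ x, q ≤ p x)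
    (l : Module.Dual 𝕜 (hardySpace 𝕜 μ ℱ p hp)) (hl : dualNorm l < ∞)
    (f : hardySpace 𝕜 μ ℱ p hp) :
    ‖l f‖ₑ ≤ dualNorm l * hardyNorm μ ℱ p (f : ℕ → Ω → 𝕜) := by
  have key : ∀ s : ℝ≥0, hardyNorm μ ℱ p (f : ℕ → Ω → 𝕜) < s → ‖l f‖ₑ ≤ dualNorm l * s := by
    intro s hs
    have hs0 : s ≠ 0 := by
      rintro rfl
      exact absurd hs (by simp)
    have hs1 : (s : ℝ≥0∞) ≠ 0 := by exact_mod_cast hs0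
    set c : 𝕜 := (((s : ℝ)⁻¹ : ℝ) : 𝕜) with hc
    have hce : ‖c‖ₑ = (s : ℝ≥0∞)⁻¹ := by
      rw [← ENNReal.coe_inv hs0, enorm_eq_nnnorm, ENNReal.coe_inj]
      ext
      simp [hc]
    have h1 : hardyNorm μ ℱ p ((c • f : hardySpace 𝕜 μ ℱ p hp) : ℕ → Ω → 𝕜) ≤ 1 := by
      refine (hardyNorm_smul_le hq hqp c (f : ℕ → Ω → 𝕜)).trans ?_
      rw [hce, ← ENNReal.inv_mul_cancel hs1 ENNReal.coe_ne_top]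
      exact mul_le_mul' le_rfl hs.le
    have h2 : ‖l (c • f)‖ₑ ≤ dualNorm l :=
      le_iSup₂_of_le (f := fun (f : hardySpace 𝕜 μ ℱ p hp)
        (_ : hardyNorm μ ℱ p (f : ℕ → Ω → 𝕜) ≤ 1) => ‖l f‖ₑ) (c • f) h1 le_rfl
    rw [map_smul, smul_eq_mul, enorm_mul, hce, ← ENNReal.div_eq_inv_mul,
      ENNReal.div_le_iff hs1 ENNReal.coe_ne_top] at h2
    exact h2
  -- Passing to the infimum over s divides by the dual norm; when that is zero, a single finite s
  -- suffices.
  rcases eq_or_ne (dualNorm l) 0 with h0 | h0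
  · obtain ⟨s, hs, -⟩ := ENNReal.lt_iff_exists_nnreal_btwn.1 (hardyNorm_lt_top hq hqp f)
    have := key s hs
    rw [h0, zero_mul] at this ⊢
    exact this
  · rw [mul_comm, ← ENNReal.div_le_iff h0 hl.ne]
    refine le_of_forall_gt_imp_ge_of_dense fun a ha => ?_
    obtain ⟨s, hs, hsa⟩ := ENNReal.lt_iff_exists_nnreal_btwn.1 ha
    refine le_trans ?_ hsa.le
    rw [ENNReal.div_le_iff h0 hl.ne, mul_comm]
    exact key s hs

theorem dualNorm_le {l : Module.Dual 𝕜 (hardySpace 𝕜 μ ℱ p hp)} {D : ℝ≥0∞}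
    (h : ∀ f : hardySpace 𝕜 μ ℱ p hp, ‖l f‖ₑ ≤ D * hardyNorm μ ℱ p (f : ℕ → Ω → 𝕜)) :
    dualNorm l ≤ D :=
  iSup₂_le fun f hf => (h f).trans ((mul_le_mul' le_rfl hf).trans (mul_one D).le)

theorem apply_eq_of_ae_eq (hq : 0 < q) (hqp : ∀ x, q ≤ p x)
    {l : Module.Dual 𝕜 (hardySpace 𝕜 μ ℱ p hp)} (hl : dualNorm l < ∞)
    {f g : hardySpace 𝕜 μ ℱ p hp}
    (h : ∀ n, (f : ℕ → Ω → 𝕜) (n + 1) - (g : ℕ → Ω → 𝕜) (n + 1) =ᵐ[μ]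
      (f : ℕ → Ω → 𝕜) n - (g : ℕ → Ω → 𝕜) n) : l f = l g := by
  rw [← sub_eq_zero, ← map_sub]
  have h1 := enorm_le_dualNorm_mul hq hqp l hl (f - g)
  rw [hardyNorm_eq_zero hq hqp (f := ((f - g : hardySpace 𝕜 μ ℱ p hp) : ℕ → Ω → 𝕜))
    (fun n => h n), mul_zero, nonpos_iff_eq_zero, enorm_eq_zero] at h1
  exact h1

/-- The element `(E(f | F_n))_n` of the Hardy space, for `f ∈ L²`. -/
noncomputable def condMart (ℱ : Filtration ℕ m) (hp : Measurable p) (hq : 0 < q)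
    (hqp : ∀ x, q ≤ p x)
    (hup : ∀ x, p x ≤ 1) (f : Lp 𝕜 2 μ) : hardySpace 𝕜 μ ℱ p hp :=
  ⟨fun n => μ[f|ℱ n], condExp_mem_hardySpace hp hq hqp hup (Lp.memLp f)⟩

theorem condMart_add (hq : 0 < q) (hqp : ∀ x, q ≤ p x) (hup : ∀ x, p x ≤ 1) (f g : Lp 𝕜 2 μ)
    (n : ℕ) : (condMart ℱ hp hq hqp hup (f + g) : ℕ → Ω → 𝕜) n =ᵐ[μ]
      (condMart ℱ hp hq hqp hup f : ℕ → Ω → 𝕜) n +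
        (condMart ℱ hp hq hqp hup g : ℕ → Ω → 𝕜) n :=
  (condExp_congr_ae (Lp.coeFn_add f g)).trans
    (condExp_add ((Lp.memLp f).integrable (by norm_num)) ((Lp.memLp g).integrable (by norm_num)) _)

theorem condMart_smul (hq : 0 < q) (hqp : ∀ x, q ≤ p x) (hup : ∀ x, p x ≤ 1) (c : 𝕜)
    (f : Lp 𝕜 2 μ) (n : ℕ) : (condMart ℱ hp hq hqp hup (c • f) : ℕ → Ω → 𝕜) n =ᵐ[μ]
      c • (condMart ℱ hp hq hqp hup f : ℕ → Ω → 𝕜) n :=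
  (condExp_congr_ae (Lp.coeFn_smul c f)).trans (condExp_smul c _ _)

theorem exists_hardyNorm_sub_condMart_lt (hq : 0 < q) (hqp : ∀ x, q ≤ p x)
    (hup : ∀ x, p x ≤ 1) (f : hardySpace 𝕜 μ ℱ p hp) {ε : ℝ≥0∞} (hε : 0 < ε) :
    ∃ g : Lp 𝕜 2 μ, hardyNorm μ ℱ p
      ((f - condMart ℱ hp hq hqp hup g : hardySpace 𝕜 μ ℱ p hp) : ℕ → Ω → 𝕜) < ε := by
  obtain ⟨g, hg, hlt⟩ := exists_memLp_hardyNorm_sub_lt hp hq hqp hup f.2 hε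
  refine ⟨hg.toLp g, lt_of_le_of_lt (le_of_eq (hardyNorm_congr fun n => ?_)) hlt⟩
  exact EventuallyEq.rfl.sub (condExp_congr_ae hg.coeFn_toLp)

/-- Bounded functionals that agree on the dense L² martingales agree everywhere. -/
theorem hardyDual_ext (hq : 0 < q) (hqp : ∀ x, q ≤ p x) (hup : ∀ x, p x ≤ 1)
    {l k : Module.Dual 𝕜 (hardySpace 𝕜 μ ℱ p hp)} (hl : l ∈ hardyDual 𝕜 μ ℱ p hp)
    (hk : k ∈ hardyDual 𝕜 μ ℱ p hp)
    (h : ∀ f : Lp 𝕜 2 μ, l (condMart ℱ hp hq hqp hup f) = k (condMart ℱ hp hq hqp hup f)) :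
    l = k := by
  rw [← sub_eq_zero]
  have hd : dualNorm (l - k) < ∞ := Submodule.sub_mem _ hl hk
  ext f
  rw [LinearMap.zero_apply]
  refine eq_of_forall_norm_sub_le (dualNorm (l - k)).toReal fun ε hε => ?_
  obtain ⟨g, hlt⟩ := exists_hardyNorm_sub_condMart_lt hq hqp hup f (ENNReal.ofReal_pos.2 hε)
  have h2 := enorm_le_dualNorm_mul hq hqp (l - k) hd (f - condMart ℱ hp hq hqp hup g)
  rw [map_sub, LinearMap.sub_apply l k (condMart _ _ _ _ _ _), h, sub_self, sub_zero] at h2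
  have h3 := ENNReal.toReal_mono (ENNReal.mul_ne_top hd.ne ENNReal.ofReal_ne_top)
    (h2.trans (mul_le_mul' le_rfl hlt.le))
  rw [ENNReal.toReal_mul, ENNReal.toReal_ofReal hε.le, toReal_enorm] at h3
  rwa [sub_zero]

/-! ### Functionals represented by Lipschitz functions -/

theorem exists_functional (hC : IndicatorComparison μ p C) (hq : 0 < q) (hqp : ∀ x, q ≤ p x)
    (hup : ∀ x, p x ≤ 1) (φ : lipSpace 𝕜 μ ℱ p) :
    ∃ l : Module.Dual 𝕜 (hardySpace 𝕜 μ ℱ p hp),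
      (∀ f : Lp 𝕜 2 μ, l (condMart ℱ hp hq hqp hup f) = ∫ x, f x * (φ : Lp 𝕜 2 μ) x ∂μ) ∧
      dualNorm l ≤ (4 * C * (2 * dilConst q) ^ 3 : ℝ≥0) *
        lipNorm μ ℱ p ((φ : Lp 𝕜 2 μ) : Ω → 𝕜) := by
  obtain ⟨φ, hφm, hφ0, hφlip⟩ := φ
  have hφ := Lp.memLp φ
  set L : Lp 𝕜 2 μ →ₗ[𝕜] 𝕜 :=
    { toFun := fun f => ∫ x, f x * φ x ∂μ
      map_add' := fun f g => by
        rw [← integral_add (integrable_mul_of_memLp_two (Lp.memLp f) hφ)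
          (integrable_mul_of_memLp_two (Lp.memLp g) hφ)]
        refine integral_congr_ae ?_
        filter_upwards [Lp.coeFn_add f g] with x hx
        rw [hx, Pi.add_apply, add_mul]
      map_smul' := fun c f => by
        rw [RingHom.id_apply, smul_eq_mul, ← integral_const_mul]
        refine integral_congr_ae ?_
        filter_upwards [Lp.coeFn_smul c f] with x hx
        rw [hx, Pi.smul_apply, smul_eq_mul, mul_assoc] } with hL
  set N : hardySpace 𝕜 μ ℱ p hp → ℝ := fun f => (hardyNorm μ ℱ p (f : ℕ → Ω → 𝕜)).toReal with hN
  set B : ℝ≥0∞ := 4 * C * lipNorm μ ℱ p φ with hBdef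
  have hBt : B ≠ ∞ := ENNReal.mul_ne_top (ENNReal.mul_ne_top (by norm_num) ENNReal.coe_ne_top)
    hφlip.ne
  have hfin := fun f : hardySpace 𝕜 μ ℱ p hp => (hardyNorm_lt_top hq hqp f).ne
  obtain ⟨l, hl1, hl2⟩ := exists_linear_extension L (condMart ℱ hp hq hqp hup) N
    -- The quasi-triangle constant: 2 from subadditivity of s(f) up to that factor, and the dilation
    -- constant from the variable quasi-norm.
    (κ := (2 * dilConst q : ℝ≥0)) (B := B.toReal) (NNReal.coe_nonneg _) ENNReal.toReal_nonneg
    (fun _ => ENNReal.toReal_nonneg)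
    (fun f g => by
      have h := hardyNorm_add_le hp hq hqp f.2.1 g.2.1
      have h' := ENNReal.toReal_mono (ENNReal.mul_ne_top ENNReal.coe_ne_top
        (ENNReal.add_ne_top.2 ⟨hfin f, hfin g⟩)) h
      rwa [ENNReal.toReal_mul, ENNReal.toReal_add (hfin f) (hfin g)] at h')
    (fun c f => by
      have h := hardyNorm_smul_le (μ := μ) (ℱ := ℱ) hq hqp c (f : ℕ → Ω → 𝕜)
      have h' := ENNReal.toReal_mono (ENNReal.mul_ne_top enorm_ne_top (hfin f)) h
      rwa [ENNReal.toReal_mul, toReal_enorm] at h')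
    (fun f g => by
      simp only [hN]
      rw [hardyNorm_eq_zero hq hqp, ENNReal.toReal_zero]
      intro n
      filter_upwards [condMart_add (ℱ := ℱ) (hp := hp) hq hqp hup f g n,
        condMart_add (ℱ := ℱ) (hp := hp) hq hqp hup f g (n + 1)] with x h1 h2
      change (condMart ℱ hp hq hqp hup (f + g) : ℕ → Ω → 𝕜) (n + 1) x -
          ((condMart ℱ hp hq hqp hup f : ℕ → Ω → 𝕜) (n + 1) +
            (condMart ℱ hp hq hqp hup g : ℕ → Ω → 𝕜) (n + 1)) x =
        (condMart ℱ hp hq hqp hup (f + g) : ℕ → Ω → 𝕜) n x -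
          ((condMart ℱ hp hq hqp hup f : ℕ → Ω → 𝕜) n +
            (condMart ℱ hp hq hqp hup g : ℕ → Ω → 𝕜) n) x
      rw [h1, h2, sub_self, sub_self])
    (fun c f => by
      simp only [hN]
      rw [hardyNorm_eq_zero hq hqp, ENNReal.toReal_zero]
      intro n
      filter_upwards [condMart_smul (ℱ := ℱ) (hp := hp) hq hqp hup c f n,
        condMart_smul (ℱ := ℱ) (hp := hp) hq hqp hup c f (n + 1)] with x h1 h2
      change (condMart ℱ hp hq hqp hup (c • f) : ℕ → Ω → 𝕜) (n + 1) x -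
          (c • (condMart ℱ hp hq hqp hup f : ℕ → Ω → 𝕜) (n + 1)) x =
        (condMart ℱ hp hq hqp hup (c • f) : ℕ → Ω → 𝕜) n x -
          (c • (condMart ℱ hp hq hqp hup f : ℕ → Ω → 𝕜) n) x
      rw [h1, h2, sub_self, sub_self])
    (fun f => by
      have h := enorm_integral_mul_le_hardyNorm hC hp hq hqp hup (Lp.memLp f) hφ hφm hφ0
      have h' := ENNReal.toReal_mono
        (ENNReal.mul_ne_top hBt (hfin (condMart ℱ hp hq hqp hup f))) h
      rwa [ENNReal.toReal_mul, toReal_enorm] at h')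
    (fun f ε hε => by
      obtain ⟨g, hlt⟩ := exists_hardyNorm_sub_condMart_lt hq hqp hup f (ENNReal.ofReal_pos.2 hε)
      exact ⟨g, ENNReal.toReal_lt_of_lt_ofReal hlt⟩)
  refine ⟨l, hl1, dualNorm_le fun f => ?_⟩
  have h := ENNReal.ofReal_le_ofReal (hl2 f)
  rw [ofReal_norm, ENNReal.ofReal_mul (by positivity), ENNReal.ofReal_mul ENNReal.toReal_nonneg,
    ENNReal.ofReal_toReal hBt, ENNReal.ofReal_toReal (hfin f), ENNReal.ofReal_pow (by positivity),
    ENNReal.ofReal_coe_nnreal] at h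
  refine h.trans (le_of_eq ?_)
  rw [hBdef]
  push_cast
  ring

end VarHardy

namespace VarHardy

variable {Ω : Type*} {m : MeasurableSpace Ω} {𝕜 : Type*} [RCLike 𝕜] {μ : Measure Ω}
  {ℱ : Filtration ℕ m} {p : Ω → ℝ} {q : ℝ} {C : ℝ≥0}

/-! ### Representation of the bounded functionals -/

theorem integral_toLp_mul {f : Ω → 𝕜} (hf : MemLp f 2 μ) (φ : Ω → 𝕜) :
    ∫ x, hf.toLp f x * φ x ∂μ = ∫ x, f x * φ x ∂μ := by
  refine integral_congr_ae ?_
  filter_upwards [hf.coeFn_toLp] with x hx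
  rw [hx]

theorem exists_forall_eq_integral_mul (L : StrongDual 𝕜 (Lp 𝕜 2 μ)) :
    ∃ φ : Lp 𝕜 2 μ, ∀ f : Lp 𝕜 2 μ, L f = ∫ x, f x * φ x ∂μ := by
  -- The pairing is bilinear while Riesz gives an inner product, hence the conjugate.
  refine ⟨star ((InnerProductSpace.toDual 𝕜 (Lp 𝕜 2 μ)).symm L), fun f => ?_⟩
  rw [← InnerProductSpace.toDual_symm_apply (y := L), L2.inner_def]
  refine integral_congr_ae ?_
  filter_upwards [Lp.coeFn_star ((InnerProductSpace.toDual 𝕜 (Lp 𝕜 2 μ)).symm L)] with x hx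
  rw [hx, RCLike.inner_apply]
  rfl

variable [IsProbabilityMeasure μ] {hp : Measurable p}

theorem apply_condExp_eq (hq : 0 < q) (hqp : ∀ x, q ≤ p x) (hup : ∀ x, p x ≤ 1)
    {l : Module.Dual 𝕜 (hardySpace 𝕜 μ ℱ p hp)} (hl : dualNorm l < ∞) {f : Ω → 𝕜}
    (hf : MemLp f 2 μ) :
    l ⟨fun n => μ[f|ℱ n], condExp_mem_hardySpace hp hq hqp hup hf⟩ =
      l (condMart ℱ hp hq hqp hup (hf.toLp f)) := by
  refine apply_eq_of_ae_eq hq hqp hl fun n => ?_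
  have h := fun n => condExp_congr_ae (m := ℱ n) hf.coeFn_toLp
  filter_upwards [h n, h (n + 1)] with x h1 h2
  simp only [Pi.sub_apply, condMart, h1, h2, sub_self]

theorem exists_memLp_representation (hC : IndicatorComparison μ p C) (hq : 0 < q)
    (hqp : ∀ x, q ≤ p x) (hup : ∀ x, p x ≤ 1) {l : Module.Dual 𝕜 (hardySpace 𝕜 μ ℱ p hp)}
    (hl : dualNorm l < ∞) :
    ∃ φ : Lp 𝕜 2 μ, ∀ f : Lp 𝕜 2 μ,
      l (condMart ℱ hp hq hqp hup f) = ∫ x, f x * φ x ∂μ := by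
  obtain ⟨C', hC'⟩ := exists_hardyNorm_condExp_le (𝕜 := 𝕜) hC
  set L : Lp 𝕜 2 μ →ₗ[𝕜] 𝕜 :=
    { toFun := fun f => l (condMart ℱ hp hq hqp hup f)
      map_add' := fun f g => by
        rw [← map_add]
        refine apply_eq_of_ae_eq hq hqp hl fun n => ?_
        filter_upwards [condMart_add (ℱ := ℱ) (hp := hp) hq hqp hup f g n,
          condMart_add (ℱ := ℱ) (hp := hp) hq hqp hup f g (n + 1)] with x h1 h2
        rw [Pi.sub_apply, Pi.sub_apply, h1, h2]
        exact (sub_self _).trans (sub_self _).symm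
      map_smul' := fun c f => by
        rw [RingHom.id_apply, ← map_smul]
        refine apply_eq_of_ae_eq hq hqp hl fun n => ?_
        filter_upwards [condMart_smul (ℱ := ℱ) (hp := hp) hq hqp hup c f n,
          condMart_smul (ℱ := ℱ) (hp := hp) hq hqp hup c f (n + 1)] with x h1 h2
        rw [Pi.sub_apply, Pi.sub_apply, h1, h2]
        exact (sub_self _).trans (sub_self _).symm } with hL
  refine exists_forall_eq_integral_mul (L.mkContinuous ((dualNorm l).toReal * C') fun f => ?_)
  have h : ‖L f‖ₑ ≤ dualNorm l * (C' * eLpNorm f 2 μ) :=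
    (enorm_le_dualNorm_mul hq hqp l hl _).trans (mul_le_mul' le_rfl (hC' ℱ f (Lp.memLp f)))
  have h' := ENNReal.toReal_mono (ENNReal.mul_ne_top hl.ne
    (ENNReal.mul_ne_top ENNReal.coe_ne_top (Lp.memLp f).2.ne)) h
  rwa [ENNReal.toReal_mul, ENNReal.toReal_mul, toReal_enorm, ← mul_assoc, ← Lp.norm_def] at h'

/-- Replacing f by its conditional expectation on the limit σ-algebra leaves every E(f | F_n)
unchanged, hence also the value of l. By self-adjointness φ and its conditional expectation then
pair alike with every f. -/
theorem ae_eq_condExp_of_representation (hq : 0 < q) (hqp : ∀ x, q ≤ p x)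
    (hup : ∀ x, p x ≤ 1) {l : Module.Dual 𝕜 (hardySpace 𝕜 μ ℱ p hp)} (hl : dualNorm l < ∞)
    {φ : Lp 𝕜 2 μ}
    (h : ∀ f : Lp 𝕜 2 μ, l (condMart ℱ hp hq hqp hup f) = ∫ x, f x * φ x ∂μ) :
    μ[φ|⨆ n, ℱ n] =ᵐ[μ] φ := by
  have hle : (⨆ n, ℱ n) ≤ m := iSup_le ℱ.le
  have hφ := Lp.memLp φ
  have hφ' : MemLp (μ[φ|⨆ n, ℱ n]) 2 μ := hφ.condExp (by norm_num)
  have h0 : μ[φ|⨆ n, ℱ n] - (φ : Ω → 𝕜) =ᵐ[μ] 0 := by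
    refine ae_eq_zero_of_integral_mul_eq_zero (hφ'.sub hφ) fun f hf => ?_
    have hf' : MemLp (μ[f|⨆ n, ℱ n]) 2 μ := hf.condExp (by norm_num)
    have e3 : l (condMart ℱ hp hq hqp hup (hf'.toLp _)) =
        l (condMart ℱ hp hq hqp hup (hf.toLp f)) := by
      rw [← apply_condExp_eq hq hqp hup hl, ← apply_condExp_eq hq hqp hup hl]
      refine apply_eq_of_ae_eq hq hqp hl fun n => ?_
      have ht := fun n => condExp_condExp_of_le (μ := μ) (f := f) (le_iSup ℱ n) hle
      filter_upwards [ht n, ht (n + 1)] with x h1 h2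
      simp only [Pi.sub_apply, h1, h2, sub_self]
    simp_rw [Pi.sub_apply, mul_sub]
    rw [integral_sub (integrable_mul_of_memLp_two hf hφ') (integrable_mul_of_memLp_two hf hφ),
      integral_mul_condExp hle hf hφ, ← integral_toLp_mul hf',
      ← integral_toLp_mul hf, ← h, ← h, e3, sub_self]
  filter_upwards [h0] with x hx
  exact sub_eq_zero.1 hx

/-- For f replaced by E(f | F_0) the martingale is constant in time, so every bounded functional
kills it. -/
theorem condExp_zero_eq_zero_of_representation (hq : 0 < q) (hqp : ∀ x, q ≤ p x)
    (hup : ∀ x, p x ≤ 1) {l : Module.Dual 𝕜 (hardySpace 𝕜 μ ℱ p hp)} (hl : dualNorm l < ∞)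
    {φ : Lp 𝕜 2 μ}
    (h : ∀ f : Lp 𝕜 2 μ, l (condMart ℱ hp hq hqp hup f) = ∫ x, f x * φ x ∂μ) :
    μ[φ|ℱ 0] =ᵐ[μ] 0 := by
  have hφ := Lp.memLp φ
  refine ae_eq_zero_of_integral_mul_eq_zero (hφ.condExp (by norm_num)) fun f hf => ?_
  have hf' : MemLp (μ[f|ℱ 0]) 2 μ := hf.condExp (by norm_num)
  rw [integral_mul_condExp (ℱ.le 0) hf hφ, ← integral_toLp_mul hf', ← h,
    ← apply_condExp_eq hq hqp hup hl, ← map_zero l]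
  refine apply_eq_of_ae_eq hq hqp hl fun n => Eventually.of_forall fun x => ?_
  have ht : ∀ n, μ[μ[f|ℱ 0]|ℱ n] = μ[f|ℱ 0] := fun n =>
    condExp_of_stronglyMeasurable (ℱ.le n)
      (stronglyMeasurable_condExp.mono (ℱ.mono (Nat.zero_le n))) integrable_condExp
  simp only [Pi.sub_apply, ht]
  rfl

theorem lipNorm_le_of_representation (hC : IndicatorComparison μ p C) (hq : 0 < q)
    (hqp : ∀ x, q ≤ p x) (hup : ∀ x, p x ≤ 1) {l : Module.Dual 𝕜 (hardySpace 𝕜 μ ℱ p hp)}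
    (hl : dualNorm l < ∞) {φ : Lp 𝕜 2 μ} (hφm : AEStronglyMeasurable[⨆ n, ℱ n] φ μ)
    (h : ∀ f : Lp 𝕜 2 μ, l (condMart ℱ hp hq hqp hup f) = ∫ x, f x * φ x ∂μ) :
    lipNorm μ ℱ p φ ≤ 2 * C * dualNorm l := by
  refine lipNorm_le_of_bound hC (Lp.memLp φ) hφm fun f hf => ?_
  rw [← integral_toLp_mul hf, ← h, ← apply_condExp_eq hq hqp hup hl]
  exact enorm_le_dualNorm_mul hq hqp l hl _

theorem exists_linearEquiv (hC : IndicatorComparison μ p C) (hq : 0 < q)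
    (hqp : ∀ x, q ≤ p x) (hup : ∀ x, p x ≤ 1) :
    ∃ Φ : lipSpace 𝕜 μ ℱ p ≃ₗ[𝕜] hardyDual 𝕜 μ ℱ p hp,
      (∀ (φ : lipSpace 𝕜 μ ℱ p) (f : Lp 𝕜 2 μ),
        (Φ φ : Module.Dual 𝕜 (hardySpace 𝕜 μ ℱ p hp)) (condMart ℱ hp hq hqp hup f) =
          ∫ x, f x * (φ : Lp 𝕜 2 μ) x ∂μ) ∧
      ∀ φ : lipSpace 𝕜 μ ℱ p,
        dualNorm (Φ φ : Module.Dual 𝕜 (hardySpace 𝕜 μ ℱ p hp)) ≤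
          (4 * C * (2 * dilConst q) ^ 3 : ℝ≥0) * lipNorm μ ℱ p ((φ : Lp 𝕜 2 μ) : Ω → 𝕜) := by
  -- The functionals are chosen separately for each φ; uniqueness on the dense subspace makes the
  -- choice linear.
  choose l hl1 hl2 using fun φ : lipSpace 𝕜 μ ℱ p =>
    exists_functional (hp := hp) hC hq hqp hup φ
  have hl : ∀ φ, l φ ∈ hardyDual 𝕜 μ ℱ p hp := fun φ =>
    (hl2 φ).trans_lt (ENNReal.mul_lt_top ENNReal.coe_lt_top φ.2.2.2)
  set T : lipSpace 𝕜 μ ℱ p →ₗ[𝕜] hardyDual 𝕜 μ ℱ p hp :=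
    { toFun := fun φ => ⟨l φ, hl φ⟩
      map_add' := fun φ ψ => by
        refine Subtype.ext (hardyDual_ext hq hqp hup (hl _)
          (Submodule.add_mem _ (hl φ) (hl ψ)) fun f => ?_)
        change l (φ + ψ) _ = l φ _ + l ψ _
        rw [hl1, hl1, hl1, ← integral_add
          (integrable_mul_of_memLp_two (Lp.memLp f) (Lp.memLp _))
          (integrable_mul_of_memLp_two (Lp.memLp f) (Lp.memLp _))]
        refine integral_congr_ae ?_
        filter_upwards [Lp.coeFn_add (φ : Lp 𝕜 2 μ) (ψ : Lp 𝕜 2 μ)] with x hx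
        rw [Submodule.coe_add, hx, Pi.add_apply, mul_add]
      map_smul' := fun c φ => by
        refine Subtype.ext (hardyDual_ext hq hqp hup (hl _)
          (Submodule.smul_mem _ c (hl φ)) fun f => ?_)
        change l (c • φ) _ = c • l φ _
        rw [hl1, hl1, smul_eq_mul, ← integral_const_mul]
        refine integral_congr_ae ?_
        filter_upwards [Lp.coeFn_smul c (φ : Lp 𝕜 2 μ)] with x hx
        rw [Submodule.coe_smul, hx, Pi.smul_apply, smul_eq_mul, mul_left_comm] } with hT
  have hinj : Function.Injective T := by
    rw [injective_iff_map_eq_zero]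
    intro φ h0
    have h1 : l φ = 0 := congrArg Subtype.val h0
    refine Subtype.ext (Lp.ext ((ae_eq_zero_of_integral_mul_eq_zero (Lp.memLp _)
      fun f hf => ?_).trans (Lp.coeFn_zero 𝕜 2 μ).symm))
    have h2 := hl1 φ (hf.toLp f)
    rw [h1, LinearMap.zero_apply] at h2
    rw [h2, integral_toLp_mul hf]
  have hsurj : Function.Surjective T := by
    rintro ⟨k, hk⟩
    obtain ⟨φ, hφ⟩ := exists_memLp_representation hC hq hqp hup hk
    have hφm : AEStronglyMeasurable[⨆ n, ℱ n] φ μ :=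
      ⟨_, stronglyMeasurable_condExp, (ae_eq_condExp_of_representation hq hqp hup hk hφ).symm⟩
    refine ⟨⟨φ, hφm, condExp_zero_eq_zero_of_representation hq hqp hup hk hφ,
      (lipNorm_le_of_representation hC hq hqp hup hk hφm hφ).trans_lt (ENNReal.mul_lt_top
        (ENNReal.mul_lt_top (by norm_num) ENNReal.coe_lt_top) hk)⟩, ?_⟩
    exact Subtype.ext (hardyDual_ext hq hqp hup (hl _) hk fun f => (hl1 _ f).trans (hφ f).symm)
  exact ⟨LinearEquiv.ofBijective T ⟨hinj, hsurj⟩, hl1, hl2⟩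

end VarHardy

/-! ### The duality theorem. -/

theorem mainTheorem4 {Ω : Type*} {m : MeasurableSpace Ω} (μ : MeasureTheory.Measure Ω)
    [MeasureTheory.IsProbabilityMeasure μ] (𝕜 : Type*) [RCLike 𝕜]
    (p : Ω → ℝ) (hp : Measurable p) (hpos : ∀ x, 0 < p x)
    (hlow : 0 < VarHardy.lowerExp p Set.univ) (hup : ∀ x, p x ≤ 1)
    (hcond : VarHardy.OscillationCondition μ p) :
    ∃ c C : ℝ≥0, 0 < c ∧ 0 < C ∧ ∀ ℱ : MeasureTheory.Filtration ℕ m,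
      ∃ Φ : VarHardy.lipSpace 𝕜 μ ℱ p ≃ₗ[𝕜] VarHardy.hardyDual 𝕜 μ ℱ p hp,
        (∀ (φ : VarHardy.lipSpace 𝕜 μ ℱ p) (f : Ω → 𝕜), MeasureTheory.MemLp f 2 μ →
          ∃ hf : (fun n => MeasureTheory.condExp (ℱ n) μ f) ∈ VarHardy.hardySpace 𝕜 μ ℱ p hp,
            (Φ φ : Module.Dual 𝕜 (VarHardy.hardySpace 𝕜 μ ℱ p hp)) ⟨_, hf⟩ =
              ∫ ω, f ω * (φ : MeasureTheory.Lp 𝕜 2 μ) ω ∂μ) ∧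
        ∀ φ : VarHardy.lipSpace 𝕜 μ ℱ p,
          c * VarHardy.lipNorm μ ℱ p ((φ : MeasureTheory.Lp 𝕜 2 μ) : Ω → 𝕜) ≤
              VarHardy.dualNorm (Φ φ : Module.Dual 𝕜 (VarHardy.hardySpace 𝕜 μ ℱ p hp)) ∧
            VarHardy.dualNorm (Φ φ : Module.Dual 𝕜 (VarHardy.hardySpace 𝕜 μ ℱ p hp)) ≤
              C * VarHardy.lipNorm μ ℱ p ((φ : MeasureTheory.Lp 𝕜 2 μ) : Ω → 𝕜) := by
  have hqp : ∀ x, VarHardy.lowerExp p univ ≤ p x := fun x =>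
    csInf_le ⟨0, by rintro _ ⟨y, -, rfl⟩; exact (hpos y).le⟩ ⟨x, mem_univ x, rfl⟩
  obtain ⟨C, hC0, hC⟩ := hcond.exists_const hp hlow hqp hup
  -- Both constants are built from the comparison constant and p_- alone, and are fixed before the
  -- filtration.
  refine ⟨(2 * C)⁻¹, 4 * C * (2 * VarHardy.dilConst (VarHardy.lowerExp p univ)) ^ 3,
    by positivity, ?_, fun ℱ => ?_⟩
  · have := VarHardy.dilConst_pos (VarHardy.lowerExp p univ)
    positivity
  obtain ⟨Φ, hΦ, hle⟩ := VarHardy.exists_linearEquiv (𝕜 := 𝕜) (ℱ := ℱ) (hp := hp) hC hlow hqp hup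
  refine ⟨Φ, fun φ f hf => ⟨VarHardy.condExp_mem_hardySpace hp hlow hqp hup hf, ?_⟩,
    fun φ => ⟨?_, hle φ⟩⟩
  · rw [VarHardy.apply_condExp_eq hlow hqp hup (Φ φ).2 hf, hΦ]
    exact VarHardy.integral_toLp_mul hf _
  · have h := VarHardy.lipNorm_le_of_representation hC hlow hqp hup (Φ φ).2 φ.2.1 (hΦ φ)
    have h2 : (2 * C : ℝ≥0) ≠ 0 := by positivity
    rw [ENNReal.coe_inv h2, ← ENNReal.div_eq_inv_mul]
    refine ENNReal.div_le_of_le_mul ?_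
    rw [mul_comm]
    exact_mod_cast h
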